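/- **Theorem 3.2 (Mode stability on the real axis).** Let $M>0$ and $a,Q\in\mathbb R$ with $a^2+Q^2<M^2$. Put $r_\pm=M\pm\sqrt{M^2-a^2-Q^2}$, $\Delta=r^2-2Mr+a^2+Q^2$, $\rho^2=r^2+a^2\cos^2\theta$, and let $r^*$ be a primitive of $(r^2+a^2)/\Delta$ on $(r_+,\infty)$. Let $\mathcal M=\{(t,r,\theta,\phi)\in\mathbb R\times(r_+,\infty)\times\mathbb S^2\}$ be the exterior of the subextremal Kerr–Newman black hole, with the metric $$g=-\frac{\Delta}{\rho^2}\big(dt-a\sin^2\theta\,d\phi\big)^2+\frac{\sin^2\theta}{\rho^2}\big((r^2+a^2)\,d\phi-a\,dt\big)^2+\frac{\rho^2}{\Delta}\,dr^2+\rho^2\,d\theta^2 .$$ A smooth solution $\psi:\mathcal M\to\mathbb C$ of the wave equation $\square_g\psi=0$ is called a *mode solution* with frequency $\omega\in\mathbb C\setminus\{0\}$ if there are $m\in\mathbb Z$, $\lambda\in\mathbb C$ and functions $R$ on $(r_+,\infty)$ and $S$ on $(0,\pi)$ such that $$\psi(t,r,\theta,\phi)=R(r)\,S(\theta)\,e^{im\phi}e^{-i\omega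 t}$$ and 1. $S$ is an eigenfunction (in particular $S\not\equiv0$) with eigenvalue $\lambda$ of $$\frac1{\sin\theta}\frac{d}{d\theta}\Big(\sin\theta\,\frac{dS}{d\theta}\Big)-\Big(\frac{m^2}{\sin^2\theta}-a^2\omega^2\cos^2\theta\Big)S+\lambda S=0\quad\text{on }(0,\pi),$$ with the boundary condition that $e^{im\phi}S(\theta)$ extends smoothly to $\mathbb S^2$; 2. $R$ solves, on $(r_+,\infty)$, $$\frac{d}{dr}\Big(\Delta\frac{dR}{dr}\Big)+\Big[-\omega^2\Big(a^2-\frac{(a^2+r^2)^2}{\Delta}\Big)+\frac{a^2m^2}{\Delta}-\frac{2am\omega(2Mr-Q^2)}{\Delta}-\lambda\Big]R=0;$$ 3. $R(r)\,(r-r_+)^{-\xi}$ is smooth at $r=r_+$, where $\xi=\dfrac{i\,(am-(2Mr_+-Q^2)\omega)}{r_+-r_-}$; 4. there are constants $(C_k)_{k\ge0}$ such that for every $N\ge1$, as $r\to\infty$, $$R(r)=\frac{e^{i\omega r^*(r)}}{r}\sum_{k=0}^N C_k\,r^{-k}+O(r^{-N-2}).$$ Then there are no non-trivial mode solutions with $\omega\in\mathbb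 R\setminus\{0\}$: every mode solution with real frequency $\omega\neq0$ vanishes identically on $\mathcal M$. -/

import Mathlib

namespace KerrNewman

open scoped Manifold Topology
open Filter Set

noncomputable section

/-- The outer root `r₊ = M + √(M² - a² - Q²)` of `Δ` (the radius of the event horizon). -/
def rPlus (M a Q : ℝ) : ℝ := M + Real.sqrt (M ^ 2 - a ^ 2 - Q ^ 2)

/-- The inner root `r₋ = M - √(M² - a² - Q²)` of `Δ`. -/
def rMinus (M a Q : ℝ) : ℝ := M - Real.sqrt (M ^ 2 - a ^ 2 - Q ^ 2)

/-- `Δ = r² - 2Mr + a² + Q²`. -/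
def Delta (M a Q r : ℝ) : ℝ := r ^ 2 - 2 * M * r + a ^ 2 + Q ^ 2

/-- `ρ² = r² + a² cos² θ`. -/
def rhoSq (a r θ : ℝ) : ℝ := r ^ 2 + a ^ 2 * Real.cos θ ^ 2

/-- The unit sphere in `ℝ³`. -/
abbrev S2 : Type := Metric.sphere (0 : EuclideanSpace ℝ (Fin 3)) 1

/-- The point of the unit sphere with polar angle `θ` and azimuth `φ`. -/
def spherePoint (θ φ : ℝ) : S2 :=
  ⟨!₂[Real.sin θ * Real.cos φ, Real.sin θ * Real.sin φ, Real.cos θ], by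
    rw [mem_sphere_zero_iff_norm, EuclideanSpace.norm_eq, Real.sqrt_eq_one]
    simp only [Fin.sum_univ_three, Real.norm_eq_abs, sq_abs]
    simp
    nlinarith [Real.sin_sq_add_cos_sq θ, Real.sin_sq_add_cos_sq φ]⟩

/-- The exterior `{(t, r, y) : r > r₊}`, `y` in the unit sphere. -/
def exterior (M a Q : ℝ) : Set (ℝ × ℝ × S2) := {p | rPlus M a Q < p.2.1}

/-- The Kerr–Newman metric in Boyer–Lindquist coordinates `x = (t, r, θ, φ)`:
`-(Δ/ρ²)(dt - a sin²θ dφ)² + (sin²θ/ρ²)((r²+a²)dφ - a dt)² + (ρ²/Δ)dr² + ρ² dθ²`. -/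
def metric (M a Q : ℝ) (x : Fin 4 → ℝ) : Matrix (Fin 4) (Fin 4) ℝ :=
  let r := x 1
  let θ := x 2
  let α : Fin 4 → ℝ := ![1, 0, 0, -(a * Real.sin θ ^ 2)]
  let β : Fin 4 → ℝ := ![-a, 0, 0, r ^ 2 + a ^ 2]
  (-(Delta M a Q r / rhoSq a r θ)) • Matrix.vecMulVec α α
    + (Real.sin θ ^ 2 / rhoSq a r θ) • Matrix.vecMulVec β β
    + Matrix.diagonal ![0, rhoSq a r θ / Delta M a Q r, rhoSq a r θ, 0]

/-- The coordinate partial derivative `∂_μ f`. -/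
def partialDeriv (μ : Fin 4) (f : (Fin 4 → ℝ) → ℂ) (x : Fin 4 → ℝ) : ℂ :=
  fderiv ℝ f x (Pi.single μ 1)

/-- The wave operator of a metric `g` in coordinates:
`□_g f = |det g|^{-1/2} ∂_μ (|det g|^{1/2} g^{μν} ∂_ν f)`. -/
def box (g : (Fin 4 → ℝ) → Matrix (Fin 4) (Fin 4) ℝ) (f : (Fin 4 → ℝ) → ℂ)
    (x : Fin 4 → ℝ) : ℂ :=
  (((Real.sqrt |(g x).det|)⁻¹ : ℝ) : ℂ) *
    ∑ μ, partialDeriv μ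
      (fun y => ((Real.sqrt |(g y).det| : ℝ) : ℂ) *
        ∑ ν, (((g y)⁻¹ μ ν : ℝ) : ℂ) * partialDeriv ν f y) x

/-- A function on the spacetime, written in Boyer–Lindquist coordinates `(t, r, θ, φ)`. -/
def inCoords (ψ : ℝ × ℝ × S2 → ℂ) (x : Fin 4 → ℝ) : ℂ :=
  ψ (x 0, x 1, spherePoint (x 2) (x 3))

/-- `ψ` is a smooth solution of the wave equation `□_g ψ = 0` on the exterior. (The equation is
imposed off the axis, where the coordinates are regular; by continuity this is no restriction.) -/
def IsSmoothWave (M a Q : ℝ) (ψ : ℝ × ℝ × S2 → ℂ) : Prop :=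
  ContMDiffOn (𝓘(ℝ, ℝ).prod (𝓘(ℝ, ℝ).prod (𝓡 2))) 𝓘(ℝ, ℂ)
    ((⊤ : ℕ∞) : WithTop ℕ∞) ψ (exterior M a Q) ∧
  ∀ x : Fin 4 → ℝ, rPlus M a Q < x 1 → x 2 ∈ Ioo 0 Real.pi →
    box (metric M a Q) (inCoords ψ) x = 0

/-- The tortoise coordinate `r*`, a primitive of `(r² + a²)/Δ` on `(r₊, ∞)`. -/
def rStar (M a Q r : ℝ) : ℝ :=
  r + (rPlus M a Q ^ 2 + a ^ 2) / (rPlus M a Q - rMinus M a Q) * Real.log (r - rPlus M a Q)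
    - (rMinus M a Q ^ 2 + a ^ 2) / (rPlus M a Q - rMinus M a Q) * Real.log (r - rMinus M a Q)

theorem hasDerivAt_rStar {M a Q r : ℝ} (h : a ^ 2 + Q ^ 2 < M ^ 2) (hr : rPlus M a Q < r) :
    HasDerivAt (rStar M a Q) ((r ^ 2 + a ^ 2) / Delta M a Q r) r := by
  have hs : 0 < Real.sqrt (M ^ 2 - a ^ 2 - Q ^ 2) := Real.sqrt_pos.2 (by linarith)
  have hs2 : Real.sqrt (M ^ 2 - a ^ 2 - Q ^ 2) ^ 2 = M ^ 2 - a ^ 2 - Q ^ 2 :=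
    Real.sq_sqrt (by linarith)
  have hD : Delta M a Q r = (r - rPlus M a Q) * (r - rMinus M a Q) := by
    unfold Delta rPlus rMinus
    linear_combination hs2
  have hpm : rPlus M a Q - rMinus M a Q ≠ 0 := by
    unfold rPlus rMinus
    linarith
  have hp : r - rPlus M a Q ≠ 0 := by linarith
  have hm : r - rMinus M a Q ≠ 0 := by
    unfold rPlus at hr
    unfold rMinus
    linarith
  have key := ((hasDerivAt_id r).add ((((hasDerivAt_id r).sub_const (rPlus M a Q)).log hp).const_mul
    ((rPlus M a Q ^ 2 + a ^ 2) / (rPlus M a Q - rMinus M a Q)))).sub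
    ((((hasDerivAt_id r).sub_const (rMinus M a Q)).log hm).const_mul
    ((rMinus M a Q ^ 2 + a ^ 2) / (rPlus M a Q - rMinus M a Q)))
  refine key.congr_deriv ?_
  rw [hD]
  simp only [id]
  field_simp
  ring

/-- `S` is an eigenfunction with eigenvalue `lam` of the angular Sturm–Liouville problem
`(1/sin θ) d/dθ (sin θ dS/dθ) - (m²/sin²θ - a²ω²cos²θ) S + lam S = 0` on `(0, π)`, with the boundary
condition that `e^{imφ} S(θ)` extends smoothly to the sphere. -/
structure IsAngularEigenfunction (a : ℝ) (ω : ℂ) (m : ℤ) (lam : ℂ) (S : ℝ → ℂ) : Prop where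
  contDiffOn : ContDiffOn ℝ 2 S (Ioo 0 Real.pi)
  ode : ∀ θ ∈ Ioo 0 Real.pi,
    1 / (Real.sin θ : ℂ) * deriv (fun s : ℝ => (Real.sin s : ℂ) * deriv S s) θ
      - ((m : ℂ) ^ 2 / (Real.sin θ : ℂ) ^ 2 - (a : ℂ) ^ 2 * ω ^ 2 * (Real.cos θ : ℂ) ^ 2) * S θ
      + lam * S θ = 0
  smooth_extension : ∃ Y : S2 → ℂ, ContMDiff (𝓡 2) 𝓘(ℝ, ℂ) ((⊤ : ℕ∞) : WithTop ℕ∞) Y ∧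
    ∀ θ ∈ Ioo 0 Real.pi, ∀ φ : ℝ,
      Y (spherePoint θ φ) = Complex.exp (Complex.I * m * φ) * S θ
  nonzero : ∃ θ ∈ Ioo 0 Real.pi, S θ ≠ 0

/-- `R` is a (classical) solution on `(r₊, ∞)` of the radial equation. -/
structure IsRadialSolution (M a Q : ℝ) (ω : ℂ) (m : ℤ) (lam : ℂ) (R : ℝ → ℂ) : Prop where
  contDiffOn : ContDiffOn ℝ 2 R (Ioi (rPlus M a Q))
  ode : ∀ r > rPlus M a Q,
    deriv (fun s : ℝ => (Delta M a Q s : ℂ) * deriv R s) r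
      + (-(ω ^ 2 * ((a : ℂ) ^ 2 - ((a : ℂ) ^ 2 + (r : ℂ) ^ 2) ^ 2 / (Delta M a Q r : ℂ)))
        + (a : ℂ) ^ 2 * (m : ℂ) ^ 2 / (Delta M a Q r : ℂ)
        - 2 * a * m * ω * (2 * M * r - (Q : ℂ) ^ 2) / (Delta M a Q r : ℂ)
        - lam) * R r = 0

/-- The exponent `i(am - (2Mr₊ - Q²)ω)/(r₊ - r₋)`. -/
def horizonExponent (M a Q : ℝ) (ω : ℂ) (m : ℤ) : ℂ :=
  Complex.I * (a * m - (2 * M * rPlus M a Q - (Q : ℂ) ^ 2) * ω) /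
    ((rPlus M a Q - rMinus M a Q : ℝ) : ℂ)

/-- The boundary condition at the horizon: `R(r) (r - r₊)^{-ξ}`, with `ξ` the horizon exponent,
is smooth at `r = r₊`, i.e. it agrees for `r > r₊` near `r₊` with a function smooth at `r₊`. -/
def RegularAtHorizon (M a Q : ℝ) (ω : ℂ) (m : ℤ) (R : ℝ → ℂ) : Prop :=
  ∃ f : ℝ → ℂ, ContDiffAt ℝ ((⊤ : ℕ∞) : WithTop ℕ∞) f (rPlus M a Q) ∧
    ∀ᶠ r in 𝓝[>] (rPlus M a Q),
      R r * ((r - rPlus M a Q : ℝ) : ℂ) ^ (-horizonExponent M a Q ω m) = f r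

/-- The boundary condition at infinity: there are constants `C k` such that for every `N ≥ 1`,
`R = (e^{iωr*}/r) ∑_{k=0}^N C k r^{-k} + O(r^{-N-2})` for large `r`. -/
def OutgoingAtInfinity (M a Q : ℝ) (ω : ℂ) (R : ℝ → ℂ) : Prop :=
  ∃ C : ℕ → ℂ, ∀ N : ℕ, 1 ≤ N →
    (fun r : ℝ => R r - Complex.exp (Complex.I * ω * rStar M a Q r) / r *
        ∑ k ∈ Finset.range (N + 1), C k * ((r : ℂ) ^ k)⁻¹)
      =O[atTop] fun r : ℝ => (r ^ (N + 2))⁻¹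

/-- `ψ` is a mode solution of the wave equation with frequency `ω ≠ 0`: a smooth solution of the
form `ψ = R(r) S(θ) e^{imφ} e^{-iωt}`, where `S` is an eigenfunction of the angular problem, `R`
solves the radial equation with the same eigenvalue, and `R` satisfies the boundary conditions at
the horizon and at infinity. The label `ℓ ≥ |m|` only enumerates the eigenvalues for given `m`,
so here the eigenvalue `lam` itself is quantified over. -/
def IsModeSolution (M a Q : ℝ) (ψ : ℝ × ℝ × S2 → ℂ) (ω : ℂ) : Prop :=
  IsSmoothWave M a Q ψ ∧ ω ≠ 0 ∧
  ∃ (m : ℤ) (lam : ℂ) (R S : ℝ → ℂ),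
    (∀ t : ℝ, ∀ r > rPlus M a Q, ∀ θ ∈ Ioo 0 Real.pi, ∀ φ : ℝ,
      ψ (t, r, spherePoint θ φ) =
        R r * S θ * Complex.exp (Complex.I * m * φ) * Complex.exp (-(Complex.I * ω * t))) ∧
    IsAngularEigenfunction a ω m lam S ∧
    IsRadialSolution M a Q ω m lam R ∧
    RegularAtHorizon M a Q ω m R ∧
    OutgoingAtInfinity M a Q ω R

end

end KerrNewman

/-!
Put `z = (r - r₊) / (r₊ - r₋)` and `f(z) = e^{iφ(z)} R(r)` for an explicit real phase `φ`. Then `f`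
solves a confluent Heun equation with real parameters `α`, `γ`, `Ω = 2ω(r₊ - r₋)`, `Λ`; it equals
`z^{2iα} h(z)` with `h` of class `C²` at the horizon, and `(1 + z) f` has a limit at infinity.

At superradiant frequencies the energy flux of the mode through the horizon has the wrong sign.
Whiting's integral transform removes this obstruction: the Laplace transform `F` of `f`, taken along
the line `p = iΩv - ε`, solves a second order equation in `v` whose flux is conserved up to `O(ε)`.
In the limit `ε → 0` the flux at `v = 1` is `(α + γ) |F(1)|²`, whereas for large `v` it is
`(Ω / 2) v² |F(v)|²`, which tends to a positive multiple of `Ω |h(0)|²`. As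
`Ω (α + γ) = -4 M ω² (r₊ - r₋) ≤ 0`, this forces `h(0) = 0`, and `f = 0` follows because the
exponents of the equation at `z = 0` are purely imaginary.

The eigenvalue `λ` is real because the angular problem is self-adjoint, and `ψ` vanishes on the
rotation axis, where the separated form is not available, by continuity.
-/

namespace ConfluentHeun

open Asymptotics Filter MeasureTheory Set
open scoped ComplexConjugate Topology

section DecayAtInfinity

variable {E : Type*} [NormedAddCommGroup E] [NormedSpace ℝ E]

theorem smul_norm_deriv_le {g g₁ g₂ : ℝ → E} {C z η : ℝ} (hη : 0 ≤ η)
    (hg : ∀ t ≥ z, HasDerivAt g (g₁ t) t) (hg₁ : ∀ t ≥ z, HasDerivAt g₁ (g₂ t) t)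
    (hC : ∀ t ≥ z, ‖g₂ t‖ ≤ C) : η * ‖g₁ z‖ ≤ ‖g (z + η) - g z‖ + C * η * η := by
  have hC0 : 0 ≤ C := (norm_nonneg _).trans (hC z le_rfl)
  have hleft : z ∈ Icc z (z + η) := left_mem_Icc.2 (by linarith)
  have hb : ∀ t ∈ Icc z (z + η), ‖g₁ t - g₁ z‖ ≤ C * η := fun t ht =>
    ((convex_Icc z (z + η)).norm_image_sub_le_of_norm_hasDerivWithin_le
      (fun s hs => (hg₁ s hs.1).hasDerivWithinAt) (fun s hs => hC s hs.1) hleft ht).trans <| by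
        rw [Real.norm_of_nonneg (by linarith [ht.1])]
        gcongr
        linarith [ht.2]
  have hd : ∀ t ∈ Icc z (z + η), HasDerivWithinAt (fun t : ℝ => g t - t • g₁ z)
      (g₁ t - g₁ z) (Icc z (z + η)) t := fun t ht =>
    ((hg t ht.1).sub ((hasDerivAt_id t).smul_const (g₁ z))).hasDerivWithinAt.congr_deriv (by simp)
  have key := (convex_Icc z (z + η)).norm_image_sub_le_of_norm_hasDerivWithin_le hd hb hleft
    (right_mem_Icc.2 (by linarith))
  rw [add_sub_cancel_left, Real.norm_of_nonneg hη] at key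
  calc η * ‖g₁ z‖ = ‖η • g₁ z‖ := by rw [norm_smul, Real.norm_of_nonneg hη]
    _ = ‖(g (z + η) - g z) - (g (z + η) - (z + η) • g₁ z - (g z - z • g₁ z))‖ := by
      congr 1; module
    _ ≤ _ := (norm_sub_le _ _).trans (by gcongr)

theorem tendsto_deriv_zero {g g₁ g₂ : ℝ → E} {c : E}
    (hg : ∀ᶠ z in atTop, HasDerivAt g (g₁ z) z) (hg₁ : ∀ᶠ z in atTop, HasDerivAt g₁ (g₂ z) z)
    (hg₂ : g₂ =O[atTop] fun _ => (1 : ℝ)) (hc : Tendsto g atTop (𝓝 c)) :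
    Tendsto g₁ atTop (𝓝 0) := by
  obtain ⟨C, hC0, hC⟩ := hg₂.exists_pos
  rw [tendsto_zero_iff_norm_tendsto_zero, Metric.tendsto_nhds]
  intro ε hε
  obtain ⟨η, hη, hηε⟩ : ∃ η > 0, C * η = ε / 2 := ⟨ε / (2 * C), by positivity, by field_simp⟩
  have hdiff : Tendsto (fun z => ‖g (z + η) - g z‖) atTop (𝓝 0) := by
    simpa using ((hc.comp (tendsto_atTop_add_const_right atTop η tendsto_id)).sub hc).norm
  filter_upwards [eventually_forall_ge_atTop.2 hg, eventually_forall_ge_atTop.2 hg₁,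
    eventually_forall_ge_atTop.2 hC.bound,
    hdiff.eventually (gt_mem_nhds (by positivity : 0 < η * (ε / 2)))] with z h1 h2 h3 h4
  have h5 := smul_norm_deriv_le hη.le h1 h2 fun t ht => by simpa using h3 t ht
  rw [Real.dist_0_eq_abs, abs_norm]
  refine lt_of_mul_lt_mul_left (h5.trans_lt ?_) hη.le
  rw [hηε]
  linarith

variable [CompleteSpace E] {h h' : ℝ → E} {n : ℕ}

theorem eventually_integrableOn_Ioi_inv_pow (hn : n ≠ 0) :
    ∀ᶠ z : ℝ in atTop, IntegrableOn (fun t : ℝ => t⁻¹ ^ (n + 1)) (Ioi z) ∧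
      ∫ t in Ioi z, t⁻¹ ^ (n + 1) ≤ z⁻¹ ^ n := by
  have hn1 : (1 : ℝ) ≤ n := by exact_mod_cast Nat.one_le_iff_ne_zero.2 hn
  filter_upwards [eventually_gt_atTop 0] with z hz
  have heq : EqOn (fun t : ℝ => t ^ (-(n + 1 : ℝ))) (fun t => t⁻¹ ^ (n + 1)) (Ioi z) :=
    fun t ht => by
      have ht0 : 0 ≤ t := (hz.trans ht).le
      simp only [Real.rpow_neg ht0, inv_pow]
      exact_mod_cast congrArg (·⁻¹) (Real.rpow_natCast t (n + 1))
  refine ⟨(integrableOn_Ioi_rpow_of_lt (by linarith) hz).congr_fun heq measurableSet_Ioi, ?_⟩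
  rw [← setIntegral_congr_fun measurableSet_Ioi heq, integral_Ioi_rpow_of_lt (by linarith) hz,
    show -(n + 1 : ℝ) + 1 = -n by ring, neg_div_neg_eq, Real.rpow_neg hz.le, Real.rpow_natCast,
    inv_pow]
  exact div_le_self (by positivity) hn1

theorem exists_norm_deriv_le_and_integrableOn (hn : n ≠ 0)
    (hd : ∀ᶠ z in atTop, HasDerivAt h (h' z) z) (hO : h' =O[atTop] fun z : ℝ => z⁻¹ ^ (n + 1)) :
    ∃ C, ∀ᶠ z in atTop, (∀ t ≥ z, HasDerivAt h (h' t) t) ∧ IntegrableOn h' (Ioi z) ∧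
      ∫ t in Ioi z, ‖h' t‖ ≤ C * z⁻¹ ^ n := by
  obtain ⟨C, hC0, hC⟩ := hO.exists_nonneg
  refine ⟨C, ?_⟩
  filter_upwards [eventually_gt_atTop 0, eventually_forall_ge_atTop.2 hd,
    eventually_forall_ge_atTop.2 hC.bound,
    eventually_integrableOn_Ioi_inv_pow hn] with z hz hdz hCz hint
  have hbound : ∀ t ∈ Ioi z, ‖h' t‖ ≤ C * t⁻¹ ^ (n + 1) := fun t ht => by
    have ht0 : 0 < t := hz.trans ht
    simpa [abs_of_pos ht0] using hCz t (le_of_lt ht)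
  have hmeas : AEStronglyMeasurable h' (volume.restrict (Ioi z)) :=
    (aestronglyMeasurable_deriv h _).congr
      ((ae_restrict_mem measurableSet_Ioi).mono fun t ht => (hdz t (le_of_lt ht)).deriv)
  have hint' : IntegrableOn h' (Ioi z) := (hint.1.const_mul C).mono' hmeas
    ((ae_restrict_mem measurableSet_Ioi).mono hbound)
  refine ⟨hdz, hint', (setIntegral_mono_on hint'.norm (hint.1.const_mul C) measurableSet_Ioi
    hbound).trans ?_⟩
  rw [integral_const_mul]
  exact mul_le_mul_of_nonneg_left hint.2 hC0

theorem isBigO_one_of_deriv (hn : n ≠ 0) (hd : ∀ᶠ z in atTop, HasDerivAt h (h' z) z)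
    (hO : h' =O[atTop] fun z : ℝ => z⁻¹ ^ (n + 1)) : h =O[atTop] fun _ => (1 : ℝ) := by
  obtain ⟨C, hC⟩ := exists_norm_deriv_le_and_integrableOn hn hd hO
  obtain ⟨z, hdz, hint, -⟩ := hC.exists
  exact (tendsto_limUnder_of_hasDerivAt_of_integrableOn_Ioi
    (fun t ht => hdz t (le_of_lt ht)) hint).isBigO_one ℝ

theorem isBigO_inv_pow_of_deriv (hn : n ≠ 0) (hd : ∀ᶠ z in atTop, HasDerivAt h (h' z) z)
    (hO : h' =O[atTop] fun z : ℝ => z⁻¹ ^ (n + 1)) (h0 : Tendsto h atTop (𝓝 0)) :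
    h =O[atTop] fun z : ℝ => z⁻¹ ^ n := by
  obtain ⟨C, hC⟩ := exists_norm_deriv_le_and_integrableOn hn hd hO
  refine IsBigO.of_bound C ?_
  filter_upwards [eventually_gt_atTop 0, hC] with z hz ⟨hdz, hint, hle⟩
  rw [Real.norm_of_nonneg (by positivity), ← norm_neg, ← zero_sub,
    ← integral_Ioi_of_hasDerivAt_of_tendsto' hdz hint h0]
  exact (norm_integral_le_integral_norm _).trans hle

end DecayAtInfinity

section Transport

variable {w P G G₁ : ℝ → ℂ} {n : ℕ}

theorem eventually_hasDerivAt_weight_mul (hw : ∀ᶠ z in atTop, HasDerivAt w (w z * P z) z)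
    (hG : ∀ᶠ z in atTop, HasDerivAt G (G₁ z) z) :
    ∀ᶠ z in atTop, HasDerivAt (fun z => w z * G z) (w z * (G₁ z + P z * G z)) z := by
  filter_upwards [hw, hG] with z hwz hGz
  exact (hwz.mul hGz).congr_deriv (by ring)

theorem isTheta_weight_mul (hw1 : w =Θ[atTop] fun _ => (1 : ℂ)) (G : ℝ → ℂ) :
    (fun z => w z * G z) =Θ[atTop] G := by
  simpa using hw1.mul (isTheta_refl G atTop)

theorem isBigO_one_of_transport (hw : ∀ᶠ z in atTop, HasDerivAt w (w z * P z) z)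
    (hw1 : w =Θ[atTop] fun _ => (1 : ℂ)) (hG : ∀ᶠ z in atTop, HasDerivAt G (G₁ z) z)
    (hn : n ≠ 0) (hO : (fun z => G₁ z + P z * G z) =O[atTop] fun z : ℝ => z⁻¹ ^ (n + 1)) :
    G =O[atTop] fun _ => (1 : ℝ) :=
  (isTheta_weight_mul hw1 G).isBigO_congr_left.1 <|
    isBigO_one_of_deriv hn (eventually_hasDerivAt_weight_mul hw hG)
      ((isTheta_weight_mul hw1 _).isBigO_congr_left.2 hO)

theorem isBigO_inv_pow_of_transport (hw : ∀ᶠ z in atTop, HasDerivAt w (w z * P z) z)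
    (hw1 : w =Θ[atTop] fun _ => (1 : ℂ)) (hG : ∀ᶠ z in atTop, HasDerivAt G (G₁ z) z)
    (hn : n ≠ 0) (hO : (fun z => G₁ z + P z * G z) =O[atTop] fun z : ℝ => z⁻¹ ^ (n + 1))
    (h0 : Tendsto G atTop (𝓝 0)) : G =O[atTop] fun z : ℝ => z⁻¹ ^ n :=
  (isTheta_weight_mul hw1 G).isBigO_congr_left.1 <|
    isBigO_inv_pow_of_deriv hn (eventually_hasDerivAt_weight_mul hw hG)
      ((isTheta_weight_mul hw1 _).isBigO_congr_left.2 hO)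
      ((isTheta_weight_mul hw1 G).1.trans_tendsto h0)

end Transport

section SecondOrder

variable {g g₁ g₂ w P Q Q₁ : ℝ → ℂ} {κ c : ℂ}

theorem isBigO_inv_deriv_of_ode (hg : ∀ᶠ z in atTop, HasDerivAt g (g₁ z) z)
    (hg₁ : ∀ᶠ z in atTop, HasDerivAt g₁ (g₂ z) z)
    (hode : ∀ᶠ z in atTop, g₂ z + P z * g₁ z + Q z * g z = 0)
    (hw : ∀ᶠ z in atTop, HasDerivAt w (w z * P z) z) (hw1 : w =Θ[atTop] fun _ => (1 : ℂ))
    (hP : P =O[atTop] fun _ => (1 : ℝ)) (hQ : Q =O[atTop] fun z : ℝ => z⁻¹ ^ 2)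
    (hc : Tendsto g atTop (𝓝 c)) : g₁ =O[atTop] fun z : ℝ => z⁻¹ ^ 1 := by
  have hQg : (fun z => Q z * g z) =O[atTop] fun z : ℝ => z⁻¹ ^ 2 := by
    simpa using hQ.mul (hc.isBigO_one ℝ)
  have htransport : (fun z => g₂ z + P z * g₁ z) =O[atTop] fun z : ℝ => z⁻¹ ^ (1 + 1) :=
    hQg.neg_left.congr' (hode.mono fun z hz => by linear_combination -hz) .rfl
  have hg₁_bdd : g₁ =O[atTop] fun _ => (1 : ℝ) :=
    isBigO_one_of_transport hw hw1 hg₁ one_ne_zero htransport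
  have hg₂_bdd : g₂ =O[atTop] fun _ => (1 : ℝ) := by
    have hsq : (fun z : ℝ => z⁻¹ ^ 2) =O[atTop] fun _ => (1 : ℝ) := by
      simpa using ((tendsto_inv_atTop_zero (𝕜 := ℝ)).pow 2).isBigO_one ℝ
    have hPg₁ : (fun z => P z * g₁ z) =O[atTop] fun _ => (1 : ℝ) := by simpa using hP.mul hg₁_bdd
    exact ((hPg₁.add (hQg.trans hsq)).neg_left).congr'
      (hode.mono fun z hz => by linear_combination -hz) .rfl
  exact isBigO_inv_pow_of_transport hw hw1 hg₁ one_ne_zero htransport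
    (tendsto_deriv_zero hg hg₁ hg₂_bdd hc)

/- To leading order the equation reads `κ g' ≈ -Q g`; the corrected derivative `g' + κ⁻¹ Q g`
satisfies the first order equation up to `O(z⁻³)`. -/
theorem isBigO_inv_sq_deriv_of_ode (hg : ∀ᶠ z in atTop, HasDerivAt g (g₁ z) z)
    (hg₁ : ∀ᶠ z in atTop, HasDerivAt g₁ (g₂ z) z)
    (hode : ∀ᶠ z in atTop, g₂ z + P z * g₁ z + Q z * g z = 0)
    (hw : ∀ᶠ z in atTop, HasDerivAt w (w z * P z) z) (hw1 : w =Θ[atTop] fun _ => (1 : ℂ))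
    (hκ : κ ≠ 0) (hP : (fun z => P z - κ) =O[atTop] fun z : ℝ => z⁻¹)
    (hQ : Q =O[atTop] fun z : ℝ => z⁻¹ ^ 2) (hQ₁ : ∀ᶠ z in atTop, HasDerivAt Q (Q₁ z) z)
    (hQ₁O : Q₁ =O[atTop] fun z : ℝ => z⁻¹ ^ 3) (hc : Tendsto g atTop (𝓝 c)) :
    g₁ =O[atTop] fun z : ℝ => z⁻¹ ^ 2 := by
  have hinv : Tendsto (fun z : ℝ => z⁻¹) atTop (𝓝 0) := tendsto_inv_atTop_zero
  have hP_bdd : P =O[atTop] fun _ => (1 : ℝ) :=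
    ((hP.trans (hinv.isBigO_one ℝ)).add (isBigO_const_const κ one_ne_zero _)).congr_left
      fun z => sub_add_cancel _ _
  have hg₁O := isBigO_inv_deriv_of_ode hg hg₁ hode hw hw1 hP_bdd hQ hc
  have hQg : (fun z => κ⁻¹ * (Q z * g z)) =O[atTop] fun z : ℝ => z⁻¹ ^ 2 := by
    simpa using (hQ.mul (hc.isBigO_one ℝ)).const_mul_left κ⁻¹
  have hderiv : ∀ᶠ z in atTop, HasDerivAt (fun z => g₁ z + κ⁻¹ * (Q z * g z))
      (g₂ z + κ⁻¹ * (Q₁ z * g z + Q z * g₁ z)) z := by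
    filter_upwards [hg, hg₁, hQ₁] with z h1 h2 h3
    exact h2.add ((h3.mul h1).const_mul κ⁻¹)
  have htransport : (fun z => g₂ z + κ⁻¹ * (Q₁ z * g z + Q z * g₁ z)
      + P z * (g₁ z + κ⁻¹ * (Q z * g z))) =O[atTop] fun z : ℝ => z⁻¹ ^ (2 + 1) := by
    have h1 : (fun z => κ⁻¹ * (Q₁ z * g z)) =O[atTop] fun z : ℝ => z⁻¹ ^ (2 + 1) := by
      simpa using (hQ₁O.mul (hc.isBigO_one ℝ)).const_mul_left κ⁻¹
    have h2 : (fun z => κ⁻¹ * (Q z * g₁ z)) =O[atTop] fun z : ℝ => z⁻¹ ^ (2 + 1) := by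
      simpa only [← pow_add] using (hQ.mul hg₁O).const_mul_left κ⁻¹
    have h3 : (fun z => (P z - κ) * (κ⁻¹ * (Q z * g z))) =O[atTop] fun z : ℝ => z⁻¹ ^ (2 + 1) :=
      (hP.mul hQg).congr_right fun z => (pow_succ' _ 2).symm
    refine ((h1.add h2).add h3).congr' (hode.mono fun z hz => ?_) .rfl
    linear_combination -hz - Q z * g z * mul_inv_cancel₀ hκ
  have hlim : Tendsto (fun z => g₁ z + κ⁻¹ * (Q z * g z)) atTop (𝓝 0) := by
    simpa using (hg₁O.trans_tendsto (by simpa using hinv)).add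
      (hQg.trans_tendsto (by simpa using hinv.pow 2))
  exact ((isBigO_inv_pow_of_transport hw hw1 hderiv two_ne_zero htransport hlim).sub hQg).congr_left
    fun z => add_sub_cancel_right _ _

end SecondOrder

section Laplace

/-- Continuous functions on `(0, ∞)` that are bounded at `0` and of polynomial growth at infinity:
the domain of the Laplace transform below. -/
structure IsModerate (φ : ℝ → ℂ) : Prop where
  continuousOn : ContinuousOn φ (Ioi 0)
  isBigO_zero : φ =O[𝓝[>] 0] fun _ => (1 : ℝ)
  isBigO_atTop : ∃ n : ℕ, φ =O[atTop] fun z : ℝ => z ^ n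

/-- The Laplace transform, with the sign of the frequency variable chosen so that it converges for
`Re p < 0`. -/
noncomputable def laplace (φ : ℝ → ℂ) (p : ℂ) : ℂ :=
  ∫ z in Ioi (0 : ℝ), Complex.exp (p * z) * φ z

variable {φ χ : ℝ → ℂ} {p : ℂ}

theorem norm_exp_mul_ofReal (p : ℂ) (z : ℝ) : ‖Complex.exp (p * z)‖ = Real.exp (p.re * z) := by
  rw [Complex.norm_exp, Complex.re_mul_ofReal]

theorem isBigO_pow_pow_atTop {k n : ℕ} (h : k ≤ n) :
    (fun z : ℝ => z ^ k) =O[atTop] fun z : ℝ => z ^ n := by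
  refine IsBigO.of_bound 1 ?_
  filter_upwards [eventually_ge_atTop 1] with z hz
  rw [one_mul, Real.norm_of_nonneg (by positivity), Real.norm_of_nonneg (by positivity)]
  exact pow_le_pow_right₀ hz h

namespace IsModerate

theorem const (c : ℂ) : IsModerate fun _ => c where
  continuousOn := continuousOn_const
  isBigO_zero := isBigO_const_const c one_ne_zero _
  isBigO_atTop := ⟨0, by simpa using isBigO_const_const c (one_ne_zero (α := ℝ)) _⟩

theorem ofReal : IsModerate fun z => (z : ℂ) where
  continuousOn := Complex.continuous_ofReal.continuousOn
  isBigO_zero := ((Complex.continuous_ofReal.tendsto 0).mono_left nhdsWithin_le_nhds).isBigO_one ℝ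
  isBigO_atTop := ⟨1, isBigO_of_le _ fun z => by rw [Complex.norm_real, pow_one]⟩

theorem mul (hφ : IsModerate φ) (hχ : IsModerate χ) : IsModerate fun z => φ z * χ z where
  continuousOn := hφ.continuousOn.mul hχ.continuousOn
  isBigO_zero := by simpa using hφ.isBigO_zero.mul hχ.isBigO_zero
  isBigO_atTop := by
    obtain ⟨n, hn⟩ := hφ.isBigO_atTop
    obtain ⟨k, hk⟩ := hχ.isBigO_atTop
    exact ⟨n + k, by simpa only [pow_add] using hn.mul hk⟩

theorem add (hφ : IsModerate φ) (hχ : IsModerate χ) : IsModerate fun z => φ z + χ z where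
  continuousOn := hφ.continuousOn.add hχ.continuousOn
  isBigO_zero := hφ.isBigO_zero.add hχ.isBigO_zero
  isBigO_atTop := by
    obtain ⟨n, hn⟩ := hφ.isBigO_atTop
    obtain ⟨k, hk⟩ := hχ.isBigO_atTop
    exact ⟨max n k, (hn.trans (isBigO_pow_pow_atTop (le_max_left n k))).add
      (hk.trans (isBigO_pow_pow_atTop (le_max_right n k)))⟩

theorem const_mul (hφ : IsModerate φ) (c : ℂ) : IsModerate fun z => c * φ z := (const c).mul hφ

theorem ofReal_mul (hφ : IsModerate φ) : IsModerate fun z => (z : ℂ) * φ z := ofReal.mul hφ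

theorem sub (hφ : IsModerate φ) (hχ : IsModerate χ) : IsModerate fun z => φ z - χ z := by
  simpa only [neg_one_mul, ← sub_eq_add_neg] using hφ.add (hχ.const_mul (-1))

theorem congr (hφ : IsModerate φ) (h : EqOn χ φ (Ioi 0)) : IsModerate χ where
  continuousOn := hφ.continuousOn.congr h
  isBigO_zero := hφ.isBigO_zero.congr'
    (eventually_nhdsWithin_of_forall fun z hz => (h hz).symm) EventuallyEq.rfl
  isBigO_atTop := by
    obtain ⟨n, hn⟩ := hφ.isBigO_atTop
    exact ⟨n, hn.congr' ((eventually_gt_atTop 0).mono fun z hz => (h hz).symm) EventuallyEq.rfl⟩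

theorem exp_mul (hφ : IsModerate φ) (hp : p.re < 0) :
    IsModerate fun z : ℝ => Complex.exp (p * z) * φ z := by
  have hexp : ContinuousOn (fun z : ℝ => Complex.exp (p * z)) (Ioi 0) := by fun_prop
  refine IsModerate.mul ⟨hexp, ?_, 0, ?_⟩ hφ
  · exact ((Continuous.tendsto (by fun_prop) 0).mono_left nhdsWithin_le_nhds).isBigO_one ℝ
  · refine IsBigO.of_bound 1 ((eventually_ge_atTop 0).mono fun z hz => ?_)
    rw [norm_exp_mul_ofReal, pow_zero, norm_one, one_mul, Real.exp_le_one_iff]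
    exact mul_nonpos_of_nonpos_of_nonneg hp.le hz

theorem integrableOn (hφ : IsModerate φ) {g : ℝ → ℝ} (hO : φ =O[atTop] g)
    (hg : IntegrableAtFilter g atTop) : IntegrableOn φ (Ioi 0) := by
  have hloc := hφ.continuousOn.locallyIntegrableOn measurableSet_Ioi (μ := volume)
  refine integrableOn_Ioi_iff_integrableAtFilter_atTop_nhdsWithin.2 ⟨?_, ?_, hloc⟩
  · exact hO.integrableAtFilter ⟨Ioi 0, Ioi_mem_atTop 0,
      hφ.continuousOn.aestronglyMeasurable measurableSet_Ioi⟩ hg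
  · exact hφ.isBigO_zero.integrableAtFilter ⟨Ioi 0, self_mem_nhdsWithin,
      hφ.continuousOn.aestronglyMeasurable measurableSet_Ioi⟩
      ⟨Ioo 0 1, Ioo_mem_nhdsGT one_pos, integrableOn_const (by simp)⟩

theorem isBigO_exp_mul (hφ : IsModerate φ) (hp : p.re < 0) :
    (fun z : ℝ => Complex.exp (p * z) * φ z) =O[atTop] fun z => Real.exp (-(-p.re / 2) * z) := by
  obtain ⟨n, hn⟩ := hφ.isBigO_atTop
  have hpow := isLittleO_pow_exp_pos_mul_atTop n (by linarith : 0 < -p.re / 2)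
  refine ((isBigO_of_le atTop fun z : ℝ => ?_ :
    (fun z : ℝ => Complex.exp (p * z)) =O[atTop] fun z => Real.exp (p.re * z)).mul
      (hn.trans hpow.isBigO)).congr_right fun z => ?_
  · rw [norm_exp_mul_ofReal, Real.norm_of_nonneg (Real.exp_pos _).le]
  · rw [← Real.exp_add]
    ring_nf

theorem integrableOn_exp_mul (hφ : IsModerate φ) (hp : p.re < 0) :
    IntegrableOn (fun z : ℝ => Complex.exp (p * z) * φ z) (Ioi 0) :=
  (hφ.exp_mul hp).integrableOn (hφ.isBigO_exp_mul hp)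
    ⟨Ioi 0, Ioi_mem_atTop 0, exp_neg_integrableOn_Ioi 0 (by linarith)⟩

theorem tendsto_exp_mul (hφ : IsModerate φ) (hp : p.re < 0) :
    Tendsto (fun z : ℝ => Complex.exp (p * z) * φ z) atTop (𝓝 0) :=
  (hφ.isBigO_exp_mul hp).trans_tendsto <| Real.tendsto_exp_atBot.comp <|
    tendsto_id.const_mul_atTop_of_neg (by linarith)

end IsModerate

theorem laplace_congr (h : EqOn φ χ (Ioi 0)) (p : ℂ) : laplace φ p = laplace χ p :=
  setIntegral_congr_fun measurableSet_Ioi fun z hz => by simp only [h hz]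

theorem laplace_add (hφ : IsModerate φ) (hχ : IsModerate χ) (hp : p.re < 0) :
    laplace (fun z => φ z + χ z) p = laplace φ p + laplace χ p := by
  simp only [laplace, mul_add]
  exact integral_add (hφ.integrableOn_exp_mul hp) (hχ.integrableOn_exp_mul hp)

theorem laplace_const_mul (c : ℂ) : laplace (fun z => c * φ z) p = c * laplace φ p := by
  simp only [laplace, mul_left_comm _ c, integral_const_mul]

theorem laplace_sub (hφ : IsModerate φ) (hχ : IsModerate χ) (hp : p.re < 0) :
    laplace (fun z => φ z - χ z) p = laplace φ p - laplace χ p := by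
  simp only [laplace, mul_sub]
  exact integral_sub (hφ.integrableOn_exp_mul hp) (hχ.integrableOn_exp_mul hp)

theorem hasDerivAt_laplace (hφ : IsModerate φ) (hp : p.re < 0) :
    HasDerivAt (laplace φ) (laplace (fun z => z * φ z) p) p := by
  have hp2 : ((p.re / 2 : ℝ) : ℂ).re < 0 := by
    rw [Complex.ofReal_re]
    linarith
  have hmeas : ∀ q : ℂ, AEStronglyMeasurable (fun z : ℝ => Complex.exp (q * z) * φ z)
      (volume.restrict (Ioi 0)) := fun q =>
    (ContinuousOn.mul (by fun_prop) hφ.continuousOn).aestronglyMeasurable measurableSet_Ioi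
  have hnhds : {q : ℂ | q.re < p.re / 2} ∈ 𝓝 p :=
    (isOpen_lt Complex.continuous_re continuous_const).mem_nhds
      (by rw [mem_ofPred_eq]; linarith)
  refine (hasDerivAt_integral_of_dominated_loc_of_deriv_le
    (F := fun (q : ℂ) (z : ℝ) => Complex.exp (q * z) * φ z)
    (F' := fun (q : ℂ) (z : ℝ) => Complex.exp (q * z) * (z * φ z)) hnhds
    (Eventually.of_forall hmeas) (hφ.integrableOn_exp_mul hp)
    (hφ.ofReal_mul.integrableOn_exp_mul hp).aestronglyMeasurable
    ((ae_restrict_mem measurableSet_Ioi).mono fun z hz q hq => ?_)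
    (hφ.ofReal_mul.integrableOn_exp_mul hp2).norm (Eventually.of_forall fun z q _ => ?_)).2
  · rw [norm_mul, norm_mul (Complex.exp _), norm_exp_mul_ofReal, norm_exp_mul_ofReal,
      Complex.ofReal_re]
    have hz0 : 0 ≤ z := le_of_lt hz
    have hqp : q.re ≤ p.re / 2 := le_of_lt hq
    gcongr
  · exact (((hasDerivAt_id q).mul_const (z : ℂ)).cexp.mul_const (φ z)).congr_deriv
      (by simp only [id]; ring)

theorem laplace_deriv (hφ : IsModerate φ) (hχ : IsModerate χ)
    (hd : ∀ z > 0, HasDerivAt φ (χ z) z) (h0 : Tendsto φ (𝓝[>] 0) (𝓝 0)) (hp : p.re < 0) :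
    laplace χ p = -p * laplace φ p := by
  have hexp : ∀ x ∈ Ioi (0 : ℝ), HasDerivAt (fun z : ℝ => Complex.exp (p * z))
      (p * Complex.exp (p * x)) x := fun x _ =>
    (((hasDerivAt_id (x : ℂ)).const_mul p).cexp.comp_ofReal).congr_deriv
      (by simp [mul_comm])
  have hcont : Continuous fun z : ℝ => Complex.exp (p * z) := by fun_prop
  have hlim : Tendsto ((fun z : ℝ => Complex.exp (p * z)) * φ) (𝓝[>] 0) (𝓝 0) :=
    mul_zero (Complex.exp (p * (0 : ℝ))) ▸
      ((hcont.tendsto 0).mono_left nhdsWithin_le_nhds).mul h0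
  have hint : IntegrableOn ((fun z : ℝ => p * Complex.exp (p * z)) * φ) (Ioi 0) :=
    ((hφ.integrableOn_exp_mul hp).const_mul p).congr
      (Eventually.of_forall fun z => by simp [mul_assoc])
  rw [laplace, integral_Ioi_mul_deriv_eq_deriv_mul hexp hd (hχ.integrableOn_exp_mul hp) hint hlim
    (hφ.tendsto_exp_mul hp)]
  simp only [mul_assoc, integral_const_mul, laplace]
  ring

theorem norm_laplace_le (hφ : IntegrableOn φ (Ioi 0)) (hp : p.re < 0) :
    ‖laplace φ p‖ ≤ ∫ z in Ioi (0 : ℝ), ‖φ z‖ := by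
  refine norm_integral_le_of_norm_le hφ.norm
    ((ae_restrict_mem measurableSet_Ioi).mono fun z hz => ?_)
  rw [norm_mul, norm_exp_mul_ofReal]
  exact mul_le_of_le_one_left (norm_nonneg _)
    (Real.exp_le_one_iff.2 (mul_nonpos_of_nonpos_of_nonneg hp.le (le_of_lt hz)))

theorem exists_norm_laplace_le {φ₁ φ₂ : ℝ → ℂ} (hφ : IsModerate φ) (hφ₁ : IsModerate φ₁)
    (hφ₂ : IsModerate φ₂) (hd : ∀ z > 0, HasDerivAt φ (φ₁ z) z)
    (hd₁ : ∀ z > 0, HasDerivAt φ₁ (φ₂ z) z) (h0 : Tendsto φ (𝓝[>] 0) (𝓝 0))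
    (h1 : Tendsto φ₁ (𝓝[>] 0) (𝓝 0)) (hint : IntegrableOn φ₂ (Ioi 0)) :
    ∃ C, ∀ p : ℂ, p.re < 0 → ‖laplace φ p‖ ≤ C / ‖p‖ ^ 2 := by
  refine ⟨∫ z in Ioi (0 : ℝ), ‖φ₂ z‖, fun p hp => ?_⟩
  have hp0 : p ≠ 0 := by
    rintro rfl
    exact lt_irrefl _ hp
  rw [le_div_iff₀ (by positivity)]
  calc ‖laplace φ p‖ * ‖p‖ ^ 2 = ‖-p * (-p * laplace φ p)‖ := by
        simp only [norm_mul, norm_neg]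
        ring
    _ = ‖laplace φ₂ p‖ := by
        rw [laplace_deriv hφ₁ hφ₂ hd₁ h1 hp, laplace_deriv hφ hφ₁ hd h0 hp]
    _ ≤ _ := norm_laplace_le hint hp

end Laplace

section GammaKernel

variable {a p : ℂ}

/-- The integrand of Euler's integral for `Γ(a)`, whose Laplace transform is explicit. -/
noncomputable def gammaKernel (a : ℂ) (z : ℝ) : ℂ := (z : ℂ) ^ (a - 1) * Complex.exp (-z)

theorem hasDerivAt_cpow_mul (s : ℂ) {u : ℝ → ℂ} {u' : ℂ} {z : ℝ} (hz : 0 < z)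
    (hu : HasDerivAt u u' z) :
    HasDerivAt (fun t : ℝ => (t : ℂ) ^ s * u t) ((z : ℂ) ^ (s - 1) * (s * u z + z * u')) z := by
  have hz0 : (z : ℂ) ≠ 0 := by exact_mod_cast hz.ne'
  have hpow : HasDerivAt (fun t : ℝ => (t : ℂ) ^ s) (s * (z : ℂ) ^ (s - 1) * 1) z :=
    ((hasDerivAt_id (z : ℂ)).cpow_const (Complex.ofReal_mem_slitPlane.2 hz)).comp_ofReal
  refine (hpow.mul hu).congr_deriv ?_
  rw [Complex.cpow_sub _ _ hz0, Complex.cpow_one]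
  field_simp

theorem hasDerivAt_gammaKernel (a : ℂ) {z : ℝ} (hz : 0 < z) :
    HasDerivAt (gammaKernel a) ((a - 1) * gammaKernel (a - 1) z - gammaKernel a z) z := by
  have hexp : HasDerivAt (fun t : ℝ => Complex.exp (-t)) (-Complex.exp (-z)) z :=
    ((hasDerivAt_neg (z : ℂ)).cexp.comp_ofReal).congr_deriv (by ring)
  refine (hasDerivAt_cpow_mul (a - 1) hz hexp).congr_deriv ?_
  have hz0 : (z : ℂ) ≠ 0 := by exact_mod_cast hz.ne'
  simp only [gammaKernel, Complex.cpow_sub _ _ hz0, Complex.cpow_one]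
  field_simp
  ring

theorem mul_gammaKernel (a : ℂ) {z : ℝ} (hz : 0 < z) :
    (z : ℂ) * gammaKernel a z = gammaKernel (a + 1) z := by
  have hz0 : (z : ℂ) ≠ 0 := by exact_mod_cast hz.ne'
  rw [gammaKernel, gammaKernel, show a + 1 - 1 = a - 1 + 1 by ring, Complex.cpow_add _ _ hz0,
    Complex.cpow_one]
  ring

theorem norm_gammaKernel (a : ℂ) {z : ℝ} (hz : 0 < z) :
    ‖gammaKernel a z‖ = z ^ (a.re - 1) * Real.exp (-z) := by
  rw [gammaKernel, norm_mul, Complex.norm_cpow_eq_rpow_re_of_pos hz, Complex.norm_exp]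
  simp

theorem isBigO_gammaKernel_inv_pow (a : ℂ) (n : ℕ) :
    gammaKernel a =O[atTop] fun z : ℝ => z⁻¹ ^ n := by
  have hexp := (isLittleO_exp_neg_mul_rpow_atTop one_pos (-(n + (a.re - 1)))).isBigO
  refine ((isBigO_refl (fun z : ℝ => z ^ (a.re - 1)) atTop).mul hexp).congr' ?_ ?_ |>.of_norm_left
  · filter_upwards [eventually_gt_atTop 0] with z hz
    rw [norm_gammaKernel a hz, neg_one_mul]
  · filter_upwards [eventually_gt_atTop 0] with z hz
    rw [← Real.rpow_add hz, show a.re - 1 + -(n + (a.re - 1)) = -(n : ℝ) by ring,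
      Real.rpow_neg hz.le, Real.rpow_natCast, inv_pow]

theorem tendsto_gammaKernel (ha : 1 < a.re) : Tendsto (gammaKernel a) (𝓝[>] 0) (𝓝 0) := by
  have hpow : Tendsto (fun z : ℝ => z ^ (a.re - 1) * Real.exp (-z)) (𝓝[>] 0) (𝓝 0) := by
    have h := ((Real.continuousAt_rpow_const 0 (a.re - 1) (Or.inr (by linarith))).tendsto.mul
      (Real.continuous_exp.comp continuous_neg).continuousAt.tendsto).mono_left
      (nhdsWithin_le_nhds (s := Ioi 0))
    simpa [Real.zero_rpow (by linarith : a.re - 1 ≠ 0)] using h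
  refine squeeze_zero_norm' ?_ hpow
  filter_upwards [self_mem_nhdsWithin] with z hz using (norm_gammaKernel a hz).le

theorem isModerate_gammaKernel (ha : 1 ≤ a.re) : IsModerate (gammaKernel a) where
  continuousOn z hz := (hasDerivAt_gammaKernel a hz).continuousAt.continuousWithinAt
  isBigO_zero := by
    refine IsBigO.of_bound 1 ?_
    filter_upwards [Ioo_mem_nhdsGT (zero_lt_one' ℝ)] with z hz
    rw [norm_gammaKernel a hz.1, norm_one, one_mul]
    exact mul_le_one₀ (Real.rpow_le_one hz.1.le hz.2.le (by linarith)) (Real.exp_pos _).le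
      (Real.exp_le_one_iff.2 (by linarith [hz.1]))
  isBigO_atTop := ⟨0, by simpa only [pow_zero] using isBigO_gammaKernel_inv_pow a 0⟩

theorem laplace_gammaKernel_succ (ha : 1 ≤ a.re) (hp : p.re < 0) :
    (1 - p) * laplace (gammaKernel (a + 1)) p = a * laplace (gammaKernel a) p := by
  have hm := isModerate_gammaKernel ha
  have ha1 : 1 < (a + 1).re := by
    rw [Complex.add_re, Complex.one_re]
    linarith
  have hm1 := isModerate_gammaKernel ha1.le
  have h := laplace_deriv hm1 ((hm.const_mul a).sub hm1)
    (fun z hz => by simpa only [add_sub_cancel_right] using hasDerivAt_gammaKernel (a + 1) hz)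
    (tendsto_gammaKernel ha1) hp
  rw [laplace_sub (hm.const_mul a) hm1 hp, laplace_const_mul] at h
  linear_combination -h

theorem hasDerivAt_cpow_mul_laplace_gammaKernel (ha : 1 ≤ a.re) (hp : p.re < 0) :
    HasDerivAt (fun q => (1 - q) ^ a * laplace (gammaKernel a) q) 0 p := by
  have hslit : 1 - p ∈ Complex.slitPlane := Or.inl (by simp; linarith)
  have hp0 : 1 - p ≠ 0 := Complex.slitPlane_ne_zero hslit
  refine ((((hasDerivAt_id p).const_sub 1).cpow_const (c := a) hslit).mul
    (hasDerivAt_laplace (isModerate_gammaKernel ha) hp)).congr_deriv ?_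
  have hpow : (1 - p) ^ a = (1 - p) ^ (a - 1) * (1 - p) := by
    rw [Complex.cpow_sub _ _ hp0, Complex.cpow_one]
    field_simp
  rw [laplace_congr fun z hz => mul_gammaKernel a hz]
  simp only [id, hpow]
  linear_combination (1 - p) ^ (a - 1) * laplace_gammaKernel_succ ha hp

theorem laplace_gammaKernel_neg_one (ha : 1 ≤ a.re) :
    (1 - -1) ^ a * laplace (gammaKernel a) (-1) = Complex.Gamma a := by
  have hlaplace : laplace (gammaKernel a) (-1) = (1 / ((2 : ℝ) : ℂ)) ^ a * Complex.Gamma a := by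
    rw [← Complex.integral_cpow_mul_exp_neg_mul_Ioi (by linarith) two_pos]
    refine setIntegral_congr_fun measurableSet_Ioi fun z _ => ?_
    simp only [gammaKernel]
    rw [mul_left_comm, ← Complex.exp_add]
    congr 2
    push_cast
    ring
  rw [hlaplace, ← mul_assoc, show (1 - -1 : ℂ) = ((2 : ℝ) : ℂ) by norm_num,
    show 1 / ((2 : ℝ) : ℂ) = ((1 / 2 : ℝ) : ℂ) by norm_num,
    ← Complex.mul_cpow_ofReal_nonneg (by norm_num) (by norm_num)]
  norm_num

theorem laplace_gammaKernel (ha : 1 ≤ a.re) (hp : p.re < 0) :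
    (1 - p) ^ a * laplace (gammaKernel a) p = Complex.Gamma a := by
  have hopen : IsOpen {q : ℂ | q.re < 0} := isOpen_lt Complex.continuous_re continuous_const
  have hder : ∀ q ∈ {q : ℂ | q.re < 0},
      HasDerivAt (fun q => (1 - q) ^ a * laplace (gammaKernel a) q) 0 q := fun q hq =>
    hasDerivAt_cpow_mul_laplace_gammaKernel ha hq
  have hm1 : (-1 : ℂ) ∈ {q : ℂ | q.re < 0} := by simp
  rw [← laplace_gammaKernel_neg_one ha]
  exact hopen.is_const_of_deriv_eq_zero (convex_halfSpace_re_lt 0).isPreconnected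
    (fun q hq => (hder q hq).differentiableAt.differentiableWithinAt)
    (fun q hq => (hder q hq).deriv) hp hm1

theorem norm_one_sub_cpow (a : ℂ) (hp : p.re < 0) :
    ‖(1 - p) ^ a‖ = ‖1 - p‖ ^ a.re / Real.exp ((1 - p).arg * a.im) :=
  Complex.norm_cpow_of_ne_zero (Complex.slitPlane_ne_zero (Or.inl (by simp; linarith))) a

theorem one_le_norm_one_sub (hp : p.re < 0) : 1 ≤ ‖1 - p‖ :=
  le_trans (by simp only [Complex.sub_re, Complex.one_re]; linarith) (Complex.re_le_norm (1 - p))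

theorem norm_le_norm_one_sub (hp : p.re < 0) : ‖p‖ ≤ ‖1 - p‖ := by
  rw [← sq_le_sq₀ (norm_nonneg _) (norm_nonneg _), ← Complex.normSq_eq_norm_sq,
    ← Complex.normSq_eq_norm_sq, Complex.normSq_apply, Complex.normSq_apply]
  simp only [Complex.sub_re, Complex.one_re, Complex.sub_im, Complex.one_im]
  nlinarith

theorem norm_laplace_gammaKernel (ha : 1 ≤ a.re) (hp : p.re < 0) :
    ‖laplace (gammaKernel a) p‖ =
      ‖Complex.Gamma a‖ * Real.exp ((1 - p).arg * a.im) / ‖1 - p‖ ^ a.re := by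
  have hpos : 0 < ‖1 - p‖ ^ a.re :=
    Real.rpow_pos_of_pos (one_pos.trans_le (one_le_norm_one_sub hp)) _
  rw [← laplace_gammaKernel ha hp, norm_mul, norm_one_sub_cpow a hp]
  field_simp

theorem abs_arg_mul_le (w : ℂ) (x : ℝ) : |w.arg * x| ≤ Real.pi * |x| := by
  rw [abs_mul]
  exact mul_le_mul_of_nonneg_right (Complex.abs_arg_le_pi w) (abs_nonneg _)

theorem exists_norm_laplace_gammaKernel_le {n : ℕ} (hn : 1 ≤ n) (ha : n ≤ a.re) :
    ∃ C, ∀ p : ℂ, p.re < 0 → ‖laplace (gammaKernel a) p‖ ≤ C / ‖p‖ ^ n := by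
  refine ⟨‖Complex.Gamma a‖ * Real.exp (Real.pi * |a.im|), fun p hp => ?_⟩
  have hp0 : p ≠ 0 := fun h => hp.ne (by rw [h, Complex.zero_re])
  rw [norm_laplace_gammaKernel ((Nat.one_le_cast.2 hn).trans ha) hp]
  refine div_le_div₀ (by positivity) ?_ (by positivity) ?_
  · have harg := (le_abs_self _).trans (abs_arg_mul_le (1 - p) a.im)
    gcongr
  · calc ‖p‖ ^ n ≤ ‖1 - p‖ ^ n := by gcongr; exact norm_le_norm_one_sub hp
      _ = ‖1 - p‖ ^ (n : ℝ) := (Real.rpow_natCast _ _).symm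
      _ ≤ _ := Real.rpow_le_rpow_of_exponent_le (one_le_norm_one_sub hp) ha

theorem exists_le_norm_laplace_gammaKernel (ha : a.re = 1) :
    ∃ c > 0, ∀ p : ℂ, p.re < 0 → c / ‖1 - p‖ ≤ ‖laplace (gammaKernel a) p‖ := by
  have hΓ : Complex.Gamma a ≠ 0 := Complex.Gamma_ne_zero_of_re_pos (by linarith)
  refine ⟨‖Complex.Gamma a‖ * Real.exp (-(Real.pi * |a.im|)), by positivity, fun p hp => ?_⟩
  rw [norm_laplace_gammaKernel ha.ge hp, ha, Real.rpow_one]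
  have harg := neg_le_of_abs_le (abs_arg_mul_le (1 - p) a.im)
  gcongr

end GammaKernel

section BehaviourAtZero

variable {s : ℂ} {u u₁ φ φ₁ φ₂ : ℝ → ℂ}

theorem eventuallyEq_deriv_of_eq_cpow_mul (hφ : φ =ᶠ[𝓝[>] 0] fun z : ℝ => (z : ℂ) ^ s * u z)
    (hd : ∀ᶠ z in 𝓝[>] 0, HasDerivAt φ (φ₁ z) z)
    (hu : ∀ᶠ z in 𝓝[>] 0, HasDerivAt u (u₁ z) z) :
    φ₁ =ᶠ[𝓝[>] 0] fun z : ℝ => (z : ℂ) ^ (s - 1) * (s * u z + z * u₁ z) := by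
  filter_upwards [self_mem_nhdsWithin, eventually_eventually_nhdsWithin.2 hφ, hd, hu]
    with z hz hz1 hz2 hz3
  rw [isOpen_Ioi.nhdsWithin_eq hz] at hz1
  exact hz2.unique ((hasDerivAt_cpow_mul s hz hz3).congr_of_eventuallyEq hz1)

theorem isBigO_cpow_mul (hs : s.re = 0) (k n : ℕ)
    (hu : u =O[𝓝[>] 0] fun z : ℝ => z ^ (k + n)) :
    (fun z : ℝ => (z : ℂ) ^ (s - k) * u z) =O[𝓝[>] 0] fun z : ℝ => z ^ n := by
  obtain ⟨C, hC⟩ := hu.bound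
  refine IsBigO.of_bound C ?_
  filter_upwards [hC, self_mem_nhdsWithin] with z hz hz0
  have hz0 : 0 < z := hz0
  have hpow : ‖(z : ℂ) ^ (s - k)‖ = (z ^ k)⁻¹ := by
    rw [Complex.norm_cpow_eq_rpow_re_of_pos hz0, Complex.sub_re, hs, Complex.natCast_re, zero_sub,
      Real.rpow_neg hz0.le, Real.rpow_natCast]
  rw [norm_mul, hpow, inv_mul_le_iff₀ (by positivity)]
  refine hz.trans_eq ?_
  rw [pow_add, norm_mul, Real.norm_of_nonneg (pow_pos hz0 k).le]
  ring

theorem isBigO_sq_of_deriv_isBigO (hd : ∀ᶠ z in 𝓝 0, DifferentiableAt ℝ u z)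
    (h0 : u 0 = 0) (hO : deriv u =O[𝓝 0] fun z => z) : u =O[𝓝 0] fun z => z ^ 2 := by
  obtain ⟨C, hC0, hC⟩ := hO.exists_nonneg
  obtain ⟨δ, hδ, hball⟩ := Metric.eventually_nhds_iff_ball.1 (hd.and hC.bound)
  refine IsBigO.of_bound C ?_
  filter_upwards [Metric.ball_mem_nhds 0 hδ] with z hz
  have hsub : ∀ t ∈ Metric.closedBall (0 : ℝ) ‖z‖, t ∈ Metric.ball (0 : ℝ) δ := fun t ht =>
    (mem_closedBall_zero_iff.1 ht).trans_lt (mem_ball_zero_iff.1 hz) |> mem_ball_zero_iff.2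
  have key := (convex_closedBall (0 : ℝ) ‖z‖).norm_image_sub_le_of_norm_deriv_le (C := C * ‖z‖)
    (fun t ht => (hball t (hsub t ht)).1)
    (fun t ht => (hball t (hsub t ht)).2.trans (by gcongr; exact mem_closedBall_zero_iff.1 ht))
    (Metric.mem_closedBall_self (norm_nonneg z)) (mem_closedBall_zero_iff.2 le_rfl)
  rw [h0, sub_zero, sub_zero] at key
  exact key.trans_eq (by rw [norm_pow]; ring)

theorem contDiffAt_deriv {n : WithTop ℕ∞} {x : ℝ} (hu : ContDiffAt ℝ (n + 1) u x) :
    ContDiffAt ℝ n (deriv u) x :=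
  (hu.fderiv_right le_rfl).clm_apply contDiffAt_const

theorem eventually_hasDerivAt_of_contDiffAt {x : ℝ} (hu : ContDiffAt ℝ 2 u x) :
    ∀ᶠ z in 𝓝 x, HasDerivAt u (deriv u z) z ∧ HasDerivAt (deriv u) (deriv (deriv u) z) z := by
  have hu₁ : ContDiffAt ℝ 1 (deriv u) x := contDiffAt_deriv hu
  filter_upwards [hu.eventually (by simp), hu₁.eventually (by simp)] with z h1 h2
  exact ⟨(h1.differentiableAt (by simp)).hasDerivAt, (h2.differentiableAt (by simp)).hasDerivAt⟩

theorem isBigO_of_contDiffAt (hu : ContDiffAt ℝ 2 u 0) (h0 : u 0 = 0) (h1 : deriv u 0 = 0) :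
    u =O[𝓝 0] (fun z => z ^ 2) ∧ deriv u =O[𝓝 0] (fun z => z) ∧
      deriv (deriv u) =O[𝓝 0] fun _ => (1 : ℝ) := by
  have hu₁ : ContDiffAt ℝ 1 (deriv u) 0 := contDiffAt_deriv hu
  have hu₂ : ContDiffAt ℝ 0 (deriv (deriv u)) 0 := contDiffAt_deriv hu₁
  have hO : deriv u =O[𝓝 0] fun z => z := by
    simpa only [h1, sub_zero] using (hu₁.differentiableAt one_ne_zero).isBigO_sub
  exact ⟨isBigO_sq_of_deriv_isBigO ((eventually_hasDerivAt_of_contDiffAt hu).mono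
    fun z hz => hz.1.differentiableAt) h0 hO, hO, hu₂.continuousAt.tendsto.isBigO_one ℝ⟩

theorem isBigO_of_eq_cpow_mul (hs : s.re = 0) (hd : ∀ᶠ z in 𝓝[>] 0, HasDerivAt φ (φ₁ z) z)
    (hd₁ : ∀ᶠ z in 𝓝[>] 0, HasDerivAt φ₁ (φ₂ z) z) (hu : ContDiffAt ℝ 2 u 0) (h0 : u 0 = 0)
    (h1 : deriv u 0 = 0) (hφ : φ =ᶠ[𝓝[>] 0] fun z : ℝ => (z : ℂ) ^ s * u z) :
    φ =O[𝓝[>] 0] (fun z => z ^ 2) ∧ φ₁ =O[𝓝[>] 0] (fun z => z ^ 1) ∧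
      φ₂ =O[𝓝[>] 0] fun z => z ^ 0 := by
  obtain ⟨hu2, hu1, hu0⟩ := isBigO_of_contDiffAt hu h0 h1
  replace hu2 := hu2.mono (nhdsWithin_le_nhds (s := Ioi 0))
  replace hu1 := hu1.mono (nhdsWithin_le_nhds (s := Ioi 0))
  replace hu0 := hu0.mono (nhdsWithin_le_nhds (s := Ioi 0))
  have hud := (eventually_hasDerivAt_of_contDiffAt hu).filter_mono
    (nhdsWithin_le_nhds (s := Ioi 0))
  have hid : (fun z : ℝ => (z : ℂ)) =O[𝓝[>] 0] fun z => z :=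
    isBigO_of_le _ fun z => (Complex.norm_real z).le
  have hφ₁ := eventuallyEq_deriv_of_eq_cpow_mul hφ hd (hud.mono fun z hz => hz.1)
  have hφ₂ := eventuallyEq_deriv_of_eq_cpow_mul hφ₁ hd₁
    (u₁ := fun z => (s + 1) * deriv u z + z * deriv (deriv u) z) (hud.mono fun z hz =>
      ((hz.1.const_mul s).add ((hasDerivAt_id z).ofReal_comp.mul hz.2)).congr_deriv
        (by simp only [id, Complex.ofReal_one]; ring))
  have hw1 : (fun z : ℝ => s * u z + z * deriv u z) =O[𝓝[>] 0] fun z => z ^ 2 :=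
    (hu2.const_mul_left s).add ((hid.mul hu1).congr_right fun z => (sq z).symm)
  have hw2 : (fun z : ℝ => (s - 1) * (s * u z + z * deriv u z) +
      z * ((s + 1) * deriv u z + z * deriv (deriv u) z)) =O[𝓝[>] 0] fun z => z ^ 2 :=
    (hw1.const_mul_left (s - 1)).add ((hid.mul ((hu1.const_mul_left (s + 1)).add
      (by simpa using hid.mul hu0))).congr_right fun z => (sq z).symm)
  refine ⟨hφ.trans_isBigO ?_, hφ₁.trans_isBigO ?_, hφ₂.trans_isBigO ?_⟩
  · simpa using isBigO_cpow_mul hs 0 2 hu2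
  · simpa using isBigO_cpow_mul hs 1 1 hw1
  · simpa [sub_sub, one_add_one_eq_two] using isBigO_cpow_mul hs 2 0 hw2

theorem exists_norm_laplace_le_of_eq_cpow_mul (hs : s.re = 0)
    (hd : ∀ z > 0, HasDerivAt φ (φ₁ z) z) (hd₁ : ∀ z > 0, HasDerivAt φ₁ (φ₂ z) z)
    (hφ₂ : ContinuousOn φ₂ (Ioi 0)) (hu : ContDiffAt ℝ 2 u 0) (h0 : u 0 = 0)
    (h1 : deriv u 0 = 0) (hφ : φ =ᶠ[𝓝[>] 0] fun z : ℝ => (z : ℂ) ^ s * u z)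
    (hO : φ =O[atTop] fun _ => (1 : ℝ)) (hO₂ : φ₂ =O[atTop] fun z : ℝ => z⁻¹ ^ 2) :
    ∃ C, ∀ p : ℂ, p.re < 0 → ‖laplace φ p‖ ≤ C / ‖p‖ ^ 2 := by
  obtain ⟨hz2, hz1, hz0⟩ := isBigO_of_eq_cpow_mul hs (eventually_nhdsWithin_of_forall hd)
    (eventually_nhdsWithin_of_forall hd₁) hu h0 h1 hφ
  have hpow : ∀ n ≠ 0, Tendsto (fun z : ℝ => z ^ n) (𝓝[>] 0) (𝓝 0) := fun n hn => by
    simpa [hn] using ((continuous_pow n).tendsto (0 : ℝ)).mono_left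
      (nhdsWithin_le_nhds (s := Ioi 0))
  have hlim : Tendsto φ (𝓝[>] 0) (𝓝 0) := hz2.trans_tendsto (hpow 2 two_ne_zero)
  have hlim₁ : Tendsto φ₁ (𝓝[>] 0) (𝓝 0) := hz1.trans_tendsto (hpow 1 one_ne_zero)
  have hO₁ : φ₁ =O[atTop] fun _ => (1 : ℝ) :=
    isBigO_one_of_deriv one_ne_zero ((eventually_gt_atTop 0).mono hd₁) hO₂
  have hsq : (fun z : ℝ => z⁻¹ ^ 2) =O[atTop] fun _ => (1 : ℝ) := by
    simpa using ((tendsto_inv_atTop_zero (𝕜 := ℝ)).pow 2).isBigO_one ℝ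
  have hm : IsModerate φ := ⟨fun z hz => (hd z hz).continuousAt.continuousWithinAt,
    hlim.isBigO_one ℝ, 0, by simpa only [pow_zero] using hO⟩
  have hm₁ : IsModerate φ₁ := ⟨fun z hz => (hd₁ z hz).continuousAt.continuousWithinAt,
    hlim₁.isBigO_one ℝ, 0, by simpa only [pow_zero] using hO₁⟩
  have hm₂ : IsModerate φ₂ := ⟨hφ₂, by simpa only [pow_zero] using hz0, 0, by
    simpa only [pow_zero] using hO₂.trans hsq⟩
  obtain ⟨z, hz⟩ := (eventually_integrableOn_Ioi_inv_pow one_ne_zero).exists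
  exact exists_norm_laplace_le hm hm₁ hm₂ hd hd₁ hlim hlim₁
    (hm₂.integrableOn hO₂ ⟨Ioi z, Ioi_mem_atTop z, hz.1⟩)

theorem eq_cpow_mul_gammaKernel (s b c : ℂ) {z : ℝ} (hz : 0 < z) :
    b * gammaKernel (1 + s) z + c * gammaKernel (2 + s) z =
      (z : ℂ) ^ s * ((b + c * z) * Complex.exp (-z)) := by
  rw [show 2 + s = 1 + s + 1 by ring, ← mul_gammaKernel _ hz, gammaKernel, add_sub_cancel_left]
  ring

theorem hasDerivAt_sub_affine_mul_exp (hu : ContDiffAt ℝ 2 u 0) :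
    HasDerivAt (fun z : ℝ => u z - (u 0 + (deriv u 0 + u 0) * z) * Complex.exp (-z)) 0 0 := by
  have hid : HasDerivAt (fun z : ℝ => (z : ℂ)) 1 0 := (hasDerivAt_id (0 : ℂ)).comp_ofReal
  refine ((hu.differentiableAt two_ne_zero).hasDerivAt.sub
    (((hid.const_mul (deriv u 0 + u 0)).const_add (u 0)).mul hid.neg.cexp)).congr_deriv ?_
  simp only [Pi.neg_apply, Complex.ofReal_zero, neg_zero, Complex.exp_zero]
  ring

theorem exists_deriv₂_gammaKernel (a : ℂ) : ∃ κ₁ κ₂ : ℝ → ℂ,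
    (∀ z > 0, HasDerivAt (gammaKernel a) (κ₁ z) z) ∧ (∀ z > 0, HasDerivAt κ₁ (κ₂ z) z) ∧
      ContinuousOn κ₂ (Ioi 0) ∧ κ₂ =O[atTop] fun z : ℝ => z⁻¹ ^ 2 := by
  have hd : ∀ a : ℂ, ∀ z : ℝ, 0 < z → _ := fun a z hz => hasDerivAt_gammaKernel a hz
  have hc : ∀ a : ℂ, ContinuousOn (gammaKernel a) (Ioi 0) := fun a z hz =>
    (hd a z hz).continuousAt.continuousWithinAt
  have hO : ∀ a : ℂ, gammaKernel a =O[atTop] fun z : ℝ => z⁻¹ ^ 2 := fun a =>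
    isBigO_gammaKernel_inv_pow a 2
  exact ⟨_, _, hd a, fun z hz => ((hd _ z hz).const_mul _).sub (hd a z hz),
    ((((hc _).const_mul _).sub (hc _)).const_mul _).sub (((hc _).const_mul _).sub (hc _)),
    ((((hO _).const_mul_left _).sub (hO _)).const_mul_left _).sub
      (((hO _).const_mul_left _).sub (hO _))⟩

theorem isModerate_of_eq_cpow_mul (hs : s.re = 0) (hc : ContinuousOn φ (Ioi 0))
    (hu : ContinuousAt u 0) (hφ : φ =ᶠ[𝓝[>] 0] fun z : ℝ => (z : ℂ) ^ s * u z)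
    (hO : φ =O[atTop] fun _ => (1 : ℝ)) : IsModerate φ where
  continuousOn := hc
  isBigO_zero := hφ.trans_isBigO (by
    simpa using isBigO_cpow_mul hs 0 0 ((by simpa using hu.tendsto.isBigO_one ℝ :
      u =O[𝓝 0] _).mono nhdsWithin_le_nhds))
  isBigO_atTop := ⟨0, by simpa only [pow_zero] using hO⟩

theorem exists_norm_laplace_sub_two_gammaKernel_le (hs : s.re = 0)
    (hd : ∀ z > 0, HasDerivAt φ (φ₁ z) z) (hd₁ : ∀ z > 0, HasDerivAt φ₁ (φ₂ z) z)
    (hφ₂ : ContinuousOn φ₂ (Ioi 0)) (hu : ContDiffAt ℝ 2 u 0)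
    (hφ : φ =ᶠ[𝓝[>] 0] fun z : ℝ => (z : ℂ) ^ s * u z)
    (hO : φ =O[atTop] fun _ => (1 : ℝ)) (hO₂ : φ₂ =O[atTop] fun z : ℝ => z⁻¹ ^ 2) :
    ∃ C, ∀ p : ℂ, p.re < 0 → ‖laplace φ p - (u 0 * laplace (gammaKernel (1 + s)) p +
      (deriv u 0 + u 0) * laplace (gammaKernel (2 + s)) p)‖ ≤ C / ‖p‖ ^ 2 := by
  set b := u 0
  set c := deriv u 0 + u 0
  obtain ⟨κ₁, κ₂, hκ, hκ₁, hκ₂, hκO⟩ := exists_deriv₂_gammaKernel (1 + s)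
  obtain ⟨χ₁, χ₂, hχ, hχ₁, hχ₂, hχO⟩ := exists_deriv₂_gammaKernel (2 + s)
  have hv := hasDerivAt_sub_affine_mul_exp hu
  have hexp : ContDiffAt ℝ 2 (fun z : ℝ => (b + c * z) * Complex.exp (-z)) 0 := by
    have hid : ContDiff ℝ 2 fun z : ℝ => (z : ℂ) := Complex.ofRealCLM.contDiff
    exact ((contDiff_const.add (contDiff_const.mul hid)).mul hid.neg.cexp).contDiffAt
  have hγO (a : ℂ) : gammaKernel a =O[atTop] fun _ => (1 : ℝ) := by
    simpa only [pow_zero] using isBigO_gammaKernel_inv_pow a 0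
  obtain ⟨C, hC⟩ := exists_norm_laplace_le_of_eq_cpow_mul (s := s)
    (φ := fun z => φ z - (b * gammaKernel (1 + s) z + c * gammaKernel (2 + s) z)) hs
    (fun z hz => (hd z hz).sub (((hκ z hz).const_mul b).add ((hχ z hz).const_mul c)))
    (fun z hz => (hd₁ z hz).sub (((hκ₁ z hz).const_mul b).add ((hχ₁ z hz).const_mul c)))
    (hφ₂.sub ((hκ₂.const_mul b).add (hχ₂.const_mul c))) (hu.sub hexp) (by simp [b]) hv.deriv
    (by filter_upwards [hφ, self_mem_nhdsWithin] with z hz hz0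
        rw [hz, eq_cpow_mul_gammaKernel s b c hz0, mul_sub])
    (hO.sub (((hγO _).const_mul_left b).add ((hγO _).const_mul_left c)))
    (hO₂.sub ((hκO.const_mul_left b).add (hχO.const_mul_left c)))
  have hm : IsModerate φ := isModerate_of_eq_cpow_mul hs
    (fun z hz => (hd z hz).continuousAt.continuousWithinAt) hu.continuousAt hφ hO
  have hm₁ : IsModerate (gammaKernel (1 + s)) := isModerate_gammaKernel (by simp [hs])
  have hm₂ : IsModerate (gammaKernel (2 + s)) := isModerate_gammaKernel (by simp [hs])
  refine ⟨C, fun p hp => ?_⟩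
  rw [← laplace_const_mul, ← laplace_const_mul,
    ← laplace_add (hm₁.const_mul b) (hm₂.const_mul c) hp,
    ← laplace_sub hm ((hm₁.const_mul b).add (hm₂.const_mul c)) hp]
  exact hC p hp

theorem exists_norm_laplace_sub_gammaKernel_le (hs : s.re = 0)
    (hd : ∀ z > 0, HasDerivAt φ (φ₁ z) z) (hd₁ : ∀ z > 0, HasDerivAt φ₁ (φ₂ z) z)
    (hφ₂ : ContinuousOn φ₂ (Ioi 0)) (hu : ContDiffAt ℝ 2 u 0)
    (hφ : φ =ᶠ[𝓝[>] 0] fun z : ℝ => (z : ℂ) ^ s * u z)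
    (hO : φ =O[atTop] fun _ => (1 : ℝ)) (hO₂ : φ₂ =O[atTop] fun z : ℝ => z⁻¹ ^ 2) :
    ∃ C, ∀ p : ℂ, p.re < 0 →
      ‖laplace φ p - u 0 * laplace (gammaKernel (1 + s)) p‖ ≤ C / ‖p‖ ^ 2 := by
  obtain ⟨C₁, hC₁⟩ := exists_norm_laplace_sub_two_gammaKernel_le hs hd hd₁ hφ₂ hu hφ hO hO₂
  obtain ⟨C₂, hC₂⟩ := exists_norm_laplace_gammaKernel_le (a := 2 + s) one_le_two (by simp [hs])
  set c := deriv u 0 + u 0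
  refine ⟨C₁ + ‖c‖ * C₂, fun p hp => ?_⟩
  calc ‖laplace φ p - u 0 * laplace (gammaKernel (1 + s)) p‖
      = ‖laplace φ p - (u 0 * laplace (gammaKernel (1 + s)) p +
          c * laplace (gammaKernel (2 + s)) p) + c * laplace (gammaKernel (2 + s)) p‖ := by ring_nf
    _ ≤ C₁ / ‖p‖ ^ 2 + ‖c‖ * (C₂ / ‖p‖ ^ 2) := (norm_add_le _ _).trans (add_le_add (hC₁ p hp) (by
        rw [norm_mul]; gcongr; exact hC₂ p hp))
    _ = (C₁ + ‖c‖ * C₂) / ‖p‖ ^ 2 := by ring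

end BehaviourAtZero

section HeunEquation

/-- `f` is a `C²` solution on `(0, ∞)` of the confluent Heun equation with singular points `0` and
`-1`, written in the normalization in which the radial equation of Kerr–Newman takes a polynomial
form. -/
structure IsHeunSolution (Ω α γ Λ : ℝ) (f : ℝ → ℂ) : Prop where
  contDiffOn : ContDiffOn ℝ 2 f (Ioi 0)
  ode : ∀ z : ℝ, 0 < z → z * (1 + z) * deriv (deriv f) z +
    (1 + 2 * z + 2 * Complex.I * (Ω / 2 * z * (1 + z) - α * (1 + z) - γ * z)) * deriv f z +
    (Complex.I * (Ω * (z + 1 / 2) - (α + γ)) - Λ) * f z = 0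

variable {Ω α γ Λ : ℝ} {f : ℝ → ℂ} {c : ℂ}

namespace IsHeunSolution

theorem hasDerivAt (hf : IsHeunSolution Ω α γ Λ f) {z : ℝ} (hz : 0 < z) :
    HasDerivAt f (deriv f z) z :=
  ((hf.contDiffOn.contDiffAt (Ioi_mem_nhds hz)).differentiableAt two_ne_zero).hasDerivAt

theorem contDiffOn_deriv (hf : IsHeunSolution Ω α γ Λ f) : ContDiffOn ℝ 1 (deriv f) (Ioi 0) :=
  hf.contDiffOn.deriv_of_isOpen isOpen_Ioi (by norm_num)

theorem hasDerivAt_deriv (hf : IsHeunSolution Ω α γ Λ f) {z : ℝ} (hz : 0 < z) :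
    HasDerivAt (deriv f) (deriv (deriv f) z) z :=
  ((hf.contDiffOn_deriv.contDiffAt (Ioi_mem_nhds hz)).differentiableAt one_ne_zero).hasDerivAt

theorem continuousOn_deriv_deriv (hf : IsHeunSolution Ω α γ Λ f) :
    ContinuousOn (deriv (deriv f)) (Ioi 0) :=
  hf.contDiffOn_deriv.continuousOn_deriv_of_isOpen isOpen_Ioi le_rfl

end IsHeunSolution

theorem hasDerivAt_one_add_mul {u : ℝ → ℂ} {u' : ℂ} {z : ℝ} (hu : HasDerivAt u u' z) :
    HasDerivAt (fun t : ℝ => (1 + t) * u t) (u z + (1 + z) * u') z :=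
  ((((hasDerivAt_id (z : ℂ)).comp_ofReal).const_add 1).mul hu).congr_deriv (by simp)

theorem hasDerivAt_ofReal_mul {u : ℝ → ℂ} {u' : ℂ} {z : ℝ} (hu : HasDerivAt u u' z) :
    HasDerivAt (fun t : ℝ => t * u t) (u z + z * u') z :=
  (((hasDerivAt_id (z : ℂ)).comp_ofReal).mul hu).congr_deriv (by simp)

/-- Coefficient of the first derivative in the equation satisfied by `(1 + z) f`. -/
noncomputable def drift (Ω α γ z : ℝ) : ℂ :=
  Complex.I * Ω + (1 - 2 * Complex.I * α) * (z : ℂ)⁻¹ -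
    (1 + 2 * Complex.I * γ) * (1 + z : ℂ)⁻¹

/-- Coefficient of the zeroth order term in the equation satisfied by `(1 + z) f`. -/
noncomputable def potential (Ω α γ Λ z : ℝ) : ℂ :=
  (Complex.I * (Ω / 2 + α + γ) - Λ - (1 + 2 * Complex.I * γ) * (1 + z : ℂ)⁻¹) *
    ((z : ℂ)⁻¹ * (1 + z : ℂ)⁻¹)

/-- The integrating factor of `drift`, normalized to have modulus `z / (1 + z)`. -/
noncomputable def driftWeight (Ω α γ z : ℝ) : ℂ :=
  Complex.exp (Complex.I * Ω * z + (1 - 2 * Complex.I * α) * Real.log z -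
    (1 + 2 * Complex.I * γ) * Real.log (1 + z))

theorem IsHeunSolution.ode_one_add_mul (hf : IsHeunSolution Ω α γ Λ f) {z : ℝ} (hz : 0 < z) :
    (2 * deriv f z + (1 + z) * deriv (deriv f) z) +
      drift Ω α γ z * (f z + (1 + z) * deriv f z) +
      potential Ω α γ Λ z * ((1 + z) * f z) = 0 := by
  have hz0 : (z : ℂ) ≠ 0 := by exact_mod_cast hz.ne'
  have hz1 : (1 + z : ℂ) ≠ 0 := by exact_mod_cast (by positivity : 1 + z ≠ 0)
  unfold drift potential
  field_simp
  linear_combination 2 * (1 + z : ℂ) * hf.ode z hz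

theorem hasDerivAt_driftWeight {z : ℝ} (hz : 0 < z) :
    HasDerivAt (driftWeight Ω α γ) (driftWeight Ω α γ z * drift Ω α γ z) z := by
  have hid : HasDerivAt (fun t : ℝ => (t : ℂ)) 1 z := (hasDerivAt_id (z : ℂ)).comp_ofReal
  have hlog : HasDerivAt (fun t : ℝ => (Real.log t : ℂ)) ((z⁻¹ : ℝ) : ℂ) z :=
    (Real.hasDerivAt_log hz.ne').ofReal_comp
  have hlog₁ : HasDerivAt (fun t : ℝ => (Real.log (1 + t) : ℂ)) (((1 + z)⁻¹ : ℝ) : ℂ) z :=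
    (by simpa using ((hasDerivAt_id z).const_add 1).log (by simp only [id]; positivity) :
      HasDerivAt (fun t => Real.log (1 + t)) (1 + z)⁻¹ z).ofReal_comp
  refine (((hid.const_mul (Complex.I * (Ω : ℂ))).add (hlog.const_mul _)).sub
    (hlog₁.const_mul _)).cexp.congr_deriv ?_
  simp only [driftWeight, drift, Pi.add_apply, Pi.sub_apply]
  push_cast
  ring

theorem norm_driftWeight {z : ℝ} (hz : 0 < z) : ‖driftWeight Ω α γ z‖ = z / (1 + z) := by
  have h1 : 0 < 1 + z := by positivity
  have hre : (Complex.I * Ω * z + (1 - 2 * Complex.I * α) * Real.log z -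
      (1 + 2 * Complex.I * γ) * Real.log (1 + z)).re = Real.log z - Real.log (1 + z) := by simp
  rw [driftWeight, Complex.norm_exp, hre, Real.exp_sub, Real.exp_log hz, Real.exp_log h1]

theorem isTheta_driftWeight : driftWeight Ω α γ =Θ[atTop] fun _ => (1 : ℂ) := by
  have hle : ∀ᶠ z : ℝ in atTop, 1 / 2 ≤ z / (1 + z) ∧ z / (1 + z) ≤ 1 := by
    filter_upwards [eventually_ge_atTop 1] with z hz
    exact ⟨by rw [div_le_div_iff₀] <;> linarith, by rw [div_le_one] <;> linarith⟩
  constructor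
  · refine IsBigO.of_bound 1 ?_
    filter_upwards [hle, eventually_gt_atTop 0] with z hz hz0
    rw [norm_driftWeight hz0, norm_one, one_mul]
    exact hz.2
  · refine IsBigO.of_bound 2 ?_
    filter_upwards [hle, eventually_gt_atTop 0] with z hz hz0
    rw [norm_driftWeight hz0, norm_one]
    linarith [hz.1]

theorem isBigO_inv_ofReal : (fun z : ℝ => (z : ℂ)⁻¹) =O[atTop] fun z : ℝ => z⁻¹ :=
  isBigO_of_le _ fun z => by rw [norm_inv, norm_inv, Complex.norm_real]

theorem isBigO_inv_one_add : (fun z : ℝ => (1 + z : ℂ)⁻¹) =O[atTop] fun z : ℝ => z⁻¹ := by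
  refine IsBigO.of_bound 1 ?_
  filter_upwards [eventually_gt_atTop 0] with z hz
  rw [show (1 + z : ℂ) = ((1 + z : ℝ) : ℂ) by push_cast; rfl, norm_inv, norm_inv, one_mul,
    Complex.norm_real, Real.norm_of_nonneg hz.le, Real.norm_of_nonneg (by positivity)]
  gcongr
  linarith

theorem isBigO_const_sub_inv_one_add (A B : ℂ) :
    (fun z : ℝ => A - B * (1 + z : ℂ)⁻¹) =O[atTop] fun _ => (1 : ℝ) :=
  (isBigO_const_const A one_ne_zero _).sub ((isBigO_inv_one_add.trans
    (tendsto_inv_atTop_zero.isBigO_one ℝ)).const_mul_left B)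

theorem isBigO_drift_sub :
    (fun z => drift Ω α γ z - Complex.I * Ω) =O[atTop] fun z : ℝ => z⁻¹ :=
  ((isBigO_inv_ofReal.const_mul_left (1 - 2 * Complex.I * α)).sub
    (isBigO_inv_one_add.const_mul_left (1 + 2 * Complex.I * γ))).congr_left
      fun z => by rw [drift]; ring

theorem isBigO_drift : drift Ω α γ =O[atTop] fun _ => (1 : ℝ) := by
  have hconst := isBigO_const_const (Complex.I * (Ω : ℂ)) (one_ne_zero (α := ℝ)) (atTop : Filter ℝ)
  exact ((isBigO_drift_sub.trans (tendsto_inv_atTop_zero.isBigO_one ℝ)).add hconst).congr_left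
    fun z => sub_add_cancel _ _

theorem isBigO_potential : potential Ω α γ Λ =O[atTop] fun z : ℝ => z⁻¹ ^ 2 :=
  ((isBigO_const_sub_inv_one_add _ _).mul (isBigO_inv_ofReal.mul isBigO_inv_one_add)).congr_right
    fun z => by ring

theorem exists_deriv_potential : ∃ Q₁ : ℝ → ℂ,
    (∀ᶠ z in atTop, HasDerivAt (potential Ω α γ Λ) (Q₁ z) z) ∧
      Q₁ =O[atTop] fun z : ℝ => z⁻¹ ^ 3 := by
  set A : ℂ := Complex.I * (Ω / 2 + α + γ) - Λ
  set B : ℂ := 1 + 2 * Complex.I * γ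
  refine ⟨fun z => B * (1 + z : ℂ)⁻¹ * ((z : ℂ)⁻¹ * (1 + z : ℂ)⁻¹ ^ 2) -
    (A - B * (1 + z : ℂ)⁻¹) * ((z : ℂ)⁻¹ ^ 2 * (1 + z : ℂ)⁻¹ + (z : ℂ)⁻¹ * (1 + z : ℂ)⁻¹ ^ 2),
    ?_, ?_⟩
  · filter_upwards [eventually_gt_atTop 0] with z hz
    have hz0 : (z : ℂ) ≠ 0 := by exact_mod_cast hz.ne'
    have hz1 : (1 + z : ℂ) ≠ 0 := by exact_mod_cast (by positivity : 1 + z ≠ 0)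
    have hid : HasDerivAt (fun t : ℝ => (t : ℂ)) 1 z := (hasDerivAt_id (z : ℂ)).comp_ofReal
    have hinv := (hid.const_add 1).inv hz1
    refine (((hinv.const_mul B).const_sub A).mul ((hid.inv hz0).mul hinv)).congr_deriv ?_
    simp only [Pi.inv_apply, Pi.mul_apply]
    field_simp
    ring
  · have hk := isBigO_inv_ofReal
    have hl := isBigO_inv_one_add
    have hB : (fun z : ℝ => B * (1 + z : ℂ)⁻¹) =O[atTop] fun _ => (1 : ℝ) :=
      (hl.trans (tendsto_inv_atTop_zero.isBigO_one ℝ)).const_mul_left B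
    have hkl : (fun z : ℝ => (z : ℂ)⁻¹ * (1 + z : ℂ)⁻¹ ^ 2) =O[atTop] fun z : ℝ => z⁻¹ ^ 3 :=
      (hk.mul (hl.pow 2)).congr_right fun z => by ring
    have hkl' : (fun z : ℝ => (z : ℂ)⁻¹ ^ 2 * (1 + z : ℂ)⁻¹) =O[atTop] fun z : ℝ => z⁻¹ ^ 3 :=
      ((hk.pow 2).mul hl).congr_right fun z => by ring
    exact ((hB.mul hkl).sub ((isBigO_const_sub_inv_one_add A B).mul (hkl'.add hkl))).congr_right
      fun z => one_mul _

theorem IsHeunSolution.isBigO_deriv_one_add_mul (hf : IsHeunSolution Ω α γ Λ f) (hΩ : Ω ≠ 0)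
    (hc : Tendsto (fun z : ℝ => (1 + z) * f z) atTop (𝓝 c)) :
    (fun z : ℝ => f z + (1 + z) * deriv f z) =O[atTop] (fun z : ℝ => z⁻¹ ^ 2) ∧
    (fun z : ℝ => 2 * deriv f z + (1 + z) * deriv (deriv f) z) =O[atTop] fun z : ℝ => z⁻¹ ^ 2 := by
  have hpos := eventually_gt_atTop (0 : ℝ)
  obtain ⟨Q₁, hQ₁, hQ₁O⟩ := exists_deriv_potential (Ω := Ω) (α := α) (γ := γ) (Λ := Λ)
  have hode := hpos.mono fun z hz => hf.ode_one_add_mul hz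
  have hO₁ : (fun z : ℝ => f z + (1 + z) * deriv f z) =O[atTop] fun z : ℝ => z⁻¹ ^ 2 :=
    isBigO_inv_sq_deriv_of_ode (hpos.mono fun z hz => hasDerivAt_one_add_mul (hf.hasDerivAt hz))
      (hpos.mono fun z hz => ((hf.hasDerivAt hz).add
        (hasDerivAt_one_add_mul (hf.hasDerivAt_deriv hz))).congr_deriv (by ring))
      hode (hpos.mono fun z hz => hasDerivAt_driftWeight hz) isTheta_driftWeight
      (mul_ne_zero Complex.I_ne_zero (by exact_mod_cast hΩ)) isBigO_drift_sub isBigO_potential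
      hQ₁ hQ₁O hc
  refine ⟨hO₁, ?_⟩
  have hP := ((isBigO_drift (Ω := Ω) (α := α) (γ := γ)).mul hO₁).congr_right fun z => one_mul _
  have hQ := ((isBigO_potential (Ω := Ω) (α := α) (γ := γ) (Λ := Λ)).mul
    (hc.isBigO_one ℝ)).congr_right fun z => mul_one _
  refine (hP.add hQ).neg_left.congr' (hode.mono fun z hz => ?_) EventuallyEq.rfl
  linear_combination -hz

theorem IsHeunSolution.isBigO_atTop (hf : IsHeunSolution Ω α γ Λ f) (hΩ : Ω ≠ 0)
    (hc : Tendsto (fun z : ℝ => (1 + z) * f z) atTop (𝓝 c)) :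
    f =O[atTop] (fun z : ℝ => z⁻¹) ∧ deriv f =O[atTop] (fun z : ℝ => z⁻¹ ^ 2) ∧
      deriv (deriv f) =O[atTop] fun z : ℝ => z⁻¹ ^ 2 := by
  have hne : ∀ᶠ z : ℝ in atTop, (1 + z : ℂ) ≠ 0 := by
    filter_upwards [eventually_gt_atTop 0] with z hz
    exact_mod_cast (by positivity : 1 + z ≠ 0)
  have hinv : (fun z : ℝ => (1 + z : ℂ)⁻¹) =O[atTop] fun _ => (1 : ℝ) :=
    isBigO_inv_one_add.trans (tendsto_inv_atTop_zero.isBigO_one ℝ)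
  obtain ⟨hO₁, hO₂⟩ := hf.isBigO_deriv_one_add_mul hΩ hc
  have hf0 : f =O[atTop] fun z : ℝ => z⁻¹ :=
    (isBigO_inv_one_add.mul (hc.isBigO_one ℝ)).congr'
      (hne.mono fun z hz => inv_mul_cancel_left₀ hz _) (Eventually.of_forall fun z => mul_one _)
  have hle : (fun z : ℝ => z⁻¹ ^ 2) =O[atTop] fun z : ℝ => z⁻¹ :=
    ((tendsto_inv_atTop_zero (𝕜 := ℝ)).isBigO_one ℝ |>.mul (isBigO_refl (fun z : ℝ => z⁻¹) _)
      ).congr (fun z => (sq _).symm) fun z => one_mul _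
  have hf1 : deriv f =O[atTop] fun z : ℝ => z⁻¹ ^ 2 := by
    refine (isBigO_inv_one_add.mul ((hO₁.trans hle).sub hf0)).congr' (hne.mono fun z hz => ?_)
      (Eventually.of_forall fun z => (sq _).symm)
    simp only [add_sub_cancel_left, inv_mul_cancel_left₀ hz]
  refine ⟨hf0, hf1, (hinv.mul (hO₂.sub (hf1.const_mul_left 2))).congr' (hne.mono fun z hz => ?_)
    (Eventually.of_forall fun z => one_mul _)⟩
  simp only [add_sub_cancel_left, inv_mul_cancel_left₀ hz]

end HeunEquation

section LaplaceEquation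

variable {Ω α γ Λ : ℝ} {f φ φ₁ : ℝ → ℂ} {p : ℂ}

theorem tendsto_ofReal_mul (hφ : IsModerate φ) :
    Tendsto (fun z : ℝ => z * φ z) (𝓝[>] 0) (𝓝 0) := by
  have hid : Tendsto (fun z : ℝ => (z : ℂ)) (𝓝[>] 0) (𝓝 0) :=
    (Complex.continuous_ofReal.tendsto' 0 0 Complex.ofReal_zero).mono_left nhdsWithin_le_nhds
  simpa using hid.zero_mul_isBoundedUnder_le hφ.isBigO_zero.isBoundedUnder_le

theorem laplace_ofReal_mul_deriv (hφ : IsModerate φ) (hφ₁ : IsModerate fun z => z * φ₁ z)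
    (hd : ∀ z > 0, HasDerivAt φ (φ₁ z) z) (hp : p.re < 0) :
    laplace (fun z => z * φ₁ z) p = -p * laplace (fun z => z * φ z) p - laplace φ p := by
  have h := laplace_deriv hφ.ofReal_mul (hφ.add hφ₁)
    (fun z hz => hasDerivAt_ofReal_mul (hd z hz)) (tendsto_ofReal_mul hφ) hp
  rw [laplace_add hφ hφ₁ hp] at h
  linear_combination h

theorem IsHeunSolution.hasDerivAt_flow (hf : IsHeunSolution Ω α γ Λ f) {z : ℝ} (hz : 0 < z) :
    HasDerivAt (fun t : ℝ => (1 + t) * (t * deriv f t) +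
        (Complex.I * Ω * (t * (t * f t)) + (Complex.I * (Ω - 2 * (α + γ)) * (t * f t) -
          2 * Complex.I * α * f t)))
      ((Complex.I * (Ω / 2 - (α + γ)) + Λ) * f z + Complex.I * Ω * (z * f z)) z := by
  have hfz := hf.hasDerivAt hz
  have hzf := hasDerivAt_ofReal_mul hfz
  refine ((hasDerivAt_one_add_mul (hasDerivAt_ofReal_mul (hf.hasDerivAt_deriv hz))).add
    (((hasDerivAt_ofReal_mul hzf).const_mul _).add
      ((hzf.const_mul _).sub (hfz.const_mul _)))).congr_deriv ?_
  linear_combination hf.ode z hz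

theorem IsHeunSolution.laplace_flow (hf : IsHeunSolution Ω α γ Λ f) (hm : IsModerate f)
    (hm₁ : IsModerate fun z => z * deriv f z)
    (h0 : Tendsto (fun z : ℝ => z * deriv f z - 2 * Complex.I * α * f z) (𝓝[>] 0) (𝓝 0))
    (hp : p.re < 0) :
    (Complex.I * (Ω / 2 - (α + γ)) + Λ) * laplace f p +
        Complex.I * Ω * laplace (fun z => z * f z) p =
      -p * (laplace (fun z => z * deriv f z) p + laplace (fun z => z * (z * deriv f z)) p +
        (Complex.I * Ω * laplace (fun z => z * (z * f z)) p +
          (Complex.I * (Ω - 2 * (α + γ)) * laplace (fun z => z * f z) p -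
            2 * Complex.I * α * laplace f p))) := by
  have hzf := hm.ofReal_mul
  have hlow := (hzf.ofReal_mul.const_mul (Complex.I * Ω)).add
    ((hzf.const_mul (Complex.I * (Ω - 2 * (α + γ)))).sub (hm.const_mul (2 * Complex.I * α)))
  have hlim : Tendsto (fun z : ℝ => z * deriv f z + z * (z * deriv f z) +
      (Complex.I * Ω * (z * (z * f z)) + (Complex.I * (Ω - 2 * (α + γ)) * (z * f z) -
        2 * Complex.I * α * f z))) (𝓝[>] 0) (𝓝 0) := by
    have h := (h0.add (tendsto_ofReal_mul hm₁)).add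
      (((tendsto_ofReal_mul hzf).const_mul (Complex.I * Ω)).add
        ((tendsto_ofReal_mul hm).const_mul (Complex.I * (Ω - 2 * (α + γ)))))
    simp only [mul_zero, add_zero] at h
    exact h.congr fun z => by ring
  have h := laplace_deriv ((hm₁.add hm₁.ofReal_mul).add hlow)
    ((hm.const_mul (Complex.I * (Ω / 2 - (α + γ)) + Λ)).add (hzf.const_mul (Complex.I * Ω)))
    (fun z hz => (hf.hasDerivAt_flow hz).congr_of_eventuallyEq
      (Eventually.of_forall fun t => by ring)) hlim hp
  rwa [laplace_add (hm.const_mul _) (hzf.const_mul _) hp, laplace_const_mul, laplace_const_mul,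
    laplace_add (hm₁.add hm₁.ofReal_mul) hlow hp, laplace_add hm₁ hm₁.ofReal_mul hp,
    laplace_add (hzf.ofReal_mul.const_mul _) ((hzf.const_mul _).sub (hm.const_mul _)) hp,
    laplace_sub (hzf.const_mul _) (hm.const_mul _) hp, laplace_const_mul, laplace_const_mul,
    laplace_const_mul] at h

theorem IsHeunSolution.laplace_ode (hf : IsHeunSolution Ω α γ Λ f) (hm : IsModerate f)
    (hm₁ : IsModerate fun z => z * deriv f z)
    (h0 : Tendsto (fun z : ℝ => z * deriv f z - 2 * Complex.I * α * f z) (𝓝[>] 0) (𝓝 0))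
    (hp : p.re < 0) :
    p * (p - Complex.I * Ω) * laplace (fun z => z * (z * f z)) p +
      (p * (p - Complex.I * Ω) + (2 * p - Complex.I * Ω) + 2 * Complex.I * (α + γ) * p) *
        laplace (fun z => z * f z) p +
      ((1 + 2 * Complex.I * α) * p + Complex.I * (α + γ) - Complex.I * Ω / 2 - Λ) *
        laplace f p = 0 := by
  have hzf := hm.ofReal_mul
  have h1 := laplace_ofReal_mul_deriv hm hm₁ (fun z hz => hf.hasDerivAt hz) hp
  have h2 := laplace_ofReal_mul_deriv hzf (φ₁ := fun z => f z + z * deriv f z)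
    ((hm.add hm₁).ofReal_mul) (fun z hz => hasDerivAt_ofReal_mul (hf.hasDerivAt hz)) hp
  rw [laplace_congr (χ := fun z : ℝ => z * f z + z * (z * deriv f z)) fun z _ => mul_add _ _ _,
    laplace_add hzf hm₁.ofReal_mul hp] at h2
  linear_combination -(hf.laplace_flow hm hm₁ h0 hp) + p * h1 + p * h2

end LaplaceEquation

section Mode

/-- `f` is a mode of the confluent Heun equation: it is `z ^ (2 i α)` times a `C²` function `h` at
the horizon `z = 0`, and decays like `z⁻¹` at infinity. Both conditions are one-sided: the second
local exponent at `0` and the other oscillation at infinity are excluded. -/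
structure IsHeunMode (Ω α γ Λ : ℝ) (f h : ℝ → ℂ) : Prop extends IsHeunSolution Ω α γ Λ f where
  contDiffAt : ContDiffAt ℝ 2 h 0
  eventuallyEq : f =ᶠ[𝓝[>] 0] fun z : ℝ => (z : ℂ) ^ (2 * Complex.I * α) * h z
  tendsto : ∃ c, Tendsto (fun z : ℝ => (1 + z) * f z) atTop (𝓝 c)

variable {Ω α γ Λ : ℝ} {f h : ℝ → ℂ} {p : ℂ}

theorem re_two_mul_I_mul (α : ℝ) : (2 * Complex.I * α).re = 0 := by simp

namespace IsHeunMode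

theorem isBigO_one (hf : IsHeunMode Ω α γ Λ f h) (hΩ : Ω ≠ 0) :
    f =O[atTop] fun _ => (1 : ℝ) := by
  obtain ⟨c, hc⟩ := hf.tendsto
  exact (hf.isBigO_atTop hΩ hc).1.trans (tendsto_inv_atTop_zero.isBigO_one ℝ)

theorem isModerate (hf : IsHeunMode Ω α γ Λ f h) (hΩ : Ω ≠ 0) : IsModerate f :=
  isModerate_of_eq_cpow_mul (re_two_mul_I_mul α) hf.contDiffOn.continuousOn
    hf.contDiffAt.continuousAt hf.eventuallyEq (hf.isBigO_one hΩ)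

theorem ofReal_mul_deriv_eq (hf : IsHeunMode Ω α γ Λ f h) :
    (fun z : ℝ => z * deriv f z) =ᶠ[𝓝[>] 0] fun z : ℝ =>
      (z : ℂ) ^ (2 * Complex.I * α) * (2 * Complex.I * α * h z + z * deriv h z) := by
  have hh := (eventually_hasDerivAt_of_contDiffAt hf.contDiffAt).filter_mono
    (nhdsWithin_le_nhds (s := Ioi 0))
  filter_upwards [eventuallyEq_deriv_of_eq_cpow_mul hf.eventuallyEq
    (eventually_nhdsWithin_of_forall fun z hz => hf.hasDerivAt hz) (hh.mono fun z hz => hz.1),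
    self_mem_nhdsWithin] with z hz hz0
  have hz0 : (z : ℂ) ≠ 0 := by exact_mod_cast (ne_of_gt hz0 : z ≠ 0)
  rw [hz, Complex.cpow_sub _ _ hz0, Complex.cpow_one]
  field_simp

theorem isModerate_ofReal_mul_deriv (hf : IsHeunMode Ω α γ Λ f h) (hΩ : Ω ≠ 0) :
    IsModerate fun z => z * deriv f z := by
  obtain ⟨c, hc⟩ := hf.tendsto
  have hh : ContinuousAt (deriv h) 0 :=
    (contDiffAt_deriv (n := 1) hf.contDiffAt).continuousAt
  refine isModerate_of_eq_cpow_mul (re_two_mul_I_mul α)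
    (Complex.continuous_ofReal.continuousOn.mul hf.contDiffOn_deriv.continuousOn)
    ((continuousAt_const.mul hf.contDiffAt.continuousAt).add
      (Complex.continuous_ofReal.continuousAt.mul hh)) hf.ofReal_mul_deriv_eq ?_
  have hid : (fun z : ℝ => (z : ℂ)) =O[atTop] fun z => z :=
    isBigO_of_le _ fun z => (Complex.norm_real z).le
  refine ((hid.mul (hf.isBigO_atTop hΩ hc).2.1).trans_eventuallyEq
    (g₂ := fun z : ℝ => z⁻¹) ?_).trans (tendsto_inv_atTop_zero.isBigO_one ℝ)
  filter_upwards [eventually_ne_atTop 0] with z hz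
  field_simp

theorem tendsto_indicial (hf : IsHeunMode Ω α γ Λ f h) :
    Tendsto (fun z : ℝ => z * deriv f z - 2 * Complex.I * α * f z) (𝓝[>] 0) (𝓝 0) := by
  have hO : (fun z : ℝ => z * deriv h z) =O[𝓝[>] 0] fun z => z ^ 1 := by
    have hh : ContinuousAt (deriv h) 0 :=
      (contDiffAt_deriv (n := 1) hf.contDiffAt).continuousAt
    have hid : (fun z : ℝ => (z : ℂ)) =O[𝓝[>] 0] fun z => z :=
      isBigO_of_le _ fun z => (Complex.norm_real z).le
    simpa using hid.mul ((hh.tendsto.isBigO_one ℝ).mono nhdsWithin_le_nhds)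
  have hz : Tendsto (fun z : ℝ => z ^ 1) (𝓝[>] 0) (𝓝 0) :=
    ((continuous_pow 1).tendsto' 0 0 (by simp)).mono_left nhdsWithin_le_nhds
  refine Tendsto.congr' ?_ ((isBigO_cpow_mul (re_two_mul_I_mul α) 0 1 (by simpa using hO)
    ).trans_tendsto hz)
  filter_upwards [hf.ofReal_mul_deriv_eq, hf.eventuallyEq] with z hz1 hz2
  rw [hz1, hz2, Nat.cast_zero, sub_zero]
  ring

theorem laplace_ode (hf : IsHeunMode Ω α γ Λ f h) (hΩ : Ω ≠ 0) (hp : p.re < 0) :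
    p * (p - Complex.I * Ω) * laplace (fun z => z * (z * f z)) p +
      (p * (p - Complex.I * Ω) + (2 * p - Complex.I * Ω) + 2 * Complex.I * (α + γ) * p) *
        laplace (fun z => z * f z) p +
      ((1 + 2 * Complex.I * α) * p + Complex.I * (α + γ) - Complex.I * Ω / 2 - Λ) *
        laplace f p = 0 :=
  hf.toIsHeunSolution.laplace_ode (hf.isModerate hΩ) (hf.isModerate_ofReal_mul_deriv hΩ)
    hf.tendsto_indicial hp

theorem exists_norm_laplace_sub_le (hf : IsHeunMode Ω α γ Λ f h) (hΩ : Ω ≠ 0) :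
    ∃ C, ∀ p : ℂ, p.re < 0 →
      ‖laplace f p - h 0 * laplace (gammaKernel (1 + 2 * Complex.I * α)) p‖ ≤ C / ‖p‖ ^ 2 := by
  obtain ⟨c, hc⟩ := hf.tendsto
  exact exists_norm_laplace_sub_gammaKernel_le (re_two_mul_I_mul α) (fun z hz => hf.hasDerivAt hz)
    (fun z hz => hf.hasDerivAt_deriv hz) hf.continuousOn_deriv_deriv hf.contDiffAt
    hf.eventuallyEq (hf.isBigO_one hΩ) (hf.isBigO_atTop hΩ hc).2.2

theorem exists_norm_laplace_one_add_mul_sub_le (hf : IsHeunMode Ω α γ Λ f h) (hΩ : Ω ≠ 0) :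
    ∃ C, ∀ p : ℂ, p.re < 0 → ‖laplace (fun z => (1 + z) * f z) p -
      h 0 * laplace (gammaKernel (1 + 2 * Complex.I * α)) p‖ ≤ C / ‖p‖ ^ 2 := by
  obtain ⟨c, hc⟩ := hf.tendsto
  have hid : ContDiff ℝ 2 fun z : ℝ => (1 + z : ℂ) :=
    contDiff_const.add Complex.ofRealCLM.contDiff
  have hcont : ContinuousOn (fun z : ℝ => 2 * deriv f z + (1 + z) * deriv (deriv f) z) (Ioi 0) :=
    (continuousOn_const.mul hf.contDiffOn_deriv.continuousOn).add
      (hid.continuous.continuousOn.mul hf.continuousOn_deriv_deriv)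
  simpa using exists_norm_laplace_sub_gammaKernel_le (u := fun z => (1 + z) * h z)
    (re_two_mul_I_mul α) (fun z hz => hasDerivAt_one_add_mul (hf.hasDerivAt hz))
    (fun z hz => ((hf.hasDerivAt hz).add (hasDerivAt_one_add_mul
      (hf.hasDerivAt_deriv hz))).congr_deriv (by ring))
    hcont (hid.contDiffAt.mul hf.contDiffAt)
    (by filter_upwards [hf.eventuallyEq] with z hz; rw [hz]; ring) (hc.isBigO_one ℝ)
    (hf.isBigO_deriv_one_add_mul hΩ hc).2

/-- The transforms of `f` and of `(1 + z) f` have the same leading term at infinity, because the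
two functions agree at `z = 0`. -/
theorem exists_norm_laplace_ofReal_mul_le (hf : IsHeunMode Ω α γ Λ f h) (hΩ : Ω ≠ 0) :
    ∃ C, ∀ p : ℂ, p.re < 0 → ‖laplace (fun z => z * f z) p‖ ≤ C / ‖p‖ ^ 2 := by
  obtain ⟨C₁, hC₁⟩ := hf.exists_norm_laplace_sub_le hΩ
  obtain ⟨C₂, hC₂⟩ := hf.exists_norm_laplace_one_add_mul_sub_le hΩ
  have hm := hf.isModerate hΩ
  refine ⟨C₂ + C₁, fun p hp => ?_⟩
  have hsplit : laplace (fun z => (1 + z) * f z) p =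
      laplace f p + laplace (fun z => z * f z) p := by
    rw [← laplace_add hm hm.ofReal_mul hp]
    exact laplace_congr (fun z _ => by ring) p
  have h := norm_sub_le_of_le (hC₂ p hp) (hC₁ p hp)
  rwa [hsplit, sub_sub_sub_cancel_right, add_sub_cancel_left, ← add_div] at h

end IsHeunMode

end Mode

section Line

variable {Ω ε v : ℝ}

/-- The line `p = i Ω v - ε`, parametrised by `v`. As `ε → 0` it approaches the imaginary axis,
which contains the singular points `p = 0` and `p = i Ω` of the transformed equation. -/
def line (Ω ε v : ℝ) : ℂ := Complex.I * Ω * v - ε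

theorem re_line_neg (hε : 0 < ε) : (line Ω ε v).re < 0 := by simpa [line] using hε

theorem hasDerivAt_line : HasDerivAt (line Ω ε) (Complex.I * Ω) v :=
  ((((hasDerivAt_id v).ofReal_comp).const_mul (Complex.I * (Ω : ℂ))).sub_const (ε : ℂ)).congr_deriv
    (by simp)

theorem line_sub : line Ω ε v - Complex.I * Ω = line Ω ε (v - 1) := by
  simp only [line]
  push_cast
  ring

theorem norm_line_sq : ‖line Ω ε v‖ ^ 2 = (Ω * v) ^ 2 + ε ^ 2 := by
  rw [← Complex.normSq_eq_norm_sq, Complex.normSq_apply]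
  simp only [line, Complex.sub_re, Complex.sub_im, Complex.mul_re, Complex.mul_im, Complex.I_re,
    Complex.I_im, Complex.ofReal_re, Complex.ofReal_im]
  ring

theorem le_norm_line : |Ω| * v ≤ ‖line Ω ε v‖ := by
  refine le_of_sq_le_sq ?_ (norm_nonneg _)
  rw [norm_line_sq, mul_pow, mul_pow, sq_abs]
  exact le_add_of_nonneg_right (sq_nonneg ε)

theorem norm_line_sub_one_le (hv : 1 ≤ v) : ‖line Ω ε (v - 1)‖ ≤ ‖line Ω ε v‖ := by
  refine le_of_sq_le_sq ?_ (norm_nonneg _)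
  rw [norm_line_sq, norm_line_sq, mul_pow, mul_pow]
  have : v - 1 ≤ v := by linarith
  have : 0 ≤ v - 1 := by linarith
  gcongr

theorem norm_line_zero (hε : 0 ≤ ε) : ‖line Ω ε 0‖ = ε := by simp [line, abs_of_nonneg hε]

theorem norm_line_le (hv : 0 ≤ v) (hε : 0 ≤ ε) : ‖line Ω ε v‖ ≤ |Ω| * v + ε := by
  refine (norm_sub_le _ _).trans (le_of_eq ?_)
  simp [abs_of_nonneg hv, abs_of_nonneg hε]

end Line

section Flux

/-- The flux of a solution of the transformed equation through the point `line Ω ε v`, in terms of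
the values `w`, `w'` of the solution and of its derivative there. It is the quadratic form whose
derivative along the line vanishes as `ε → 0`. -/
noncomputable def flux (Ω μ ε v : ℝ) (w w' : ℂ) : ℝ :=
  ((-(Complex.I / Ω) * (line Ω ε v * line Ω ε (v - 1)) * w' +
    Complex.I * (Ω / 2 * v * (v - 1) + μ * v) * w) * conj w).im

/-- The derivative of the flux along the line, divided by `ε`. -/
noncomputable def fluxDefect (Ω α μ ε v : ℝ) (w w' : ℂ) : ℝ :=
  (((Complex.I * (Ω * (2 * v - 1) : ℝ) - ε + 2 * Complex.I * μ) * w' +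
    (1 + 2 * Complex.I * α) * w) * conj w).im + Ω * (2 * v - 1) * ‖w'‖ ^ 2

variable {Ω α μ Λ ε v A : ℝ} {w w' w'' : ℂ} {F F' F'' : ℝ → ℂ}

theorem I_div_mul_I_mul (hΩ : Ω ≠ 0) : Complex.I / (Ω : ℂ) * (Complex.I * Ω) = -1 := by
  rw [div_mul_eq_mul_div, ← mul_assoc, Complex.I_mul_I, neg_one_mul, neg_div,
    div_self (Complex.ofReal_ne_zero.2 hΩ)]

theorem star_I_mul_ofReal_mul : star (Complex.I * Ω * w) = -(Complex.I * Ω) * star w := by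
  simp [mul_comm]

theorem flux_coeff_deriv (hΩ : Ω ≠ 0)
    (hode : line Ω ε v * line Ω ε (v - 1) * w'' +
      (line Ω ε v * line Ω ε (v - 1) + (line Ω ε v + line Ω ε (v - 1)) +
        2 * Complex.I * μ * line Ω ε v) * w' +
      ((1 + 2 * Complex.I * α) * line Ω ε v + Complex.I * μ - Complex.I * Ω / 2 - Λ) * w = 0) :
    -(Complex.I / Ω) * (Complex.I * Ω * (line Ω ε v + line Ω ε (v - 1)) * w' +
        line Ω ε v * line Ω ε (v - 1) * (Complex.I * Ω * w'')) =
      (Ω * Ω * v * (v - 1) + 2 * μ * Ω * v : ℝ) * w' -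
        (Complex.I * (Ω * v + μ - Ω / 2 : ℝ) - (2 * α * Ω * v + Λ : ℝ)) * w +
      ε * ((Complex.I * (Ω * (2 * v - 1) : ℝ) - ε + 2 * Complex.I * μ) * w' +
        (1 + 2 * Complex.I * α) * w) := by
  calc _ = (line Ω ε v + line Ω ε (v - 1)) * w' + line Ω ε v * line Ω ε (v - 1) * w'' := by
        linear_combination (-((line Ω ε v + line Ω ε (v - 1)) * w' +
          line Ω ε v * line Ω ε (v - 1) * w'')) * I_div_mul_I_mul hΩ
    _ = _ := by
        simp only [line] at hode ⊢
        push_cast at hode ⊢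
        linear_combination hode - (Ω ^ 2 * v * (v - 1) * w' + 2 * μ * Ω * v * w' +
          2 * α * Ω * v * w) * Complex.I_mul_I

theorem im_flux_boundary (hΩ : Ω ≠ 0) :
    (-(Complex.I / Ω) * (line Ω ε v * line Ω ε (v - 1)) * w' * star (Complex.I * Ω * w')).im =
      ε * (Ω * (2 * v - 1) * ‖w'‖ ^ 2) := by
  calc _ = (-(line Ω ε v * line Ω ε (v - 1)) * (‖w'‖ ^ 2 : ℝ)).im := by
        rw [star_I_mul_ofReal_mul, Complex.ofReal_pow, ← Complex.mul_conj', starRingEnd_apply]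
        congr 1
        linear_combination (line Ω ε v * line Ω ε (v - 1) * (w' * star w')) * I_div_mul_I_mul hΩ
    _ = _ := by
        rw [Complex.im_mul_ofReal]
        simp only [line, Complex.neg_im, Complex.mul_im, Complex.sub_re, Complex.sub_im,
          Complex.mul_re, Complex.I_re, Complex.I_im, Complex.ofReal_re, Complex.ofReal_im]
        ring

theorem im_flux_interior :
    (((Ω * Ω * v * (v - 1) + 2 * μ * Ω * v : ℝ) * w' -
          (Complex.I * (Ω * v + μ - Ω / 2 : ℝ) - (2 * α * Ω * v + Λ : ℝ)) * w +
        (Complex.I * (Ω * v + μ - Ω / 2 : ℝ) * w +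
          Complex.I * (Ω / 2 * v * (v - 1) + μ * v : ℝ) * (Complex.I * Ω * w'))) * star w +
      Complex.I * (Ω / 2 * v * (v - 1) + μ * v : ℝ) * w * star (Complex.I * Ω * w')).im = 0 := by
  have hadd : w' * star w + w * star w' = (2 * (w' * star w).re : ℝ) := by
    rw [← Complex.add_conj, ← Complex.star_def, star_mul', star_star, mul_comm (star w')]
  have hsq : w * star w = ‖w‖ ^ 2 := Complex.mul_conj' w
  convert Complex.ofReal_im (Ω * (Ω / 2 * v * (v - 1) + μ * v) * (2 * (w' * star w).re) +
    (2 * α * Ω * v + Λ) * ‖w‖ ^ 2) using 2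
  rw [star_I_mul_ofReal_mul]
  push_cast at hadd ⊢
  linear_combination Ω * (Ω / 2 * v * (v - 1) + μ * v) * hadd + (2 * α * Ω * v + Λ) * hsq +
    (Ω * (Ω / 2 * v * (v - 1) + μ * v) * (w' * star w - w * star w')) * Complex.I_mul_I

theorem hasDerivAt_flux (hΩ : Ω ≠ 0) (hF : HasDerivAt F (Complex.I * Ω * F' v) v)
    (hF' : HasDerivAt F' (Complex.I * Ω * w'') v)
    (hode : line Ω ε v * line Ω ε (v - 1) * w'' +
      (line Ω ε v * line Ω ε (v - 1) + (line Ω ε v + line Ω ε (v - 1)) +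
        2 * Complex.I * μ * line Ω ε v) * F' v +
      ((1 + 2 * Complex.I * α) * line Ω ε v + Complex.I * μ - Complex.I * Ω / 2 - Λ) * F v = 0) :
    HasDerivAt (fun v => flux Ω μ ε v (F v) (F' v)) (ε * fluxDefect Ω α μ ε v (F v) (F' v)) v := by
  have hv : HasDerivAt (fun v : ℝ => (v : ℂ)) 1 v := (hasDerivAt_id v).ofReal_comp
  have hp : HasDerivAt (fun v => line Ω ε v * line Ω ε (v - 1))
      (Complex.I * Ω * (line Ω ε v + line Ω ε (v - 1))) v :=
    (hasDerivAt_line.mul (hasDerivAt_line.comp_sub_const v 1)).congr_deriv (by ring)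
  have hX : HasDerivAt
      (fun v => -(Complex.I / Ω) * (line Ω ε v * line Ω ε (v - 1)) * F' v)
      ((Ω * Ω * v * (v - 1) + 2 * μ * Ω * v : ℝ) * F' v -
        (Complex.I * (Ω * v + μ - Ω / 2 : ℝ) - (2 * α * Ω * v + Λ : ℝ)) * F v +
        ε * ((Complex.I * (Ω * (2 * v - 1) : ℝ) - ε + 2 * Complex.I * μ) * F' v +
          (1 + 2 * Complex.I * α) * F v)) v :=
    ((hp.const_mul (-(Complex.I / (Ω : ℂ)))).mul hF').congr_deriv
      (by rw [← flux_coeff_deriv hΩ hode]; ring)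
  have hk := (((hv.const_mul ((Ω : ℂ) / 2)).mul (hv.sub_const 1)).add
    (hv.const_mul (μ : ℂ))).const_mul Complex.I
  refine (Complex.imCLM.hasFDerivAt.comp_hasDerivAt v
    ((hX.add (hk.mul hF)).mul hF.star)).congr_deriv ?_
  have hb := im_flux_boundary (ε := ε) (v := v) (w' := F' v) hΩ
  have hi := im_flux_interior (Ω := Ω) (α := α) (μ := μ) (Λ := Λ) (v := v) (w := F v) (w' := F' v)
  rw [fluxDefect, mul_add ε, ← hb, ← Complex.im_ofReal_mul, ← Complex.add_im,
    ← add_zero (Complex.im _), ← hi, ← Complex.add_im, Complex.imCLM_apply]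
  congr 1
  simp only [Pi.mul_apply, Pi.add_apply, starRingEnd_apply]
  push_cast
  ring

theorem abs_fluxDefect_le (hε : 0 < ε) (hε1 : ε ≤ 1) (hv : 1 ≤ v) (hw : ‖w‖ ≤ A)
    (hw' : ‖w'‖ ≤ A) :
    |fluxDefect Ω α μ ε v w w'| ≤ (4 * |Ω| * v + 2 + 2 * |μ| + 2 * |α|) * A ^ 2 := by
  have hA : 0 ≤ A := (norm_nonneg w).trans hw
  have hv' : |Ω * (2 * v - 1)| ≤ |Ω| * (2 * v) := by
    rw [abs_mul, abs_of_nonneg (by linarith : 0 ≤ 2 * v - 1)]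
    gcongr
    linarith
  have h₁ : ‖Complex.I * (Ω * (2 * v - 1) : ℝ) - ε + 2 * Complex.I * μ‖ ≤
      |Ω| * (2 * v) + 1 + 2 * |μ| := by
    refine norm_add_le_of_le (norm_sub_le_of_le ?_ ?_) ?_
    · rwa [norm_mul, Complex.norm_I, one_mul, Complex.norm_real, Real.norm_eq_abs]
    · rwa [Complex.norm_real, Real.norm_of_nonneg hε.le]
    · simp
  have h₂ : ‖1 + 2 * Complex.I * (α : ℂ)‖ ≤ 1 + 2 * |α| := norm_add_le_of_le (by simp) (by simp)
  have h₃ : ‖((Complex.I * (Ω * (2 * v - 1) : ℝ) - ε + 2 * Complex.I * μ) * w' +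
      (1 + 2 * Complex.I * α) * w) * conj w‖ ≤
      ((|Ω| * (2 * v) + 1 + 2 * |μ|) * A + (1 + 2 * |α|) * A) * A := by
    rw [norm_mul, RCLike.norm_conj]
    exact mul_le_mul (norm_add_le_of_le (norm_mul_le_of_le h₁ hw') (norm_mul_le_of_le h₂ hw))
      hw (norm_nonneg _) (by positivity)
  have h₄ : |Ω * (2 * v - 1) * ‖w'‖ ^ 2| ≤ |Ω| * (2 * v) * A ^ 2 := by
    rw [abs_mul, abs_of_nonneg (sq_nonneg ‖w'‖)]
    gcongr
  calc _ ≤ _ := (abs_add_le _ _).trans (add_le_add ((Complex.abs_im_le_norm _).trans h₃) h₄)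
    _ = _ := by ring

theorem abs_flux_sub_le (hΩ : Ω ≠ 0) (hε : 0 < ε) (hε1 : ε ≤ 1) {V : ℝ} (hV : 1 ≤ V)
    (hF : ∀ v ∈ Icc 1 V, HasDerivAt F (Complex.I * Ω * F' v) v)
    (hF' : ∀ v ∈ Icc 1 V, HasDerivAt F' (Complex.I * Ω * F'' v) v)
    (hode : ∀ v ∈ Icc 1 V, line Ω ε v * line Ω ε (v - 1) * F'' v +
      (line Ω ε v * line Ω ε (v - 1) + (line Ω ε v + line Ω ε (v - 1)) +
        2 * Complex.I * μ * line Ω ε v) * F' v +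
      ((1 + 2 * Complex.I * α) * line Ω ε v + Complex.I * μ - Complex.I * Ω / 2 - Λ) * F v = 0)
    (hA : ∀ v ∈ Icc 1 V, ‖F v‖ ≤ A) (hA' : ∀ v ∈ Icc 1 V, ‖F' v‖ ≤ A) :
    |flux Ω μ ε V (F V) (F' V) - flux Ω μ ε 1 (F 1) (F' 1)| ≤
      ε * ((4 * |Ω| * V + 2 + 2 * |μ| + 2 * |α|) * A ^ 2) * (V - 1) := by
  have h := (convex_Icc 1 V).norm_image_sub_le_of_norm_hasDerivWithin_le
    (f := fun v => flux Ω μ ε v (F v) (F' v))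
    (C := ε * ((4 * |Ω| * V + 2 + 2 * |μ| + 2 * |α|) * A ^ 2))
    (fun v hv => (hasDerivAt_flux hΩ (hF v hv) (hF' v hv) (hode v hv)).hasDerivWithinAt)
    (fun v hv => ?_) (left_mem_Icc.2 hV) (right_mem_Icc.2 hV)
  · rwa [Real.norm_eq_abs, Real.norm_of_nonneg (by linarith)] at h
  · rw [norm_mul, Real.norm_of_nonneg hε.le]
    have hle := abs_fluxDefect_le (Ω := Ω) (α := α) (μ := μ) hε hε1 hv.1 (hA v hv) (hA' v hv)
    have hvV := hv.2
    exact mul_le_mul_of_nonneg_left (hle.trans (by gcongr)) hε.le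

/-- Up to a boundary term, `Ω` times the flux is a multiple of `‖w‖ ^ 2` whose sign is that of
`Ω * μ` at `v = 1` and positive for large `v`. -/
theorem abs_mul_flux_sub_le (hΩ : Ω ≠ 0) :
    |Ω * flux Ω μ ε v w w' - Ω * (Ω / 2 * v * (v - 1) + μ * v) * ‖w‖ ^ 2| ≤
      ‖line Ω ε v‖ * ‖line Ω ε (v - 1)‖ * ‖w'‖ * ‖w‖ := by
  have hflux : Ω * flux Ω μ ε v w w' - Ω * (Ω / 2 * v * (v - 1) + μ * v) * ‖w‖ ^ 2 =
      Ω * (-(Complex.I / Ω) * (line Ω ε v * line Ω ε (v - 1)) * w' * conj w).im := by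
    have hreal : Complex.I * (Ω / 2 * v * (v - 1) + μ * v) * (‖w‖ : ℂ) ^ 2 =
        ((Ω / 2 * v * (v - 1) + μ * v) * ‖w‖ ^ 2 : ℝ) * Complex.I := by push_cast; ring
    rw [flux, add_mul, Complex.add_im, mul_assoc _ w, Complex.mul_conj', hreal,
      Complex.im_ofReal_mul, Complex.I_im]
    ring
  rw [hflux, abs_mul]
  refine (mul_le_mul_of_nonneg_left (Complex.abs_im_le_norm _) (abs_nonneg _)).trans (le_of_eq ?_)
  simp only [norm_mul, norm_neg, norm_div, Complex.norm_I, Complex.norm_real, Real.norm_eq_abs,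
    RCLike.norm_conj]
  have := abs_ne_zero.2 hΩ
  field_simp

end Flux

section LeadingCoefficient

variable {Ω α γ Λ ε v : ℝ} {f h : ℝ → ℂ}

theorem hasDerivAt_laplace_line {φ : ℝ → ℂ} (hφ : IsModerate φ) (hε : 0 < ε) :
    HasDerivAt (fun v => laplace φ (line Ω ε v))
      (Complex.I * Ω * laplace (fun z => z * φ z) (line Ω ε v)) v :=
  (HasDerivAt.comp v (hasDerivAt_laplace hφ (re_line_neg hε)) hasDerivAt_line).congr_deriv
    (mul_comm _ _)

namespace IsHeunMode

theorem exists_mul_norm_laplace_sub_le (hf : IsHeunMode Ω α γ Λ f h) (hΩ : Ω ≠ 0) :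
    ∃ C, ∀ ε > 0, ∀ v ≥ 1, v * ‖laplace f (line Ω ε v) -
      h 0 * laplace (gammaKernel (1 + 2 * Complex.I * α)) (line Ω ε v)‖ ≤ C / v := by
  obtain ⟨C, hC⟩ := hf.exists_norm_laplace_sub_le hΩ
  have hC0 : 0 ≤ C := by simpa using (norm_nonneg _).trans (hC (-1) (by simp))
  have : 0 < |Ω| := abs_pos.2 hΩ
  refine ⟨C / |Ω| ^ 2, fun ε hε v hv => ?_⟩
  have : 0 < v := one_pos.trans_le hv
  have hp : |Ω| * v ≤ ‖line Ω ε v‖ := le_norm_line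
  calc _ ≤ v * (C / (|Ω| * v) ^ 2) := by
        gcongr
        exact (hC _ (re_line_neg hε)).trans (by gcongr)
    _ = C / |Ω| ^ 2 / v := by field_simp

theorem exists_mul_norm_laplace_le (hf : IsHeunMode Ω α γ Λ f h) (hΩ : Ω ≠ 0) :
    ∃ A, ∀ ε > 0, ∀ v ≥ 1, v * ‖laplace f (line Ω ε v)‖ ≤ A := by
  obtain ⟨C, hC⟩ := hf.exists_mul_norm_laplace_sub_le hΩ
  obtain ⟨D, hD⟩ := exists_norm_laplace_gammaKernel_le
    (a := 1 + 2 * Complex.I * (α : ℂ)) le_rfl (by simp)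
  have hC0 : 0 ≤ C := by
    have h1 := hC 1 one_pos 1 le_rfl
    rw [one_mul, div_one] at h1
    exact (norm_nonneg _).trans h1
  have hD0 : 0 ≤ D := by simpa using (norm_nonneg _).trans (hD (-1) (by simp))
  have : 0 < |Ω| := abs_pos.2 hΩ
  refine ⟨‖h 0‖ * (D / |Ω|) + C, fun ε hε v hv => ?_⟩
  have : 0 < v := one_pos.trans_le hv
  have hp : |Ω| * v ≤ ‖line Ω ε v‖ := le_norm_line
  set L := laplace (gammaKernel (1 + 2 * Complex.I * α)) (line Ω ε v)
  have hLD : v * ‖L‖ ≤ D / |Ω| :=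
    calc v * ‖L‖ ≤ v * (D / (|Ω| * v) ^ 1) := by
          gcongr
          exact (hD _ (re_line_neg hε)).trans (by gcongr)
      _ = D / |Ω| := by field_simp
  calc v * ‖laplace f (line Ω ε v)‖
    _ ≤ v * (‖h 0 * L‖ + ‖laplace f (line Ω ε v) - h 0 * L‖) := by
        gcongr
        exact norm_le_norm_add_norm_sub' _ _
    _ = ‖h 0‖ * (v * ‖L‖) + v * ‖laplace f (line Ω ε v) - h 0 * L‖ := by rw [norm_mul]; ring
    _ ≤ ‖h 0‖ * (D / |Ω|) + C := by
        gcongr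
        exact (hC ε hε v hv).trans (div_le_self hC0 hv)

theorem exists_sq_mul_norm_laplace_ofReal_mul_le (hf : IsHeunMode Ω α γ Λ f h) (hΩ : Ω ≠ 0) :
    ∃ B, ∀ ε > 0, ∀ v, ‖line Ω ε v‖ ^ 2 * ‖laplace (fun z => z * f z) (line Ω ε v)‖ ≤ B := by
  obtain ⟨B, hB⟩ := hf.exists_norm_laplace_ofReal_mul_le hΩ
  refine ⟨B, fun ε hε v => ?_⟩
  have hp : 0 < ‖line Ω ε v‖ := norm_pos_iff.2 fun h0 => by
    simpa [h0] using re_line_neg (Ω := Ω) (v := v) hε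
  rw [mul_comm, ← le_div_iff₀ (by positivity)]
  exact hB _ (re_line_neg hε)

theorem laplace_ode_line (hf : IsHeunMode Ω α γ Λ f h) (hΩ : Ω ≠ 0) (hε : 0 < ε) :
    line Ω ε v * line Ω ε (v - 1) * laplace (fun z => z * (z * f z)) (line Ω ε v) +
      (line Ω ε v * line Ω ε (v - 1) + (line Ω ε v + line Ω ε (v - 1)) +
        2 * Complex.I * (α + γ : ℝ) * line Ω ε v) * laplace (fun z => z * f z) (line Ω ε v) +
      ((1 + 2 * Complex.I * α) * line Ω ε v + Complex.I * (α + γ : ℝ) - Complex.I * Ω / 2 - Λ) *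
        laplace f (line Ω ε v) = 0 := by
  have hode := hf.laplace_ode hΩ (re_line_neg (Ω := Ω) (v := v) hε)
  rw [← line_sub]
  push_cast
  linear_combination hode

theorem exists_abs_flux_sub_le (hf : IsHeunMode Ω α γ Λ f h) (hΩ : Ω ≠ 0) {V : ℝ}
    (hV : 1 ≤ V) :
    ∃ K, ∀ ε ∈ Ioc (0 : ℝ) 1,
      |flux Ω (α + γ) ε V (laplace f (line Ω ε V)) (laplace (fun z => z * f z) (line Ω ε V)) -
        flux Ω (α + γ) ε 1 (laplace f (line Ω ε 1)) (laplace (fun z => z * f z) (line Ω ε 1))| ≤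
      ε * K := by
  obtain ⟨A, hA⟩ := hf.exists_mul_norm_laplace_le hΩ
  obtain ⟨B, hB⟩ := hf.exists_sq_mul_norm_laplace_ofReal_mul_le hΩ
  refine ⟨_, fun ε ⟨hε, hε1⟩ => (abs_flux_sub_le (A := max A (B / |Ω| ^ 2)) hΩ hε hε1 hV
    (fun v _ => hasDerivAt_laplace_line (hf.isModerate hΩ) hε)
    (fun v _ => hasDerivAt_laplace_line (hf.isModerate hΩ).ofReal_mul hε)
    (fun v _ => hf.laplace_ode_line hΩ hε) (fun v hv => ?_) fun v hv => ?_).trans_eq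
    (mul_assoc _ _ _)⟩
  · exact (le_mul_of_one_le_left (norm_nonneg _) hv.1).trans
      ((hA ε hε v hv.1).trans (le_max_left _ _))
  · have hΩ0 : 0 < |Ω| := abs_pos.2 hΩ
    have hp : |Ω| ≤ ‖line Ω ε v‖ := (le_mul_of_one_le_right hΩ0.le hv.1).trans le_norm_line
    refine le_trans ?_ (le_max_right _ _)
    rw [le_div_iff₀' (by positivity)]
    refine le_trans ?_ (hB ε hε v)
    gcongr

/-- At `v = 1` the flux is at most `O(ε)` because of the sign of `α + γ`, and it is conserved up to
`O(ε)`; this bounds the transform at `v = V`. -/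
theorem exists_mul_sq_norm_laplace_le (hf : IsHeunMode Ω α γ Λ f h) (hΩ : Ω ≠ 0)
    (hμ : Ω * (α + γ) ≤ 0) :
    ∃ B, ∀ V ≥ 1, ∃ K, ∀ ε ∈ Ioc (0 : ℝ) 1,
      Ω * (Ω / 2 * V * (V - 1) + (α + γ) * V) * ‖laplace f (line Ω ε V)‖ ^ 2 ≤
        B * ‖laplace f (line Ω ε V)‖ + ε * K := by
  obtain ⟨A, hA⟩ := hf.exists_mul_norm_laplace_le hΩ
  obtain ⟨B, hB⟩ := hf.exists_sq_mul_norm_laplace_ofReal_mul_le hΩ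
  refine ⟨B, fun V hV => ?_⟩
  obtain ⟨K, hK⟩ := hf.exists_abs_flux_sub_le hΩ hV
  refine ⟨|Ω| * K + B / |Ω| * A, fun ε hε => ?_⟩
  set F := fun v => laplace f (line Ω ε v)
  set F' := fun v => laplace (fun z => z * f z) (line Ω ε v)
  have hend : ‖line Ω ε V‖ * ‖line Ω ε (V - 1)‖ * ‖F' V‖ ≤ B :=
    calc _ ≤ ‖line Ω ε V‖ * ‖line Ω ε V‖ * ‖F' V‖ := by
          gcongr
          exact norm_line_sub_one_le hV
      _ ≤ B := by rw [← sq]; exact hB ε hε.1 V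
  have hF'1 : ‖line Ω ε 1‖ * ‖F' 1‖ ≤ B / |Ω| := by
    rw [le_div_iff₀' (abs_pos.2 hΩ), ← mul_assoc]
    refine le_trans ?_ (hB ε hε.1 1)
    rw [sq]
    gcongr
    simpa using le_norm_line (Ω := Ω) (ε := ε) (v := 1)
  have hstart : ‖line Ω ε 1‖ * ‖line Ω ε (1 - 1)‖ * ‖F' 1‖ * ‖F 1‖ ≤ ε * (B / |Ω| * A) := by
    rw [sub_self, norm_line_zero hε.1.le, mul_right_comm _ ε, mul_right_comm _ ε, mul_comm _ ε]
    have hF1 : ‖F 1‖ ≤ A := by simpa using hA ε hε.1 1 le_rfl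
    exact mul_le_mul_of_nonneg_left (mul_le_mul hF'1 hF1 (norm_nonneg _)
      (le_trans (by positivity) hF'1)) hε.1.le
  have hconst : |Ω * flux Ω (α + γ) ε V (F V) (F' V) - Ω * flux Ω (α + γ) ε 1 (F 1) (F' 1)| ≤
      ε * (|Ω| * K) := by
    rw [← mul_sub, abs_mul, mul_left_comm]
    exact mul_le_mul_of_nonneg_left (hK ε hε) (abs_nonneg _)
  have h₁ := (abs_le.1 ((abs_mul_flux_sub_le (μ := α + γ) hΩ).trans hstart)).2
  have h₂ := (abs_le.1 ((abs_mul_flux_sub_le (μ := α + γ) hΩ).trans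
    (mul_le_mul_of_nonneg_right hend (norm_nonneg (F V))))).1
  have hsign : Ω * (α + γ) * ‖F 1‖ ^ 2 ≤ 0 := mul_nonpos_of_nonpos_of_nonneg hμ (sq_nonneg _)
  linarith [(abs_le.1 hconst).2]

theorem exists_sq_mul_le (hf : IsHeunMode Ω α γ Λ f h) (hΩ : Ω ≠ 0) (hμ : Ω * (α + γ) ≤ 0) :
    ∃ C, ∀ V ≥ 1, ∃ K, ∀ ε ∈ Ioc (0 : ℝ) 1,
      (V * ‖laplace f (line Ω ε V)‖) ^ 2 * V ≤ C + ε * K := by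
  obtain ⟨A, hA⟩ := hf.exists_mul_norm_laplace_le hΩ
  obtain ⟨B, hB⟩ := hf.exists_mul_sq_norm_laplace_le hΩ hμ
  refine ⟨2 / Ω ^ 2 * (|Ω ^ 2 / 2 - Ω * (α + γ)| * A ^ 2 + |B| * A), fun V hV => ?_⟩
  obtain ⟨K, hK⟩ := hB V hV
  refine ⟨2 / Ω ^ 2 * (K * V), fun ε hε => ?_⟩
  have hV0 : 0 < V := one_pos.trans_le hV
  set y := V * ‖laplace f (line Ω ε V)‖ with hy
  have hy0 : 0 ≤ y := by positivity
  have hyA : y ≤ A := hA ε hε.1 V hV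
  have hflux : Ω ^ 2 / 2 * (y ^ 2 * V) ≤
      (Ω ^ 2 / 2 - Ω * (α + γ)) * y ^ 2 + B * y + ε * (K * V) := by
    have hKV := mul_le_mul_of_nonneg_right (hK ε hε) hV0.le
    rw [hy]
    linear_combination hKV
  have hcoeff : (Ω ^ 2 / 2 - Ω * (α + γ)) * y ^ 2 ≤ |Ω ^ 2 / 2 - Ω * (α + γ)| * A ^ 2 :=
    (mul_le_mul_of_nonneg_right (le_abs_self _) (sq_nonneg y)).trans (by gcongr)
  have hB : B * y ≤ |B| * A := (mul_le_mul_of_nonneg_right (le_abs_self B) hy0).trans (by gcongr)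
  calc y ^ 2 * V = 2 / Ω ^ 2 * (Ω ^ 2 / 2 * (y ^ 2 * V)) := by field_simp
    _ ≤ 2 / Ω ^ 2 * (|Ω ^ 2 / 2 - Ω * (α + γ)| * A ^ 2 + |B| * A + ε * (K * V)) := by
        gcongr
        linarith
    _ = _ := by ring

theorem exists_le_mul_norm_laplace (hf : IsHeunMode Ω α γ Λ f h) (hΩ : Ω ≠ 0) :
    ∃ c > 0, ∃ C, ∀ V ≥ 1, ∀ ε ∈ Ioc (0 : ℝ) 1,
      ‖h 0‖ * c ≤ V * ‖laplace f (line Ω ε V)‖ + C / V := by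
  obtain ⟨C, hC⟩ := hf.exists_mul_norm_laplace_sub_le hΩ
  obtain ⟨c, hc, hγ⟩ := exists_le_norm_laplace_gammaKernel (a := 1 + 2 * Complex.I * (α : ℂ))
    (by simp)
  refine ⟨c / (2 + |Ω|), by positivity, C, fun V hV ε hε => ?_⟩
  have hV0 : 0 < V := one_pos.trans_le hV
  set p := line Ω ε V
  have hp : p.re < 0 := re_line_neg hε.1
  have h1p : ‖1 - p‖ ≤ (2 + |Ω|) * V :=
    calc ‖1 - p‖ ≤ 1 + (|Ω| * V + ε) := norm_sub_le_of_le (by simp) (norm_line_le hV0.le hε.1.le)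
      _ ≤ (2 + |Ω|) * V := by linarith [hε.2]
  set L := laplace (gammaKernel (1 + 2 * Complex.I * α)) p
  have hL : c / (2 + |Ω|) ≤ V * ‖L‖ :=
    calc c / (2 + |Ω|) = V * (c / ((2 + |Ω|) * V)) := by field_simp
      _ ≤ V * (c / ‖1 - p‖) := by
          have := one_pos.trans_le (one_le_norm_one_sub hp)
          gcongr
      _ ≤ V * ‖L‖ := by gcongr; exact hγ p hp
  calc ‖h 0‖ * (c / (2 + |Ω|)) ≤ ‖h 0‖ * (V * ‖L‖) := by gcongr
    _ = V * ‖h 0 * L‖ := by rw [norm_mul]; ring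
    _ ≤ V * (‖laplace f p‖ + ‖laplace f p - h 0 * L‖) := by
        gcongr
        exact norm_le_norm_add_norm_sub _ _
    _ ≤ V * ‖laplace f p‖ + C / V := by
        rw [mul_add]
        gcongr
        exact hC ε hε.1 V hV

theorem horizon_value_eq_zero (hf : IsHeunMode Ω α γ Λ f h) (hΩ : Ω ≠ 0)
    (hμ : Ω * (α + γ) ≤ 0) : h 0 = 0 := by
  obtain ⟨c, hc, C, hC⟩ := hf.exists_le_mul_norm_laplace hΩ
  obtain ⟨D, hD⟩ := hf.exists_sq_mul_le hΩ hμ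
  have hbound : ∀ V ≥ 1, (‖h 0‖ * c) ^ 2 * V ≤ 2 * D + 2 * C ^ 2 := by
    intro V hV
    obtain ⟨K, hK⟩ := hD V hV
    have hlim : Tendsto (fun ε : ℝ => 2 * (D + ε * K) + 2 * C ^ 2) (𝓝[>] 0)
        (𝓝 (2 * D + 2 * C ^ 2)) :=
      (Continuous.tendsto' (by fun_prop) 0 _ (by ring)).mono_left nhdsWithin_le_nhds
    refine ge_of_tendsto hlim ?_
    filter_upwards [Ioc_mem_nhdsGT one_pos] with ε hε
    have hV0 : 0 < V := one_pos.trans_le hV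
    set y := V * ‖laplace f (line Ω ε V)‖
    have hCV : (C / V) ^ 2 * V ≤ C ^ 2 := by
      rw [div_pow, div_mul_eq_mul_div, sq V, mul_div_mul_right _ _ hV0.ne']
      exact div_le_self (sq_nonneg C) hV
    calc (‖h 0‖ * c) ^ 2 * V ≤ (y + C / V) ^ 2 * V := by gcongr; exact hC V hV ε hε
      _ ≤ 2 * (y ^ 2 + (C / V) ^ 2) * V := by gcongr; exact add_sq_le
      _ = 2 * (y ^ 2 * V) + 2 * ((C / V) ^ 2 * V) := by ring
      _ ≤ 2 * (D + ε * K) + 2 * C ^ 2 := by gcongr; exact hK ε hε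
  by_contra h0
  have hpos : 0 < (‖h 0‖ * c) ^ 2 := by positivity
  obtain ⟨V, hV, hV1⟩ := (((tendsto_id.const_mul_atTop hpos).eventually_gt_atTop _).and
    (eventually_ge_atTop 1)).exists
  exact (hbound V hV1).not_gt hV

end IsHeunMode

end LeadingCoefficient

section Uniqueness

variable {g g₁ g₂ P Q w : ℝ → ℂ}

theorem eq_zero_of_initial {a b : ℝ} (hab : a ≤ b)
    (hg : ∀ z ∈ Icc a b, HasDerivAt g (g₁ z) z) (hg₁ : ∀ z ∈ Icc a b, HasDerivAt g₁ (g₂ z) z)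
    (hode : ∀ z ∈ Icc a b, g₂ z + P z * g₁ z + Q z * g z = 0) (hP : ContinuousOn P (Icc a b))
    (hQ : ContinuousOn Q (Icc a b)) (h0 : g a = 0) (h1 : g₁ a = 0) : g b = 0 := by
  obtain ⟨K₁, hK₁⟩ := isCompact_Icc.exists_bound_of_continuousOn hP
  obtain ⟨K₀, hK₀⟩ := isCompact_Icc.exists_bound_of_continuousOn hQ
  have hd : ∀ z ∈ Icc a b, HasDerivAt (fun z => (g z, g₁ z)) (g₁ z, g₂ z) z :=
    fun z hz => (hg z hz).prodMk (hg₁ z hz)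
  have hbound : ∀ z ∈ Ico a b, ‖(g₁ z, g₂ z)‖ ≤ max 1 (K₁ + K₀) * ‖(g z, g₁ z)‖ + 0 := by
    intro z hz
    have hz := Ico_subset_Icc_self hz
    have n0 : ‖g z‖ ≤ ‖(g z, g₁ z)‖ := norm_fst_le (g z, g₁ z)
    have n1 : ‖g₁ z‖ ≤ ‖(g z, g₁ z)‖ := norm_snd_le (g z, g₁ z)
    have h₂ : ‖g₂ z‖ ≤ (K₁ + K₀) * ‖(g z, g₁ z)‖ := calc
      ‖g₂ z‖ = ‖P z * g₁ z + Q z * g z‖ := by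
        rw [← norm_neg, ← eq_neg_of_add_eq_zero_right ((add_assoc _ _ _).symm.trans (hode z hz))]
      _ ≤ K₁ * ‖(g z, g₁ z)‖ + K₀ * ‖(g z, g₁ z)‖ :=
        norm_add_le_of_le (norm_mul_le_of_le (hK₁ z hz) n1) (norm_mul_le_of_le (hK₀ z hz) n0)
      _ = _ := (add_mul _ _ _).symm
    rw [add_zero]
    exact max_le (n1.trans (le_mul_of_one_le_left (norm_nonneg _) (le_max_left _ _)))
      (h₂.trans (by gcongr; exact le_max_right _ _))
  have key := norm_le_gronwallBound_of_norm_deriv_right_le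
    (fun z hz => (hd z hz).continuousAt.continuousWithinAt)
    (fun z hz => (hd z (Ico_subset_Icc_self hz)).hasDerivWithinAt)
    (by rw [h0, h1, Prod.mk_zero_zero, norm_zero]) hbound b (right_mem_Icc.2 hab)
  rw [gronwallBound_ε0_δ0] at key
  exact congrArg Prod.fst (norm_le_zero_iff.1 key)

theorem norm_le_mul_of_tendsto_zero {E : Type*} [NormedAddCommGroup E] [NormedSpace ℝ E]
    {g g' : ℝ → E} {z B : ℝ} (hz : 0 < z) (hg : ∀ t ∈ Ioc 0 z, HasDerivAt g (g' t) t)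
    (hB : ∀ t ∈ Ioc 0 z, ‖g' t‖ ≤ B) (h0 : Tendsto g (𝓝[>] 0) (𝓝 0)) : ‖g z‖ ≤ B * z := by
  have hB0 : 0 ≤ B := (norm_nonneg _).trans (hB z ⟨hz, le_rfl⟩)
  have hlim : Tendsto (fun t => ‖g z - g t‖) (𝓝[>] 0) (𝓝 ‖g z‖) := by
    simpa only [sub_zero] using (h0.const_sub (g z)).norm
  refine le_of_tendsto hlim (eventually_of_mem (Ioo_mem_nhdsGT hz) fun t ht => ?_)
  have hle := (convex_Icc t z).norm_image_sub_le_of_norm_hasDerivWithin_le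
    (fun s hs => (hg s ⟨ht.1.trans_le hs.1, hs.2⟩).hasDerivWithinAt)
    (fun s hs => hB s ⟨ht.1.trans_le hs.1, hs.2⟩) (left_mem_Icc.2 ht.2.le)
    (right_mem_Icc.2 ht.2.le)
  refine hle.trans (mul_le_mul_of_nonneg_left ?_ hB0)
  rw [Real.norm_of_nonneg (sub_nonneg.2 ht.2.le)]
  exact sub_le_self z ht.1.le

theorem eq_zero_of_norm_le_half {ι E : Type*} [NormedAddCommGroup E] {s : Set ι} {u : ι → E}
    {N : ℝ} (hN : ∀ x ∈ s, ‖u x‖ ≤ N)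
    (hstep : ∀ B, (∀ x ∈ s, ‖u x‖ ≤ B) → ∀ x ∈ s, ‖u x‖ ≤ B / 2) : ∀ x ∈ s, u x = 0 := by
  have hiter : ∀ n : ℕ, ∀ x ∈ s, ‖u x‖ ≤ N / 2 ^ n := by
    intro n
    induction n with
    | zero => simpa using hN
    | succ n ih => simpa only [div_div, ← pow_succ] using hstep _ ih
  intro x hx
  have hlim : Tendsto (fun n : ℕ => N / 2 ^ n) atTop (𝓝 0) :=
    tendsto_const_nhds.div_atTop (tendsto_pow_atTop_atTop_of_one_lt one_lt_two)
  exact norm_le_zero_iff.1 (ge_of_tendsto' hlim fun n => hiter n x hx)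

theorem eq_zero_of_weight_bound {C K N η : ℝ} (hC : 0 ≤ C)
    (hη : C * K * η ≤ 1 / 2) (hg : ∀ z ∈ Ioc 0 η, HasDerivAt g (g₁ z) z)
    (hwg : ∀ z ∈ Ioc 0 η, HasDerivAt (fun z => w z * g₁ z) (-(w z * Q z * g z)) z)
    (hwQ : ∀ z ∈ Ioc 0 η, ‖w z * Q z‖ ≤ K) (hw : ∀ z ∈ Ioc 0 η, z ≤ C * ‖w z‖)
    (hN : ∀ z ∈ Ioc 0 η, ‖g₁ z‖ ≤ N) (h0 : Tendsto g (𝓝[>] 0) (𝓝 0))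
    (hw0 : Tendsto (fun z => w z * g₁ z) (𝓝[>] 0) (𝓝 0)) :
    ∀ z ∈ Ioc 0 η, g z = 0 ∧ g₁ z = 0 := by
  have hg_le : ∀ B, (∀ z ∈ Ioc 0 η, ‖g₁ z‖ ≤ B) → ∀ z ∈ Ioc 0 η, ‖g z‖ ≤ B * z :=
    fun B hB z hz => norm_le_mul_of_tendsto_zero hz.1 (fun t ht => hg t ⟨ht.1, ht.2.trans hz.2⟩)
      (fun t ht => hB t ⟨ht.1, ht.2.trans hz.2⟩) h0
  have hg₁0 : ∀ z ∈ Ioc 0 η, g₁ z = 0 := by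
    refine eq_zero_of_norm_le_half hN fun B hB z hz => ?_
    have hB0 : 0 ≤ B := (norm_nonneg _).trans (hB z hz)
    have hK0 : 0 ≤ K := (norm_nonneg _).trans (hwQ z hz)
    have hwg_le : ‖w z * g₁ z‖ ≤ K * (B * z) * z := by
      refine norm_le_mul_of_tendsto_zero hz.1 (fun t ht => hwg t ⟨ht.1, ht.2.trans hz.2⟩)
        (fun t ht => ?_) hw0
      have htη : t ∈ Ioc 0 η := ⟨ht.1, ht.2.trans hz.2⟩
      rw [norm_neg]
      exact norm_mul_le_of_le (hwQ t htη)
        ((hg_le B hB t htη).trans (mul_le_mul_of_nonneg_left ht.2 hB0))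
    refine le_of_mul_le_mul_left ?_ hz.1
    calc z * ‖g₁ z‖ ≤ C * ‖w z‖ * ‖g₁ z‖ := by gcongr; exact hw z hz
      _ = C * ‖w z * g₁ z‖ := by rw [norm_mul, mul_assoc]
      _ ≤ C * (K * (B * z) * z) := by gcongr
      _ = z * (C * K * z * B) := by ring
      _ ≤ z * (C * K * η * B) := by gcongr; exacts [hz.1.le, hz.2]
      _ ≤ z * (1 / 2 * B) := by gcongr; exact hz.1.le
      _ = z * (B / 2) := by ring
  refine fun z hz => ⟨norm_le_zero_iff.1 ?_, hg₁0 z hz⟩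
  simpa using hg_le 0 (fun t ht => by rw [hg₁0 t ht, norm_zero]) z hz

/-- A weight `w` of size `z` makes both indicial roots at `0` purely imaginary, so a solution
cannot tend to `0` without vanishing. -/
theorem eventually_eq_zero_of_tendsto_zero (hg : ∀ᶠ z in 𝓝[>] 0, HasDerivAt g (g₁ z) z)
    (hg₁ : ∀ᶠ z in 𝓝[>] 0, HasDerivAt g₁ (g₂ z) z)
    (hode : ∀ᶠ z in 𝓝[>] 0, g₂ z + P z * g₁ z + Q z * g z = 0)
    (hw : ∀ᶠ z in 𝓝[>] 0, HasDerivAt w (w z * P z) z) (hwz : w =Θ[𝓝[>] 0] fun z : ℝ => z)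
    (hQ : Q =O[𝓝[>] 0] fun z : ℝ => z⁻¹) (h0 : Tendsto g (𝓝[>] 0) (𝓝 0))
    (h1 : g₁ =O[𝓝[>] 0] fun _ => (1 : ℝ)) : ∀ᶠ z in 𝓝[>] 0, g z = 0 ∧ g₁ z = 0 := by
  have hpos : ∀ᶠ z : ℝ in 𝓝[>] 0, 0 < z := self_mem_nhdsWithin
  have hwQ : (fun z => w z * Q z) =O[𝓝[>] 0] fun _ => (1 : ℝ) :=
    (hwz.1.mul hQ).trans_eventuallyEq (hpos.mono fun z hz => mul_inv_cancel₀ hz.ne')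
  have hw0 : Tendsto (fun z => w z * g₁ z) (𝓝[>] 0) (𝓝 0) :=
    (hwz.1.mul h1).trans_tendsto (((continuous_mul_const 1).tendsto' 0 0 (zero_mul 1)).mono_left
      nhdsWithin_le_nhds)
  have hwg : ∀ᶠ z in 𝓝[>] 0, HasDerivAt (fun z => w z * g₁ z) (-(w z * Q z * g z)) z := by
    filter_upwards [hw, hg₁, hode] with z hwz hgz hz
    exact (hwz.mul hgz).congr_deriv (by linear_combination w z * hz)
  obtain ⟨N, hN⟩ := h1.bound
  obtain ⟨K, hK0, hK⟩ := hwQ.exists_pos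
  obtain ⟨C, hC0, hC⟩ := hwz.2.exists_pos
  obtain ⟨δ, hδ, hall⟩ := mem_nhdsGT_iff_exists_Ioo_subset.1
    (hg.and (hwg.and (hK.bound.and (hC.bound.and hN))))
  have hδ : 0 < δ := hδ
  set η := min (δ / 2) (1 / (2 * (C * K)))
  have hη0 : 0 < η := by positivity
  have hη : C * K * η ≤ 1 / 2 := calc
    C * K * η ≤ C * K * (1 / (2 * (C * K))) := by gcongr; exact min_le_right _ _
    _ = 1 / 2 := by field_simp
  have hall : ∀ z ∈ Ioc 0 η, _ := fun z hz =>
    hall ⟨hz.1, (hz.2.trans (min_le_left _ _)).trans_lt (half_lt_self hδ)⟩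
  filter_upwards [Ioc_mem_nhdsGT hη0] using eq_zero_of_weight_bound hC0.le hη
    (fun z hz => (hall z hz).1) (fun z hz => (hall z hz).2.1)
    (fun z hz => by simpa using (hall z hz).2.2.1)
    (fun z hz => (le_abs_self z).trans (hall z hz).2.2.2.1)
    (fun z hz => by simpa using (hall z hz).2.2.2.2) h0 hw0

end Uniqueness

section Vanishing

variable {Ω α γ Λ : ℝ} {f h : ℝ → ℂ}

theorem isTheta_driftWeight_zero : driftWeight Ω α γ =Θ[𝓝[>] 0] fun z : ℝ => z := by
  have hz : ∀ᶠ z : ℝ in 𝓝[>] 0, 0 < z ∧ z < 1 := Ioo_mem_nhdsGT one_pos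
  constructor
  · refine IsBigO.of_bound 1 (hz.mono fun z hz => ?_)
    rw [norm_driftWeight hz.1, one_mul, Real.norm_of_nonneg hz.1.le]
    exact div_le_self hz.1.le (by linarith)
  · refine IsBigO.of_bound 2 (hz.mono fun z hz => ?_)
    rw [norm_driftWeight hz.1, Real.norm_of_nonneg hz.1.le, mul_div_assoc',
      le_div_iff₀ (by linarith)]
    nlinarith

theorem continuousOn_inv_one_add : ContinuousOn (fun z : ℝ => (1 + z : ℂ)⁻¹) (Ici 0) :=
  ContinuousOn.inv₀ (continuous_const.add Complex.continuous_ofReal).continuousOn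
    fun z (hz : 0 ≤ z) => (by exact_mod_cast (by positivity : 1 + z ≠ 0) : (1 + z : ℂ) ≠ 0)

theorem continuousOn_inv_ofReal : ContinuousOn (fun z : ℝ => (z : ℂ)⁻¹) (Ioi 0) :=
  Complex.continuous_ofReal.continuousOn.inv₀ fun z (hz : 0 < z) => by exact_mod_cast hz.ne'

theorem continuousOn_drift : ContinuousOn (drift Ω α γ) (Ioi 0) :=
  (continuousOn_const.add (continuousOn_const.mul continuousOn_inv_ofReal)).sub
    (continuousOn_const.mul (continuousOn_inv_one_add.mono Ioi_subset_Ici_self))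

theorem continuousOn_potential : ContinuousOn (potential Ω α γ Λ) (Ioi 0) :=
  have hinv := continuousOn_inv_one_add.mono Ioi_subset_Ici_self
  (continuousOn_const.sub (continuousOn_const.mul hinv)).mul (continuousOn_inv_ofReal.mul hinv)

theorem isBigO_potential_zero : potential Ω α γ Λ =O[𝓝[>] 0] fun z : ℝ => z⁻¹ := by
  have hinv : Tendsto (fun z : ℝ => (1 + z : ℂ)⁻¹) (𝓝[>] 0) (𝓝 (1 + (0 : ℝ) : ℂ)⁻¹) :=
    (continuousOn_inv_one_add 0 self_mem_Ici).mono_left (nhdsWithin_mono _ Ioi_subset_Ici_self)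
  have hz : (fun z : ℝ => (z : ℂ)⁻¹) =O[𝓝[>] 0] fun z : ℝ => z⁻¹ :=
    isBigO_of_le _ fun z => by rw [norm_inv, norm_inv, Complex.norm_real]
  exact ((((hinv.const_mul _).const_sub _).isBigO_one ℝ).mul
    (hz.mul (hinv.isBigO_one ℝ))).congr_right fun z => by rw [one_mul, mul_one]

namespace IsHeunMode

theorem isBigO_of_horizon_value_eq_zero (hf : IsHeunMode Ω α γ Λ f h) (h0 : h 0 = 0) :
    f =O[𝓝[>] 0] (fun z : ℝ => z ^ 1) ∧ deriv f =O[𝓝[>] 0] fun z : ℝ => z ^ 0 := by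
  have hs := re_two_mul_I_mul α
  have hd := (eventually_hasDerivAt_of_contDiffAt hf.contDiffAt).filter_mono
    (nhdsWithin_le_nhds (s := Ioi 0))
  have hh : h =O[𝓝[>] 0] fun z : ℝ => z ^ 1 := by
    simpa [h0] using
      (hf.contDiffAt.differentiableAt two_ne_zero).isBigO_sub.mono nhdsWithin_le_nhds
  have hh' : (fun z : ℝ => z * deriv h z) =O[𝓝[>] 0] fun z : ℝ => z ^ 1 := by
    have hid : (fun z : ℝ => (z : ℂ)) =O[𝓝[>] 0] fun z => z :=
      isBigO_of_le _ fun z => (Complex.norm_real z).le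
    simpa using hid.mul (((contDiffAt_deriv (n := 1) hf.contDiffAt).continuousAt.tendsto.isBigO_one
      ℝ).mono nhdsWithin_le_nhds)
  refine ⟨hf.eventuallyEq.trans_isBigO (by simpa using isBigO_cpow_mul hs 0 1 (by simpa using hh)),
    (eventuallyEq_deriv_of_eq_cpow_mul hf.eventuallyEq
      (eventually_nhdsWithin_of_forall fun z hz => hf.hasDerivAt hz)
      (hd.mono fun z hz => hz.1)).trans_isBigO ?_⟩
  simpa using isBigO_cpow_mul hs 1 0 ((hh.const_mul_left (2 * Complex.I * α)).add hh')

theorem eventually_eq_zero (hf : IsHeunMode Ω α γ Λ f h) (h0 : h 0 = 0) :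
    ∀ᶠ z : ℝ in 𝓝[>] 0, (1 + z) * f z = 0 ∧ f z + (1 + z) * deriv f z = 0 := by
  obtain ⟨hO, hO₁⟩ := hf.isBigO_of_horizon_value_eq_zero h0
  have hone : Tendsto (fun z : ℝ => (1 + z : ℂ)) (𝓝[>] 0) (𝓝 1) :=
    ((continuous_const.add Complex.continuous_ofReal).tendsto' 0 1 (by simp)).mono_left
      nhdsWithin_le_nhds
  have hf0 : Tendsto f (𝓝[>] 0) (𝓝 0) := hO.trans_tendsto
    (((continuous_pow 1).tendsto' 0 0 (by simp)).mono_left nhdsWithin_le_nhds)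
  refine eventually_eq_zero_of_tendsto_zero (P := drift Ω α γ) (Q := potential Ω α γ Λ)
    (g₂ := fun z => 2 * deriv f z + (1 + z) * deriv (deriv f) z) ?_ ?_ ?_ ?_
    (isTheta_driftWeight_zero (Ω := Ω) (α := α) (γ := γ)) isBigO_potential_zero
    (by simpa using hone.mul hf0)
    ((hf0.isBigO_one ℝ).add (by simpa using (hone.isBigO_one ℝ).mul hO₁))
  all_goals refine eventually_nhdsWithin_of_forall fun z (hz : 0 < z) => ?_
  · exact hasDerivAt_one_add_mul (hf.hasDerivAt hz)
  · exact ((hf.hasDerivAt hz).add (hasDerivAt_one_add_mul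
      (hf.hasDerivAt_deriv hz))).congr_deriv (by ring)
  · exact hf.ode_one_add_mul hz
  · exact hasDerivAt_driftWeight hz

theorem eq_zero (hf : IsHeunMode Ω α γ Λ f h) (hΩ : Ω ≠ 0) (hμ : Ω * (α + γ) ≤ 0) :
    ∀ z > 0, f z = 0 := by
  intro b hb
  obtain ⟨a, ⟨h0, h1⟩, ha⟩ :=
    ((hf.eventually_eq_zero (hf.horizon_value_eq_zero hΩ hμ)).and (Ioc_mem_nhdsGT hb)).exists
  have hsub : Icc a b ⊆ Ioi 0 := fun z hz => ha.1.trans_le hz.1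
  have hgb : (1 + b) * f b = 0 := eq_zero_of_initial (g := fun z => (1 + z) * f z) ha.2
    (fun z hz => hasDerivAt_one_add_mul (hf.hasDerivAt (hsub hz)))
    (fun z hz => ((hf.hasDerivAt (hsub hz)).add (hasDerivAt_one_add_mul
      (hf.hasDerivAt_deriv (hsub hz)))).congr_deriv (by ring))
    (fun z hz => hf.ode_one_add_mul (hsub hz)) (continuousOn_drift.mono hsub)
    (continuousOn_potential.mono hsub) h0 h1
  exact (mul_eq_zero.1 hgb).resolve_left (by exact_mod_cast (by positivity : 1 + b ≠ 0))

end IsHeunMode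

end Vanishing

section Conjugation

variable {Ω α γ Λ : ℝ} {u : ℝ → ℂ} {z : ℝ}

/-- The phase `α log z + γ log (1 + z) - Ω z / 2` whose exponential conjugates the formally
self-adjoint form of the confluent Heun equation to the form of `IsHeunSolution`. -/
noncomputable def phase (Ω α γ z : ℝ) : ℝ :=
  α * Real.log z + γ * Real.log (1 + z) - Ω / 2 * z

/-- The derivative of `phase`. -/
noncomputable def phaseDeriv (Ω α γ z : ℝ) : ℝ := α / z + γ / (1 + z) - Ω / 2

theorem hasDerivAt_phase (hz : 0 < z) : HasDerivAt (phase Ω α γ) (phaseDeriv Ω α γ z) z := by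
  have hlog := (((hasDerivAt_id z).const_add 1).log (by simp only [id]; linarith)).const_mul γ
  refine ((((Real.hasDerivAt_log hz.ne').const_mul α).add hlog).sub
    ((hasDerivAt_id z).const_mul (Ω / 2))).congr_deriv ?_
  simp only [phaseDeriv, id]
  ring

theorem hasDerivAt_phaseDeriv (hz : 0 < z) :
    HasDerivAt (phaseDeriv Ω α γ) (-α / z ^ 2 - γ / (1 + z) ^ 2) z := by
  have hz1 : 1 + z ≠ 0 := by linarith
  refine ((((hasDerivAt_const z α).div (hasDerivAt_id z) hz.ne').add
    ((hasDerivAt_const z γ).div ((hasDerivAt_id z).const_add 1) hz1)).sub_const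
      (Ω / 2)).congr_deriv ?_
  simp only [id]
  ring

theorem contDiffOn_phase : ContDiffOn ℝ 2 (phase Ω α γ) (Ioi 0) := by
  have hlog : ContDiffOn ℝ 2 (fun z : ℝ => Real.log (1 + z)) (Ioi 0) :=
    (contDiffOn_const.add contDiffOn_id).log fun z (hz : 0 < z) => by positivity
  exact ((contDiffOn_const.mul (contDiffOn_id.log fun z hz => hz.ne')).add
    (contDiffOn_const.mul hlog)).sub (contDiffOn_const.mul contDiffOn_id)

theorem hasDerivAt_exp_I_mul {θ : ℝ → ℝ} {θ₁ : ℝ} {u₁ : ℂ} (hθ : HasDerivAt θ θ₁ z)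
    (hu : HasDerivAt u u₁ z) : HasDerivAt (fun t => Complex.exp (Complex.I * θ t) * u t)
      (Complex.exp (Complex.I * θ z) * (Complex.I * θ₁ * u z + u₁)) z :=
  ((hθ.ofReal_comp.const_mul Complex.I).cexp.mul hu).congr_deriv (by ring)

theorem mul_phaseDeriv (hz : 0 < z) : z * (1 + z) * phaseDeriv Ω α γ z =
    -(Ω / 2 * z * (1 + z) - α * (1 + z) - γ * z) := by
  rw [phaseDeriv]
  field_simp
  ring

theorem mul_deriv_phaseDeriv (hz : 0 < z) :
    z * (1 + z) * (-α / z ^ 2 - γ / (1 + z) ^ 2) + (1 + 2 * z) * phaseDeriv Ω α γ z =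
      -(Ω * (z + 1 / 2) - (α + γ)) := by
  rw [phaseDeriv]
  field_simp
  ring

theorem isHeunSolution_exp_phase_mul (hu : ContDiffOn ℝ 2 u (Ioi 0))
    (hode : ∀ z > 0, z * (1 + z) * deriv (deriv u) z + (1 + 2 * z) * deriv u z +
      (z * (1 + z) * phaseDeriv Ω α γ z ^ 2 - Λ) * u z = 0) :
    IsHeunSolution Ω α γ Λ fun z => Complex.exp (Complex.I * phase Ω α γ z) * u z := by
  set f : ℝ → ℂ := fun z => Complex.exp (Complex.I * phase Ω α γ z) * u z with hf
  have hd : ∀ z > 0, HasDerivAt u (deriv u z) z := fun z hz =>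
    ((hu.contDiffAt (Ioi_mem_nhds hz)).differentiableAt two_ne_zero).hasDerivAt
  have hd₁ : ∀ z > 0, HasDerivAt (deriv u) (deriv (deriv u) z) z := fun z hz =>
    (((hu.deriv_of_isOpen (m := 1) isOpen_Ioi le_rfl).contDiffAt
      (Ioi_mem_nhds hz)).differentiableAt one_ne_zero).hasDerivAt
  have hf₁ : EqOn (deriv f) (fun z => Complex.exp (Complex.I * phase Ω α γ z) *
      (Complex.I * phaseDeriv Ω α γ z * u z + deriv u z)) (Ioi 0) := fun z hz =>
    (hasDerivAt_exp_I_mul (hasDerivAt_phase hz) (hd z hz)).deriv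
  refine ⟨(contDiffOn_const.mul
    (Complex.ofRealCLM.contDiff.comp_contDiffOn contDiffOn_phase)).cexp.mul hu, fun z hz => ?_⟩
  have hf₂ := (hf₁.deriv isOpen_Ioi hz).trans
    (hasDerivAt_exp_I_mul (hasDerivAt_phase (Ω := Ω) (α := α) (γ := γ) hz)
      ((((hasDerivAt_phaseDeriv (Ω := Ω) (α := α) (γ := γ) hz).ofReal_comp.const_mul
        Complex.I).mul (hd z hz)).add (hd₁ z hz))).deriv
  have hphase := congrArg Complex.ofReal (mul_phaseDeriv (Ω := Ω) (α := α) (γ := γ) hz)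
  have hphase₁ := congrArg Complex.ofReal (mul_deriv_phaseDeriv (Ω := Ω) (α := α) (γ := γ) hz)
  rw [Complex.ofReal_neg, eq_neg_iff_add_eq_zero] at hphase hphase₁
  rw [hf₂, hf₁ hz, hf]
  simp only [Pi.mul_apply, Pi.add_apply]
  push_cast at hphase hphase₁ ⊢
  set e := Complex.exp (Complex.I * phase Ω α γ z)
  linear_combination e * hode z hz + e * Complex.I * u z * hphase₁ +
    2 * e * Complex.I * (Complex.I * phaseDeriv Ω α γ z * u z + deriv u z) * hphase -
    e * z * (1 + z) * phaseDeriv Ω α γ z ^ 2 * u z * Complex.I_sq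

end Conjugation

end ConfluentHeun

namespace KerrNewman

open ConfluentHeun
open Asymptotics Filter Set
open scoped ComplexConjugate Manifold Topology

section SturmLiouville

variable {a b : ℝ} {p q ρ : ℝ → ℝ} {S S₁ : ℝ → ℂ} {lam : ℂ}

theorem hasDerivAt_im_mul_conj {θ : ℝ} (hS : HasDerivAt S (S₁ θ) θ)
    (hp : HasDerivAt (fun s => p s * S₁ s) ((q θ - lam * ρ θ) * S θ) θ) :
    HasDerivAt (fun s => (p s * S₁ s * conj (S s)).im)
      (-(lam.im * (ρ θ * Complex.normSq (S θ)))) θ := by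
  refine (Complex.imCLM.hasFDerivAt.comp_hasDerivAt θ (hp.mul hS.star)).congr_deriv ?_
  have hpot : (q θ - lam * ρ θ) * S θ * conj (S θ) =
      ((q θ * Complex.normSq (S θ) : ℝ) : ℂ) - lam * (ρ θ * Complex.normSq (S θ) : ℝ) := by
    push_cast [Complex.normSq_eq_conj_mul_self]
    ring
  have hkin : p θ * S₁ θ * conj (S₁ θ) = ((p θ * Complex.normSq (S₁ θ) : ℝ) : ℂ) := by
    push_cast [Complex.normSq_eq_conj_mul_self]
    ring
  simp only [Complex.imCLM_apply, ← starRingEnd_apply]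
  rw [hpot, hkin, Complex.add_im, Complex.sub_im, Complex.ofReal_im, Complex.ofReal_im,
    Complex.im_mul_ofReal]
  ring

theorem deriv_eq_zero_of_nonneg_of_eq {u u' : ℝ → ℝ} (hc : ContinuousOn u (Icc a b))
    (hd : ∀ θ ∈ Ioo a b, HasDerivAt u (u' θ) θ) (hu' : ∀ θ ∈ Ioo a b, 0 ≤ u' θ)
    (hab : u a = u b) : ∀ θ ∈ Ioo a b, u' θ = 0 := by
  intro θ hθ
  have hmono : MonotoneOn u (Icc a b) := by
    refine monotoneOn_of_deriv_nonneg (convex_Icc a b) hc ?_ ?_ <;> rw [interior_Icc]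
    · exact fun θ hθ => (hd θ hθ).differentiableAt.differentiableWithinAt
    · exact fun θ hθ => (hd θ hθ).deriv.symm ▸ hu' θ hθ
  have hle : a ≤ b := (hθ.1.trans hθ.2).le
  have hconst : ∀ s ∈ Ioo a b, u s = u a := fun s hs =>
    ((hmono (Ioo_subset_Icc_self hs) (right_mem_Icc.2 hle) hs.2.le).trans hab.ge).antisymm
      (hmono (left_mem_Icc.2 hle) (Ioo_subset_Icc_self hs) hs.1.le)
  exact (hd θ hθ).unique ((hasDerivAt_const θ (u a)).congr_of_eventuallyEq
    (eventually_of_mem (Ioo_mem_nhds hθ.1 hθ.2) hconst))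

theorem im_eq_zero_of_sturmLiouville (hp : ContinuousOn p (Icc a b)) (hpa : p a = 0)
    (hpb : p b = 0) (hSc : ContinuousOn S (Icc a b)) (hSc₁ : ContinuousOn S₁ (Icc a b))
    (hS : ∀ θ ∈ Ioo a b, HasDerivAt S (S₁ θ) θ)
    (hode : ∀ θ ∈ Ioo a b, HasDerivAt (fun s => p s * S₁ s) ((q θ - lam * ρ θ) * S θ) θ)
    (hρ : ∀ θ ∈ Ioo a b, 0 < ρ θ) (hne : ∃ θ ∈ Ioo a b, S θ ≠ 0) : lam.im = 0 := by
  obtain ⟨θ, hθ, hSθ⟩ := hne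
  by_contra hlam
  set u : ℝ → ℝ := fun s => -(lam.im)⁻¹ * (p s * S₁ s * conj (S s)).im with hu
  have hc : ContinuousOn u (Icc a b) :=
    continuousOn_const.mul (Complex.continuous_im.comp_continuousOn
      (((Complex.continuous_ofReal.comp_continuousOn hp).mul hSc₁).mul
        (Complex.continuous_conj.comp_continuousOn hSc)))
  have hd : ∀ s ∈ Ioo a b, HasDerivAt u (ρ s * Complex.normSq (S s)) s := fun s hs =>
    ((hasDerivAt_im_mul_conj (hS s hs) (hode s hs)).const_mul (-(lam.im)⁻¹)).congr_deriv
      (by field_simp)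
  have hzero := deriv_eq_zero_of_nonneg_of_eq hc hd
    (fun s hs => mul_nonneg (hρ s hs).le (Complex.normSq_nonneg _)) (by simp [hu, hpa, hpb]) θ hθ
  exact mul_ne_zero (hρ θ hθ).ne' (mt Complex.normSq_eq_zero.1 hSθ) hzero

end SturmLiouville

section Sphere

theorem contMDiff_spherePoint (φ : ℝ) :
    ContMDiff 𝓘(ℝ, ℝ) (𝓡 2) ((⊤ : ℕ∞) : WithTop ℕ∞) fun θ : ℝ => spherePoint θ φ := by
  have h : ContMDiff 𝓘(ℝ, ℝ) 𝓘(ℝ, EuclideanSpace ℝ (Fin 3)) ((⊤ : ℕ∞) : WithTop ℕ∞)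
      fun θ : ℝ => (spherePoint θ φ : EuclideanSpace ℝ (Fin 3)) := by
    rw [contMDiff_iff_contDiff, contDiff_euclidean]
    intro i
    fin_cases i
    · exact Real.contDiff_sin.mul contDiff_const
    · exact Real.contDiff_sin.mul contDiff_const
    · exact Real.contDiff_cos
  have : Fact (Module.finrank ℝ (EuclideanSpace ℝ (Fin 3)) = 2 + 1) := ⟨by simp⟩
  exact h.codRestrict_sphere (n := 2) fun θ => (spherePoint θ φ).2

theorem exists_spherePoint_eq (y : S2) : ∃ θ ∈ Icc 0 Real.pi, ∃ φ : ℝ, spherePoint θ φ = y := by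
  obtain ⟨y, hy⟩ := y
  have hsq : y 0 ^ 2 + y 1 ^ 2 + y 2 ^ 2 = 1 := by
    rw [mem_sphere_zero_iff_norm, EuclideanSpace.norm_eq, Real.sqrt_eq_one] at hy
    simpa [Fin.sum_univ_three] using hy
  have hcos : -1 ≤ y 2 ∧ y 2 ≤ 1 := by
    constructor <;> nlinarith [sq_nonneg (y 0), sq_nonneg (y 1)]
  set w : ℂ := ⟨y 0, y 1⟩
  have hnorm : ‖w‖ = Real.sin (Real.arccos (y 2)) := by
    rw [Real.sin_arccos, Complex.norm_def, Complex.normSq_mk]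
    congr 1
    linarith
  refine ⟨Real.arccos (y 2), ⟨Real.arccos_nonneg _, Real.arccos_le_pi _⟩, w.arg, ?_⟩
  ext i
  fin_cases i
  · change Real.sin (Real.arccos (y 2)) * Real.cos w.arg = y 0
    rw [← hnorm, Complex.norm_mul_cos_arg]
  · change Real.sin (Real.arccos (y 2)) * Real.sin w.arg = y 1
    rw [← hnorm, Complex.norm_mul_sin_arg]
  · exact Real.cos_arccos hcos.1 hcos.2

theorem eq_zero_of_eq_zero_off_axis {M a Q : ℝ} {ψ : ℝ × ℝ × S2 → ℂ}
    (hψ : ContinuousOn ψ (exterior M a Q))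
    (h : ∀ t : ℝ, ∀ r > rPlus M a Q, ∀ θ ∈ Ioo 0 Real.pi, ∀ φ : ℝ,
      ψ (t, r, spherePoint θ φ) = 0) : ∀ p ∈ exterior M a Q, ψ p = 0 := by
  rintro ⟨t, r, y⟩ hr
  obtain ⟨θ, hθ, φ, rfl⟩ := exists_spherePoint_eq y
  have hc : Continuous fun s : ℝ => ψ (t, r, spherePoint s φ) :=
    hψ.comp_continuous (continuous_const.prodMk
      (continuous_const.prodMk (contMDiff_spherePoint φ).continuous)) fun _ => hr
  have hsub : closure (Ioo 0 Real.pi) ⊆ {s : ℝ | ψ (t, r, spherePoint s φ) = 0} :=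
    (isClosed_eq hc continuous_const).closure_subset_iff.2 fun s hs => h t r hr s hs φ
  rw [closure_Ioo Real.pi_pos.ne] at hsub
  exact hsub hθ

end Sphere

namespace IsAngularEigenfunction

variable {a ω : ℝ} {m : ℤ} {lam : ℂ} {S : ℝ → ℂ}

theorem exists_contDiff_eqOn {ω : ℂ} (hS : IsAngularEigenfunction a ω m lam S) :
    ∃ T : ℝ → ℂ, ContDiff ℝ 2 T ∧ EqOn T S (Ioo 0 Real.pi) := by
  obtain ⟨Y, hY, hYS⟩ := hS.smooth_extension
  refine ⟨fun θ => Y (spherePoint θ 0), (contMDiff_iff_contDiff.1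
    (hY.comp (contMDiff_spherePoint 0))).of_le (WithTop.coe_le_coe.2 le_top), fun θ hθ => ?_⟩
  simpa using hYS θ hθ 0

theorem hasDerivAt_sin_mul_deriv (hS : IsAngularEigenfunction a ω m lam S) {θ : ℝ}
    (hθ : θ ∈ Ioo 0 Real.pi) : HasDerivAt (fun s : ℝ => Real.sin s * deriv S s)
      (((Real.sin θ * (m ^ 2 / Real.sin θ ^ 2 - a ^ 2 * ω ^ 2 * Real.cos θ ^ 2) : ℝ) -
        lam * Real.sin θ) * S θ) θ := by
  have hS₁ : DifferentiableAt ℝ (deriv S) θ :=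
    ((hS.contDiffOn.deriv_of_isOpen (m := 1) isOpen_Ioo (by norm_num)).contDiffAt
      (Ioo_mem_nhds hθ.1 hθ.2)).differentiableAt one_ne_zero
  have hsin : (Real.sin θ : ℂ) ≠ 0 := by exact_mod_cast (Real.sin_pos_of_mem_Ioo hθ).ne'
  refine HasDerivAt.congr_deriv
    ((Real.hasDerivAt_sin θ).ofReal_comp.differentiableAt.mul hS₁).hasDerivAt ?_
  change deriv (fun s : ℝ => (Real.sin s : ℂ) * deriv S s) θ = _
  have hode := hS.ode θ hθ
  simp only [Complex.ofReal_mul, Complex.ofReal_sub, Complex.ofReal_div, Complex.ofReal_pow,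
    Complex.ofReal_intCast]
  field_simp at hode ⊢
  linear_combination hode

theorem im_eq_zero (hS : IsAngularEigenfunction a ω m lam S) : lam.im = 0 := by
  obtain ⟨T, hT, hTS⟩ := hS.exists_contDiff_eqOn
  have hderiv : EqOn (deriv T) (deriv S) (Ioo 0 Real.pi) := hTS.deriv isOpen_Ioo
  obtain ⟨θ, hθ, hne⟩ := hS.nonzero
  refine im_eq_zero_of_sturmLiouville (a := 0) (b := Real.pi) (S := T) (S₁ := deriv T)
    (q := fun θ => Real.sin θ * (m ^ 2 / Real.sin θ ^ 2 - a ^ 2 * ω ^ 2 * Real.cos θ ^ 2))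
    Real.continuous_sin.continuousOn Real.sin_zero Real.sin_pi hT.continuous.continuousOn
    (hT.continuous_deriv one_le_two).continuousOn
    (fun θ _ => (hT.differentiable two_ne_zero θ).hasDerivAt) (fun θ hθ => ?_)
    (fun θ hθ => Real.sin_pos_of_mem_Ioo hθ) ⟨θ, hθ, (hTS hθ).symm ▸ hne⟩
  rw [hTS hθ]
  exact (hS.hasDerivAt_sin_mul_deriv hθ).congr_of_eventuallyEq
    (eventually_of_mem (Ioo_mem_nhds hθ.1 hθ.2) fun s hs => by simp only [hderiv hs])

end IsAngularEigenfunction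

section Radial

variable {M a Q ω L : ℝ} {m : ℤ} {R : ℝ → ℂ} {r z : ℝ}

theorem rPlus_sub_rMinus_pos (hsub : a ^ 2 + Q ^ 2 < M ^ 2) : 0 < rPlus M a Q - rMinus M a Q := by
  have : 0 < Real.sqrt (M ^ 2 - a ^ 2 - Q ^ 2) := Real.sqrt_pos.2 (by linarith)
  unfold rPlus rMinus
  linarith

theorem rPlus_add_rMinus : rPlus M a Q + rMinus M a Q = 2 * M := by
  unfold rPlus rMinus
  ring

theorem rPlus_mul_rMinus (hsub : a ^ 2 + Q ^ 2 < M ^ 2) :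
    rPlus M a Q * rMinus M a Q = a ^ 2 + Q ^ 2 := by
  unfold rPlus rMinus
  linear_combination -Real.sq_sqrt (by linarith : 0 ≤ M ^ 2 - a ^ 2 - Q ^ 2)

/-- The affine coordinate on `(r₊, ∞)` that puts the horizons `r₊` and `r₋` at `0` and `-1`. -/
noncomputable def radius (M a Q z : ℝ) : ℝ := rPlus M a Q + (rPlus M a Q - rMinus M a Q) * z

theorem rPlus_lt_radius (hsub : a ^ 2 + Q ^ 2 < M ^ 2) (hz : 0 < z) :
    rPlus M a Q < radius M a Q z :=
  lt_add_of_pos_right _ (mul_pos (rPlus_sub_rMinus_pos hsub) hz)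

theorem radius_div (hsub : a ^ 2 + Q ^ 2 < M ^ 2) :
    radius M a Q ((r - rPlus M a Q) / (rPlus M a Q - rMinus M a Q)) = r := by
  rw [radius, mul_div_cancel₀ _ (rPlus_sub_rMinus_pos hsub).ne', add_sub_cancel]

theorem hasDerivAt_radius : HasDerivAt (radius M a Q) (rPlus M a Q - rMinus M a Q) z :=
  (((hasDerivAt_id z).const_mul _).const_add _).congr_deriv (mul_one _)

theorem Delta_radius (hsub : a ^ 2 + Q ^ 2 < M ^ 2) :
    Delta M a Q (radius M a Q z) = (rPlus M a Q - rMinus M a Q) ^ 2 * (z * (1 + z)) := by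
  unfold Delta radius
  linear_combination (rPlus M a Q + (rPlus M a Q - rMinus M a Q) * z) *
    rPlus_add_rMinus (M := M) (a := a) (Q := Q) - rPlus_mul_rMinus hsub

theorem hasDerivAt_Delta : HasDerivAt (Delta M a Q) (2 * (r - M)) r := by
  refine (((((hasDerivAt_id r).pow 2).sub ((hasDerivAt_id r).const_mul (2 * M))).add_const
    (a ^ 2)).add_const (Q ^ 2)).congr_deriv ?_
  simp only [id, mul_one, Nat.cast_ofNat]
  ring

/-- The parameter `α` of the confluent Heun equation: the radial equation has exponents `± iα` at
`r₊`. -/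
noncomputable def heunAlpha (M a Q ω : ℝ) (m : ℤ) : ℝ :=
  (a * m - (rPlus M a Q ^ 2 + a ^ 2) * ω) / (rPlus M a Q - rMinus M a Q)

/-- The parameter `γ` of the confluent Heun equation: the radial equation has exponents `± iγ` at
`r₋`. -/
noncomputable def heunGamma (M a Q ω : ℝ) (m : ℤ) : ℝ :=
  ((rMinus M a Q ^ 2 + a ^ 2) * ω - a * m) / (rPlus M a Q - rMinus M a Q)

/-- The parameter `Ω` of the confluent Heun equation: the frequency `2ω` in the variable `z`. -/
noncomputable def heunOmega (M a Q ω : ℝ) : ℝ := 2 * ω * (rPlus M a Q - rMinus M a Q)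

/-- The parameter `Λ` of the confluent Heun equation, where `L` is the angular eigenvalue `λ`. -/
noncomputable def heunLambda (a ω L : ℝ) (m : ℤ) : ℝ := L + a ^ 2 * ω ^ 2 - 2 * a * m * ω

/-- The phase conjugating the radial equation to the confluent Heun equation. -/
noncomputable def heunPhase (M a Q ω : ℝ) (m : ℤ) (z : ℝ) : ℝ :=
  phase (heunOmega M a Q ω) (heunAlpha M a Q ω m) (heunGamma M a Q ω m) z

/-- The solution of the confluent Heun equation obtained from a radial function. -/
noncomputable def heunOfRadial (M a Q ω : ℝ) (m : ℤ) (R : ℝ → ℂ) (z : ℝ) : ℂ :=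
  Complex.exp (Complex.I * heunPhase M a Q ω m z) * R (radius M a Q z)

theorem heunOmega_ne_zero (hsub : a ^ 2 + Q ^ 2 < M ^ 2) (hω : ω ≠ 0) : heunOmega M a Q ω ≠ 0 :=
  mul_ne_zero (mul_ne_zero two_ne_zero hω) (rPlus_sub_rMinus_pos hsub).ne'

theorem heunOmega_mul_nonpos (hM : 0 ≤ M) (hsub : a ^ 2 + Q ^ 2 < M ^ 2) :
    heunOmega M a Q ω * (heunAlpha M a Q ω m + heunGamma M a Q ω m) ≤ 0 := by
  have hs := rPlus_sub_rMinus_pos hsub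
  have h : heunOmega M a Q ω * (heunAlpha M a Q ω m + heunGamma M a Q ω m) =
      -(4 * M * ω ^ 2 * (rPlus M a Q - rMinus M a Q)) := by
    unfold heunOmega heunAlpha heunGamma
    field_simp
    linear_combination (-2 * ω ^ 2 * (rPlus M a Q - rMinus M a Q)) *
      rPlus_add_rMinus (M := M) (a := a) (Q := Q)
  rw [h]
  exact neg_nonpos.2 (by positivity)

theorem Delta_mul_phaseDeriv (hsub : a ^ 2 + Q ^ 2 < M ^ 2) (hz : 0 < z) :
    Delta M a Q (radius M a Q z) *
        phaseDeriv (heunOmega M a Q ω) (heunAlpha M a Q ω m) (heunGamma M a Q ω m) z =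
      (rPlus M a Q - rMinus M a Q) * (a * m - (radius M a Q z ^ 2 + a ^ 2) * ω) := by
  have hs := (rPlus_sub_rMinus_pos hsub).ne'
  rw [Delta_radius hsub, mul_assoc, mul_phaseDeriv hz]
  unfold heunOmega heunAlpha heunGamma radius
  field_simp
  ring

theorem sq_div_Delta_radius (hsub : a ^ 2 + Q ^ 2 < M ^ 2) (hz : 0 < z) :
    (a * m - (radius M a Q z ^ 2 + a ^ 2) * ω) ^ 2 / Delta M a Q (radius M a Q z) =
      z * (1 + z) *
        phaseDeriv (heunOmega M a Q ω) (heunAlpha M a Q ω m) (heunGamma M a Q ω m) z ^ 2 := by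
  have hs := (rPlus_sub_rMinus_pos hsub).ne'
  have h := Delta_mul_phaseDeriv (ω := ω) (m := m) hsub hz
  rw [Delta_radius hsub] at h ⊢
  rw [div_eq_iff (by positivity)]
  refine mul_left_cancel₀ (pow_ne_zero 2 hs) ?_
  rw [← mul_pow, ← h]
  ring

theorem IsRadialSolution.ode_expanded (hR : IsRadialSolution M a Q ω m L R)
    (hr : rPlus M a Q < r) (hΔ : Delta M a Q r ≠ 0) :
    Delta M a Q r * deriv (deriv R) r + 2 * (r - M) * deriv R r +
      ((a * m - (r ^ 2 + a ^ 2) * ω) ^ 2 / Delta M a Q r - heunLambda a ω L m) * R r = 0 := by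
  have hR₁ : DifferentiableAt ℝ (deriv R) r :=
    ((hR.contDiffOn.deriv_of_isOpen (m := 1) isOpen_Ioi le_rfl).contDiffAt
      (Ioi_mem_nhds hr)).differentiableAt one_ne_zero
  have hode := hR.ode r hr
  rw [show deriv (fun s : ℝ => (Delta M a Q s : ℂ) * deriv R s) r = _ from
    (hasDerivAt_Delta.ofReal_comp.mul hR₁.hasDerivAt).deriv] at hode
  have hc : (Delta M a Q r : ℂ) ≠ 0 := by exact_mod_cast hΔ
  have hexpand : (Delta M a Q r : ℂ) = r ^ 2 - 2 * M * r + a ^ 2 + Q ^ 2 := by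
    simp only [Delta]
    push_cast
    ring
  have hpot : ((a * m - (r ^ 2 + a ^ 2) * ω) ^ 2 / Delta M a Q r - heunLambda a ω L m : ℂ) =
      -(ω ^ 2 * (a ^ 2 - (a ^ 2 + r ^ 2) ^ 2 / Delta M a Q r)) +
        a ^ 2 * m ^ 2 / Delta M a Q r -
        2 * a * m * ω * (2 * M * r - Q ^ 2) / Delta M a Q r - L := by
    rw [show (2 * M * r - Q ^ 2 : ℂ) = r ^ 2 + a ^ 2 - Delta M a Q r by rw [hexpand]; ring]
    simp only [heunLambda]
    push_cast
    field_simp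
    ring
  rw [hpot]
  push_cast at hode
  linear_combination hode

theorem eqOn_deriv_comp_radius (hsub : a ^ 2 + Q ^ 2 < M ^ 2) {n : WithTop ℕ∞} (hn : n ≠ 0)
    (hR : ContDiffOn ℝ n R (Ioi (rPlus M a Q))) :
    EqOn (deriv fun z => R (radius M a Q z))
      (fun z => ((rPlus M a Q - rMinus M a Q : ℝ) : ℂ) * deriv R (radius M a Q z)) (Ioi 0) :=
  fun _ hz => ((((hR.contDiffAt (Ioi_mem_nhds (rPlus_lt_radius hsub hz))).differentiableAt
    hn).hasDerivAt.scomp _ hasDerivAt_radius).congr_deriv Complex.real_smul).deriv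

theorem IsRadialSolution.isHeunSolution (hsub : a ^ 2 + Q ^ 2 < M ^ 2)
    (hR : IsRadialSolution M a Q ω m L R) :
    IsHeunSolution (heunOmega M a Q ω) (heunAlpha M a Q ω m) (heunGamma M a Q ω m)
      (heunLambda a ω L m) (heunOfRadial M a Q ω m R) := by
  set s := rPlus M a Q - rMinus M a Q with hs
  have hs0 : s ≠ 0 := (rPlus_sub_rMinus_pos hsub).ne'
  have hmaps : MapsTo (radius M a Q) (Ioi 0) (Ioi (rPlus M a Q)) := fun z hz =>
    rPlus_lt_radius hsub hz
  have hR₁ : ContDiffOn ℝ 1 (deriv R) (Ioi (rPlus M a Q)) :=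
    hR.contDiffOn.deriv_of_isOpen isOpen_Ioi le_rfl
  have hu₁ := eqOn_deriv_comp_radius hsub two_ne_zero hR.contDiffOn
  refine isHeunSolution_exp_phase_mul (hR.contDiffOn.comp (by unfold radius; fun_prop) hmaps)
    fun z hz => ?_
  have hΔ : Delta M a Q (radius M a Q z) ≠ 0 := by
    rw [Delta_radius hsub]
    positivity
  have hdrift : 2 * (radius M a Q z - M) = s * (1 + 2 * z) := by
    unfold radius
    linear_combination rPlus_add_rMinus (M := M) (a := a) (Q := Q)
  have hdriftc := congrArg Complex.ofReal hdrift
  have hpotc := congrArg Complex.ofReal (sq_div_Delta_radius (ω := ω) (m := m) hsub hz)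
  have hode := hR.ode_expanded (hmaps hz) hΔ
  push_cast at hpotc hdriftc
  rw [hpotc, hdriftc, Delta_radius hsub, ← hs] at hode
  rw [hu₁.deriv isOpen_Ioi hz, deriv_const_mul_field, hu₁ hz,
    eqOn_deriv_comp_radius hsub one_ne_zero hR₁ hz]
  push_cast at hode
  linear_combination hode

end Radial

section BoundaryConditions

variable {M a Q ω L : ℝ} {m : ℤ} {R : ℝ → ℂ} {r z : ℝ}

theorem horizonExponent_eq (hsub : a ^ 2 + Q ^ 2 < M ^ 2) :
    horizonExponent M a Q ω m = Complex.I * heunAlpha M a Q ω m := by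
  have h : rPlus M a Q ^ 2 + a ^ 2 = 2 * M * rPlus M a Q - Q ^ 2 := by
    linear_combination rPlus M a Q * rPlus_add_rMinus (M := M) (a := a) (Q := Q) -
      rPlus_mul_rMinus hsub
  unfold horizonExponent heunAlpha
  rw [h]
  push_cast
  ring

theorem log_radius_sub_rPlus (hsub : a ^ 2 + Q ^ 2 < M ^ 2) (hz : 0 < z) :
    Real.log (radius M a Q z - rPlus M a Q) =
      Real.log (rPlus M a Q - rMinus M a Q) + Real.log z := by
  rw [radius, add_sub_cancel_left, Real.log_mul (rPlus_sub_rMinus_pos hsub).ne' hz.ne']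

theorem log_radius_sub_rMinus (hsub : a ^ 2 + Q ^ 2 < M ^ 2) (hz : 0 < z) :
    Real.log (radius M a Q z - rMinus M a Q) =
      Real.log (rPlus M a Q - rMinus M a Q) + Real.log (1 + z) := by
  rw [← Real.log_mul (rPlus_sub_rMinus_pos hsub).ne' (by positivity), radius]
  congr 1
  ring

theorem continuous_radius : Continuous (radius M a Q) := by
  unfold radius
  fun_prop

theorem tendsto_radius_nhdsGT (hsub : a ^ 2 + Q ^ 2 < M ^ 2) :
    Tendsto (radius M a Q) (𝓝[>] 0) (𝓝[>] (rPlus M a Q)) :=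
  tendsto_nhdsWithin_of_tendsto_nhds_of_eventually_within _
    ((continuous_radius.tendsto' 0 _ (by simp [radius])).mono_left nhdsWithin_le_nhds)
    (eventually_mem_of_tendsto_nhdsWithin tendsto_id |>.mono fun _ hz => rPlus_lt_radius hsub hz)

/-- The smooth factor left when `(r - r₊) ^ ξ` and the phase are written as powers of `z`. -/
noncomputable def horizonFactor (M a Q ω : ℝ) (m : ℤ) (F : ℝ → ℂ) (z : ℝ) : ℂ :=
  Complex.exp (Complex.I * ((heunAlpha M a Q ω m * Real.log (rPlus M a Q - rMinus M a Q) +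
    heunGamma M a Q ω m * Real.log (1 + z) - heunOmega M a Q ω / 2 * z : ℝ) : ℂ)) *
    F (radius M a Q z)

theorem contDiffAt_horizonFactor {n : WithTop ℕ∞} {F : ℝ → ℂ}
    (hF : ContDiffAt ℝ n F (rPlus M a Q)) : ContDiffAt ℝ n (horizonFactor M a Q ω m F) 0 := by
  have hlog : ContDiffAt ℝ n (fun z : ℝ => Real.log (1 + z)) 0 :=
    (contDiffAt_const.add contDiffAt_id).log (by simp)
  have hexp : ContDiffAt ℝ n (fun z : ℝ => Complex.exp (Complex.I *
      ((heunAlpha M a Q ω m * Real.log (rPlus M a Q - rMinus M a Q) +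
        heunGamma M a Q ω m * Real.log (1 + z) - heunOmega M a Q ω / 2 * z : ℝ) : ℂ))) 0 :=
    (contDiffAt_const.mul (Complex.ofRealCLM.contDiff.contDiffAt.comp (0 : ℝ)
      ((contDiffAt_const.add (contDiffAt_const.mul hlog)).sub
        (contDiffAt_const.mul contDiffAt_id)))).cexp
  exact hexp.mul (ContDiffAt.comp (0 : ℝ) (by simpa [radius] using hF)
    (contDiffAt_const.add (contDiffAt_const.mul contDiffAt_id)))

theorem heunOfRadial_eq_horizonFactor (hsub : a ^ 2 + Q ^ 2 < M ^ 2) {F : ℝ → ℂ} (hz : 0 < z)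
    (hF : R (radius M a Q z) * ((radius M a Q z - rPlus M a Q : ℝ) : ℂ) ^
      (-horizonExponent M a Q ω m) = F (radius M a Q z)) :
    heunOfRadial M a Q ω m R z =
      (z : ℂ) ^ (2 * Complex.I * heunAlpha M a Q ω m) * horizonFactor M a Q ω m F z := by
  have hpos : 0 < radius M a Q z - rPlus M a Q := sub_pos.2 (rPlus_lt_radius hsub hz)
  have hpos0 : ((radius M a Q z - rPlus M a Q : ℝ) : ℂ) ≠ 0 := by exact_mod_cast hpos.ne'
  have hz0 : (z : ℂ) ≠ 0 := by exact_mod_cast hz.ne'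
  rw [heunOfRadial, horizonFactor, ← hF, horizonExponent_eq hsub,
    Complex.cpow_def_of_ne_zero hz0, Complex.cpow_def_of_ne_zero hpos0,
    ← Complex.ofReal_log hpos.le, ← Complex.ofReal_log hz.le, log_radius_sub_rPlus hsub hz,
    mul_left_comm _ (R _), mul_left_comm _ (R _), mul_comm _ (R _), ← Complex.exp_add,
    ← Complex.exp_add, heunPhase, phase]
  congr 2
  push_cast
  ring

theorem RegularAtHorizon.exists_contDiffAt (hsub : a ^ 2 + Q ^ 2 < M ^ 2)
    (hR : RegularAtHorizon M a Q ω m R) :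
    ∃ h : ℝ → ℂ, ContDiffAt ℝ 2 h 0 ∧ heunOfRadial M a Q ω m R =ᶠ[𝓝[>] 0]
      fun z : ℝ => (z : ℂ) ^ (2 * Complex.I * heunAlpha M a Q ω m) * h z := by
  obtain ⟨F, hF, hRF⟩ := hR
  refine ⟨horizonFactor M a Q ω m F,
    contDiffAt_horizonFactor (hF.of_le (WithTop.coe_le_coe.2 le_top)), ?_⟩
  filter_upwards [(tendsto_radius_nhdsGT hsub).eventually hRF, self_mem_nhdsWithin] with z hz hz0
  exact heunOfRadial_eq_horizonFactor hsub hz0 hz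

theorem heunPhase_add_rStar (hsub : a ^ 2 + Q ^ 2 < M ^ 2) (hz : 0 < z) :
    heunPhase M a Q ω m z + ω * rStar M a Q (radius M a Q z) =
      ω * rPlus M a Q + 2 * M * ω * Real.log (rPlus M a Q - rMinus M a Q) -
        a * m / (rPlus M a Q - rMinus M a Q) * Real.log (1 + z⁻¹) := by
  have hs := (rPlus_sub_rMinus_pos hsub).ne'
  have hlog : Real.log (1 + z⁻¹) = Real.log (1 + z) - Real.log z := by
    rw [← Real.log_div (by positivity) hz.ne']
    congr 1
    field_simp
    ring
  rw [hlog, ← rPlus_add_rMinus (M := M) (a := a) (Q := Q), heunPhase, phase, rStar,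
    log_radius_sub_rPlus hsub hz, log_radius_sub_rMinus hsub hz]
  unfold heunOmega heunAlpha heunGamma radius
  field_simp
  ring

theorem exists_tendsto_exp_heunPhase_add_rStar (hsub : a ^ 2 + Q ^ 2 < M ^ 2) :
    ∃ c, Tendsto (fun z : ℝ => Complex.exp (Complex.I *
      (heunPhase M a Q ω m z + ω * rStar M a Q (radius M a Q z) : ℝ))) atTop (𝓝 c) := by
  have hlog : Tendsto (fun z : ℝ => Real.log (1 + z⁻¹)) atTop (𝓝 (Real.log (1 + 0))) :=
    (tendsto_inv_atTop_zero.const_add 1).log (by simp)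
  have hphase : Tendsto (fun z => heunPhase M a Q ω m z + ω * rStar M a Q (radius M a Q z))
      atTop (𝓝 _) :=
    ((hlog.const_mul (a * m / (rPlus M a Q - rMinus M a Q))).const_sub
      (ω * rPlus M a Q + 2 * M * ω * Real.log (rPlus M a Q - rMinus M a Q))).congr'
      ((eventually_gt_atTop 0).mono fun z hz => (heunPhase_add_rStar hsub hz).symm)
  exact ⟨_, (((Complex.continuous_ofReal.tendsto _).comp hphase).const_mul Complex.I).cexp⟩

theorem OutgoingAtInfinity.exists_tendsto (hR : OutgoingAtInfinity M a Q ω R) :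
    ∃ c, Tendsto (fun r : ℝ => r * (Complex.exp (-(Complex.I * ω * rStar M a Q r)) * R r))
      atTop (𝓝 c) := by
  obtain ⟨C, hC⟩ := hR
  have hO := hC 1 le_rfl
  simp only [Finset.sum_range_succ, Finset.sum_range_zero, pow_zero, pow_one, inv_one, mul_one,
    zero_add] at hO
  set E : ℝ → ℂ := fun r => Complex.exp (Complex.I * ω * rStar M a Q r) / r *
    (C 0 + C 1 * (r : ℂ)⁻¹) with hE
  have hexp : (fun r : ℝ => Complex.exp (-(Complex.I * ω * rStar M a Q r))) =O[atTop]
      fun _ => (1 : ℝ) := by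
    refine IsBigO.of_norm_le fun r => ?_
    simp [Complex.norm_exp]
  have hrem : Tendsto (fun r : ℝ => r * (Complex.exp (-(Complex.I * ω * rStar M a Q r)) *
      (R r - E r))) atTop (𝓝 0) := by
    have hid : (fun r : ℝ => (r : ℂ)) =O[atTop] fun r : ℝ => r :=
      Complex.isBigO_ofReal_left.2 (isBigO_refl _ _)
    refine (hid.mul (hexp.mul hO)).trans_tendsto ?_
    refine (tendsto_pow_neg_atTop (𝕜 := ℝ) two_ne_zero).congr' ?_
    filter_upwards [eventually_gt_atTop 0] with r hr
    rw [zpow_neg, zpow_natCast]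
    field_simp
  have hlead : Tendsto (fun r : ℝ => C 0 + C 1 * (r : ℂ)⁻¹) atTop (𝓝 (C 0 + C 1 * 0)) := by
    have hinv : Tendsto (fun r : ℝ => (r : ℂ)⁻¹) atTop (𝓝 0) := by
      refine ((Complex.continuous_ofReal.tendsto' 0 0 Complex.ofReal_zero).comp
        tendsto_inv_atTop_zero).congr fun r => by simp
    exact (hinv.const_mul _).const_add _
  refine ⟨_, (hrem.add hlead).congr' ?_⟩
  filter_upwards [eventually_gt_atTop 0] with r hr
  have hr0 : (r : ℂ) ≠ 0 := by exact_mod_cast hr.ne'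
  have hcancel := Complex.exp_ne_zero (Complex.I * ω * rStar M a Q r)
  simp only [hE, Complex.exp_neg]
  field_simp
  ring

theorem tendsto_radius_atTop (hsub : a ^ 2 + Q ^ 2 < M ^ 2) :
    Tendsto (radius M a Q) atTop atTop :=
  tendsto_atTop_add_const_left _ _ (tendsto_id.const_mul_atTop (rPlus_sub_rMinus_pos hsub))

theorem tendsto_one_add_div_radius (hsub : a ^ 2 + Q ^ 2 < M ^ 2) :
    Tendsto (fun z => (1 + z) / radius M a Q z) atTop (𝓝 (rPlus M a Q - rMinus M a Q)⁻¹) := by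
  have hs := (rPlus_sub_rMinus_pos hsub).ne'
  have hinv := tendsto_inv_atTop_zero.comp (tendsto_radius_atTop hsub)
  have h := (hinv.const_mul (1 - rPlus M a Q * (rPlus M a Q - rMinus M a Q)⁻¹)).const_add
    (rPlus M a Q - rMinus M a Q)⁻¹
  rw [mul_zero, add_zero] at h
  refine h.congr' ?_
  filter_upwards [(tendsto_radius_atTop hsub).eventually_ne_atTop 0] with z hz
  simp only [Function.comp_apply]
  field_simp
  unfold radius
  ring

theorem OutgoingAtInfinity.exists_tendsto_heunOfRadial (hsub : a ^ 2 + Q ^ 2 < M ^ 2)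
    (hR : OutgoingAtInfinity M a Q ω R) :
    ∃ c, Tendsto (fun z : ℝ => (1 + z) * heunOfRadial M a Q ω m R z) atTop (𝓝 c) := by
  obtain ⟨c, hc⟩ := hR.exists_tendsto
  obtain ⟨d, hd⟩ := exists_tendsto_exp_heunPhase_add_rStar (ω := ω) (m := m) hsub
  have hratio := (Complex.continuous_ofReal.tendsto _).comp (tendsto_one_add_div_radius hsub)
  refine ⟨_, ((hratio.mul (hc.comp (tendsto_radius_atTop hsub))).mul hd).congr' ?_⟩
  filter_upwards [(tendsto_radius_atTop hsub).eventually_ne_atTop 0] with z hz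
  have hz0 : (radius M a Q z : ℂ) ≠ 0 := by exact_mod_cast hz
  have hcancel := Complex.exp_ne_zero (Complex.I * ω * rStar M a Q (radius M a Q z))
  simp only [Function.comp_apply, heunOfRadial, Complex.exp_neg]
  push_cast
  rw [mul_add, Complex.exp_add, ← mul_assoc Complex.I]
  field_simp

theorem IsRadialSolution.eq_zero (hM : 0 ≤ M) (hsub : a ^ 2 + Q ^ 2 < M ^ 2) (hω : ω ≠ 0)
    (hR : IsRadialSolution M a Q ω m L R) (hhor : RegularAtHorizon M a Q ω m R)
    (hinf : OutgoingAtInfinity M a Q ω R) (hr : rPlus M a Q < r) : R r = 0 := by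
  obtain ⟨h, hh, hfh⟩ := hhor.exists_contDiffAt hsub
  have hmode : IsHeunMode _ _ _ _ (heunOfRadial M a Q ω m R) h :=
    ⟨hR.isHeunSolution hsub, hh, hfh, hinf.exists_tendsto_heunOfRadial hsub⟩
  have h0 := hmode.eq_zero (heunOmega_ne_zero hsub hω) (heunOmega_mul_nonpos hM hsub)
    ((r - rPlus M a Q) / (rPlus M a Q - rMinus M a Q))
    (div_pos (sub_pos.2 hr) (rPlus_sub_rMinus_pos hsub))
  rw [heunOfRadial, radius_div hsub] at h0
  exact (mul_eq_zero.1 h0).resolve_left (Complex.exp_ne_zero _)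

end BoundaryConditions

end KerrNewman

/-- Mode stability on the real axis: a mode solution of the wave equation on a subextremal
Kerr–Newman exterior with real frequency `ω ≠ 0` vanishes identically. -/
theorem theorem3p2 (M a Q : ℝ) (hM : 0 < M) (hsub : a ^ 2 + Q ^ 2 < M ^ 2)
    (ω : ℝ) (hω : ω ≠ 0) (ψ : ℝ × ℝ × KerrNewman.S2 → ℂ)
    (hψ : KerrNewman.IsModeSolution M a Q ψ (ω : ℂ)) :
    ∀ p ∈ KerrNewman.exterior M a Q, ψ p = 0 := by
  obtain ⟨⟨hsmooth, -⟩, -, m, lam, R, S, hform, hS, hR, hhor, hinf⟩ := hψ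
  have hlam : lam = ((lam.re : ℝ) : ℂ) := Complex.ext rfl hS.im_eq_zero
  rw [hlam] at hR
  refine KerrNewman.eq_zero_of_eq_zero_off_axis hsmooth.continuousOn fun t r hr θ hθ φ => ?_
  rw [hform t r hr θ hθ φ, hR.eq_zero hM.le hsub hω hhor hinf hr]
  simp only [zero_mul]
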